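/- All graphs are finite and simple. For a cubic (3-regular) graph $G$ and a vertex $v$ with neighbours $x_1,x_2,x_3$, let $G^v$ be the cubic graph obtained by replacing $v$ with a triangle $v_1v_2v_3$, where $v_i$ is joined to $x_i$; a \emph{descendant} of $G$ is a graph obtained from $G$ by a non-empty sequence of such replacements. An edge of a graph is \emph{lonely} if it belongs to exactly one perfect matching, and $\mathcal U_3$ is the class of 3-connected cubic graphs with exactly three lonely edges. The \emph{prism} is obtained from $K_4$ by replacing one vertex with a triangle $T$; label the vertices of $T$ by $x_1,x_2,x_3$. Given a cubic graph with a triangle labelled $x_1,x_2,x_3$ and $s\in\{1,2,3\}$, the extension of index $s$ replaces $x_s$ with a new triangle, whose vertices are again labelled $x_1,x_2,x_3$ in such a way that for both $j\ne s$ the new $x_j$ is adjacent to the old $x_j$. The \emph{extended prism with pattern $(s_1,\dots,s_m)$} is the graph obtained from the prism by applying extensions of indices $s_1,\dots,s_m$ consecutively, starting at $T$ and each time continuing with the new triangle. (Up to isomorphism it does not depend on the labelling of $T$.) The \emph{tricorn} is the graph with vertices $0,1,\dots,9$ whose edges are $01,02,03,14,15,26,27,38,39$ and those of the $6$-cycle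 $4\,5\,6\,7\,8\,9$. Let $\mathcal W_3$ consist of the tricorn, its descendants that lie in $\mathcal U_3$, and the extended prism with pattern $(3,1,3)$ (all up to isomorphism). \textbf{Theorem.} Up to isomorphism the tricorn has exactly three descendants in $\mathcal U_3$. A graph $G$ belongs to $\mathcal U_3$ if and only if either $G\in\mathcal W_3$ or $G$ is isomorphic to an extended prism with pattern $$(\underbrace{3,\dots,3}_{h-1\text{ times}},\,2,\,\underbrace{1,\dots,1}_{k-h\text{ times}})$$ for some integers $k\ge 3$ and $1\le h\le k$. -/

import Mathlib

namespace LonelyEdge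

/-- The vertex set of `G^v`: `v` is removed and replaced by one new vertex `v_x` for each
neighbour `x` of `v`.  (`Sum.inl` are the old vertices, `Sum.inr x` is `v_x`.) -/
abbrev ExpandVert {V : Type*} (G : SimpleGraph V) (v : V) : Type _ :=
  {w : V // w ≠ v} ⊕ (G.neighborSet v)

/-- Adjacency in `G^v`: old edges avoiding `v` stay, `v_x` is joined to `x`, and the new vertices
are pairwise adjacent. -/
def expandAdj {V : Type*} (G : SimpleGraph V) (v : V) : ExpandVert G v → ExpandVert G v → Prop
  | Sum.inl a, Sum.inl b => G.Adj a.1 b.1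
  | Sum.inl a, Sum.inr x => a.1 = x.1
  | Sum.inr x, Sum.inl a => a.1 = x.1
  | Sum.inr x, Sum.inr y => x ≠ y

/-- The graph `G^v` obtained from a cubic graph `G` by replacing the vertex `v` with a triangle. -/
def expand {V : Type*} (G : SimpleGraph V) (v : V) : SimpleGraph (ExpandVert G v) where
  Adj := expandAdj G v
  symm := ⟨by
    rintro (a | x) (b | y) h
    · exact SimpleGraph.Adj.symm h
    · exact h
    · exact h
    · exact Ne.symm h⟩
  loopless := ⟨by
    rintro (a | x) h
    · exact G.irrefl h
    · exact h rfl⟩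

/-- A graph is cubic if every vertex has exactly three neighbours. -/
def IsCubic {V : Type*} (G : SimpleGraph V) : Prop :=
  ∀ v : V, (G.neighborSet v).ncard = 3

/-- (Vertex-)3-connectedness: more than three vertices, and deleting fewer than three vertices
always leaves a connected graph. -/
def IsThreeConnected {V : Type*} (G : SimpleGraph V) : Prop :=
  3 < Nat.card V ∧ ∀ S : Set V, S.ncard < 3 → (G.induce Sᶜ).Connected

/-- An edge is lonely if it belongs to exactly one perfect matching. -/
def IsLonely {V : Type*} (G : SimpleGraph V) (e : Sym2 V) : Prop :=
  e ∈ G.edgeSet ∧ ∃! M : G.Subgraph, M.IsPerfectMatching ∧ e ∈ M.edgeSet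

/-- The number `l(G)` of lonely edges of a (finite) graph. -/
noncomputable def numLonely {V : Type*} (G : SimpleGraph V) : ℕ :=
  {e : Sym2 V | IsLonely G e}.ncard

/-- The class `𝒰₃`: 3-connected cubic graphs with exactly three lonely edges. -/
def InU3 {V : Type*} (G : SimpleGraph V) : Prop :=
  IsCubic G ∧ IsThreeConnected G ∧ numLonely G = 3

/-- `H` is a descendant of `G` if it arises from `G` by a (nonempty) sequence of replacements of a
vertex with a triangle. -/
inductive IsDescendant {V : Type*} (G : SimpleGraph V) :
    ∀ {W : Type _}, SimpleGraph W → Prop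
  | child (v : V) : IsDescendant G (expand G v)
  | step {W : Type _} {H : SimpleGraph W} (w : W) :
      IsDescendant G H → IsDescendant G (expand H w)

/-- The tricorn, on ten vertices. -/
def tricorn : SimpleGraph (Fin 10) :=
  SimpleGraph.fromEdgeSet
    {s(0, 1), s(0, 2), s(0, 3), s(1, 4), s(1, 5), s(2, 6), s(2, 7), s(3, 8), s(3, 9),
     s(4, 5), s(5, 6), s(6, 7), s(7, 8), s(8, 9), s(9, 4)}

/-- `x` labels the three vertices of the new triangle of `G^v`. -/
def LabelsNewTriangle {V : Type*} {G : SimpleGraph V} {v : V} (x : Fin 3 → ExpandVert G v) :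
    Prop :=
  Function.Injective x ∧ ∀ i, ∃ y : G.neighborSet v, x i = Sum.inr y

/-- The relabelling rule for the extension of index `s` of a graph `G` at a triangle with labelled
vertices `x`: the labelling `x'` of the new triangle of `G^{x_s}` is such that, for both `j ≠ s`,
the new vertex `x'_j` is adjacent to the old vertex `x_j`. -/
def IsRelabelling {V : Type*} (G : SimpleGraph V) (x : Fin 3 → V) (s : Fin 3)
    (x' : Fin 3 → ExpandVert G (x s)) : Prop :=
  LabelsNewTriangle x' ∧
    ∀ j, j ≠ s → ∃ h : x j ≠ x s, (expand G (x s)).Adj (x' j) (Sum.inl ⟨x j, h⟩)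

/-- `IsExtension G x p H`: the graph `H` is isomorphic to the graph obtained from `G` by
consecutively applying extensions whose indices are the entries of `p`, starting at the triangle of
`G` with labelled vertices `x` and updating this triangle to the new triangle each time. -/
def IsExtension {W : Type*} : ∀ {V : Type}, SimpleGraph V → (Fin 3 → V) → List (Fin 3) →
    SimpleGraph W → Prop
  | _, G, _, [], H => Nonempty (H ≃g G)
  | _, G, x, s :: p, H => ∃ x' : Fin 3 → ExpandVert G (x s),
      IsRelabelling G x s x' ∧ IsExtension (expand G (x s)) x' p H

/-- The prism, obtained from `K₄` by replacing a vertex with a triangle. -/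
def prism : SimpleGraph (ExpandVert (⊤ : SimpleGraph (Fin 4)) 3) :=
  expand (⊤ : SimpleGraph (Fin 4)) 3

/-- `H` is isomorphic to an extended prism with extension pattern `p`; the extensions are applied at
the triangle `T_v` of the prism.  The elements `0, 1, 2` of `Fin 3` stand for the indices
`1, 2, 3`, respectively. -/
def IsExtendedPrism {W : Type*} (H : SimpleGraph W) (p : List (Fin 3)) : Prop :=
  ∃ x : Fin 3 → ExpandVert (⊤ : SimpleGraph (Fin 4)) 3,
    LabelsNewTriangle x ∧ IsExtension prism x p H

/-- The indices `1`, `2`, `3` as elements of `Fin 3`. -/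
abbrev i1 : Fin 3 := 0
abbrev i2 : Fin 3 := 1
abbrev i3 : Fin 3 := 2

/-- `G` is isomorphic to a descendant in `𝒰₃` of the tricorn. -/
def IsTricornDescendantInU3 {V : Type*} (G : SimpleGraph V) : Prop :=
  InU3 G ∧ ∃ (W : Type) (H : SimpleGraph W), IsDescendant tricorn H ∧ Nonempty (G ≃g H)

/-- The class `𝒲₃`: the tricorn, its descendants in `𝒰₃`, and the extended prism with pattern
`(3, 1, 3)`. -/
def InW3 {V : Type*} (G : SimpleGraph V) : Prop :=
  Nonempty (G ≃g tricorn) ∨ IsTricornDescendantInU3 G ∨ IsExtendedPrism G [i3, i1, i3]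

end LonelyEdge

/-! Write `G^v` for the expansion of `G` at `v`. Three edges leave its new triangle, and a perfect
matching uses one or three of them. The matchings that use one are in bijection with the perfect
matchings of `G` (`lift`); those that use three correspond to the perfect matchings of `G - N[v]`
(`lift3`). Everything about lonely edges is read off from this dichotomy (`IsPM.eq_lift_or`).

Reduction to Klee graphs. Let a perfect matching `σ` of a cubic 3-connected graph with more than
four vertices be the only one through some edge. Removing a further edge of `σ` destroys a matching,
so Tutte's theorem supplies a barrier. Since every cut has at least three edges, counting the edges
at the barrier forces equality throughout, and this yields a triangle that contains an edge of `σ`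
(`exists_triangle`). Contracting it keeps the graph cubic and 3-connected, and the lonely edge
survives. By induction the graph arises from `K₄` by replacing vertices with triangles
(`klee_of_lonely`). In a Klee graph every edge lies in a perfect matching and every `G - N[v]` has
one, whence an expansion never increases the number of lonely edges (`Klee.numLonely_expand_le`).

Structure of Klee graphs. Expansions at distinct old vertices commute. Rearranging them shows that
`K^z` is either built by always expanding inside the newest triangle, and then is an extended prism,
or at some stage two vertices of one new triangle are expanded. The latter creates a tricorn, and
`K^z` is the tricorn or one of its descendants (`Klee.isTower_or`).

Extended prisms. Sort the lonely edges by the edge of the newest triangle that their matching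
contains. The three resulting numbers start as (2, 2, 2), and an extension of index `s` lowers entry
`s` by one, if it is positive, and exchanges the other two (`TriangleState.shift`). So the number of
lonely edges depends on the pattern only, and tracking the triples shows which patterns give three:
(3,1,3) and the stated family, up to a permutation of the indices.

Tricorn. It has three lonely edges. An expansion keeps all of them only at the three neighbours of
the centre, each of which may be expanded once. By symmetry this leaves one descendant on each of
12, 14 and 16 vertices; any other expansion loses a lonely edge for good. -/

namespace LonelyEdge

/-! ### Perfect matchings as involutions -/

/-- A perfect matching, given by the map that sends every vertex to its partner. -/
def IsPM {V : Type*} (G : SimpleGraph V) (σ : V → V) : Prop :=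
  ∀ a, G.Adj a (σ a) ∧ σ (σ a) = a

/-- The edge `e` joins a vertex to its partner. -/
def HasEdge {V : Type*} (σ : V → V) (e : Sym2 V) : Prop := ∃ a, e = s(a, σ a)

section
variable {V : Type*} {G : SimpleGraph V} {σ τ : V → V}

theorem IsPM.adj (h : IsPM G σ) (a : V) : G.Adj a (σ a) := (h a).1

theorem IsPM.invol (h : IsPM G σ) (a : V) : σ (σ a) = a := (h a).2

theorem IsPM.eq_comm (h : IsPM G σ) {a b : V} : σ a = b ↔ σ b = a :=
  ⟨fun e => e ▸ h.invol a, fun e => e ▸ h.invol b⟩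

theorem IsPM.inj (h : IsPM G σ) {a b : V} (e : σ a = σ b) : a = b := by
  rw [← h.invol a, e, h.invol]

theorem IsPM.adj_of_eq (h : IsPM G σ) {a b : V} (e : σ a = b) : G.Adj b a :=
  e ▸ (h.adj a).symm

theorem IsPM.hasEdge_iff (h : IsPM G σ) {a b : V} : HasEdge σ s(a, b) ↔ σ a = b := by
  constructor
  · rintro ⟨c, hc⟩
    rcases Sym2.eq_iff.1 hc with ⟨rfl, rfl⟩ | ⟨rfl, rfl⟩
    · rfl
    · exact h.invol _
  · rintro rfl
    exact ⟨a, rfl⟩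

/-- The subgraph of a perfect matching. -/
def IsPM.toSubgraph (h : IsPM G σ) : G.Subgraph where
  verts := Set.univ
  Adj a b := σ a = b
  adj_sub := by rintro a b rfl; exact h.adj a
  edge_vert := fun _ => Set.mem_univ _
  symm := ⟨fun _ _ e => h.eq_comm.1 e⟩

theorem IsPM.toSubgraph_isPerfectMatching (h : IsPM G σ) : h.toSubgraph.IsPerfectMatching :=
  SimpleGraph.Subgraph.isPerfectMatching_iff.2 fun a =>
    ⟨σ a, rfl, fun b (e : σ a = b) => e.symm⟩

theorem exists_isPM_of_isPerfectMatching {M : G.Subgraph} (hM : M.IsPerfectMatching) :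
    ∃ σ, IsPM G σ ∧ ∀ a b, M.Adj a b ↔ σ a = b := by
  choose σ h1 h2 using SimpleGraph.Subgraph.isPerfectMatching_iff.1 hM
  refine ⟨σ, fun a => ⟨(h1 a).adj_sub, (h2 _ _ (h1 a).symm).symm⟩, fun a b => ⟨fun h => ?_, ?_⟩⟩
  · exact (h2 a b h).symm
  · rintro rfl
    exact h1 a

theorem exists_isPM_iff : (∃ σ, IsPM G σ) ↔ ∃ M : G.Subgraph, M.IsPerfectMatching :=
  ⟨fun ⟨_, h⟩ => ⟨_, h.toSubgraph_isPerfectMatching⟩,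
    fun ⟨_, h⟩ => (exists_isPM_of_isPerfectMatching h).imp fun _ h => h.1⟩

theorem isLonely_iff {e : Sym2 V} : IsLonely G e ↔ ∃! σ, IsPM G σ ∧ HasEdge σ e := by
  induction e using Sym2.ind with
  | _ a b =>
  constructor
  · rintro ⟨-, M, ⟨hM, he⟩, hu⟩
    obtain ⟨σ, hσ, hadj⟩ := exists_isPM_of_isPerfectMatching hM
    refine ⟨σ, ⟨hσ, hσ.hasEdge_iff.2 ((hadj _ _).1 he)⟩, fun τ hτ => ?_⟩
    have := hu hτ.1.toSubgraph ⟨hτ.1.toSubgraph_isPerfectMatching, hτ.1.hasEdge_iff.1 hτ.2⟩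
    funext c
    have h2 : M.Adj c (τ c) := by rw [← this]; rfl
    exact ((hadj _ _).1 h2).symm
  · rintro ⟨σ, ⟨hσ, he⟩, hu⟩
    have he' := hσ.hasEdge_iff.1 he
    refine ⟨by rw [← he']; exact hσ.adj a, hσ.toSubgraph,
      ⟨hσ.toSubgraph_isPerfectMatching, he'⟩, fun M hM => ?_⟩
    obtain ⟨τ, hτ, hadj⟩ := exists_isPM_of_isPerfectMatching hM.1
    have := hu τ ⟨hτ, hτ.hasEdge_iff.2 ((hadj _ _).1 hM.2)⟩
    subst this
    ext c d
    · simpa [IsPM.toSubgraph] using hM.1.2 c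
    · exact hadj c d

theorem IsLonely.eq {e : Sym2 V} (he : IsLonely G e) (hσ : IsPM G σ) (hτ : IsPM G τ)
    (h1 : HasEdge σ e) (h2 : HasEdge τ e) : σ = τ :=
  (isLonely_iff.1 he).unique ⟨hσ, h1⟩ ⟨hτ, h2⟩

theorem HasEdge.congr {e : Sym2 V} {W : Type*} (f : V → W) {τ : W → W} (h : HasEdge σ e)
    (hf : ∀ a, τ (f a) = f (σ a)) : HasEdge τ (e.map f) := by
  obtain ⟨a, rfl⟩ := h
  exact ⟨f a, by simp [hf]⟩

theorem IsPM.isLonely_iff (h : IsPM G σ) {a : V} :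
    IsLonely G s(a, σ a) ↔ ∀ τ, IsPM G τ → τ a = σ a → τ = σ := by
  rw [LonelyEdge.isLonely_iff]
  constructor
  · intro hu τ hτ e
    exact hu.unique ⟨hτ, hτ.hasEdge_iff.2 e⟩ ⟨h, h.hasEdge_iff.2 rfl⟩
  · intro hu
    exact ⟨σ, ⟨h, h.hasEdge_iff.2 rfl⟩, fun τ hτ => hu τ hτ.1 (hτ.1.hasEdge_iff.1 hτ.2)⟩

end

/-! ### Invariance under isomorphism -/

section
variable {V W : Type*} {G : SimpleGraph V} {H : SimpleGraph W}

theorem IsPM.map {σ : V → V} (h : IsPM G σ) (φ : G ≃g H) : IsPM H (fun b => φ (σ (φ.symm b))) := by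
  intro b
  constructor
  · have := φ.map_adj_iff.2 (h.adj (φ.symm b))
    simpa using this
  · simp [h.invol]

theorem IsLonely.map {e : Sym2 V} (h : IsLonely G e) (φ : G ≃g H) : IsLonely H (e.map φ) := by
  rw [isLonely_iff] at h ⊢
  obtain ⟨σ, ⟨hσ, he⟩, hu⟩ := h
  refine ⟨_, ⟨hσ.map φ, he.congr φ (by simp)⟩, fun τ hτ => ?_⟩
  have := hu _ ⟨hτ.1.map φ.symm, by
    have := hτ.2.congr (τ := fun b => φ.symm (τ (φ b))) φ.symm (by simp)
    have h2 : (φ.symm ∘ φ : V → V) = id := by funext; simp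
    rwa [Sym2.map_map, h2, Sym2.map_id, id] at this⟩
  rw [← this]
  funext b
  simp

theorem numLonely_congr (φ : G ≃g H) : numLonely G = numLonely H := by
  refine Set.ncard_congr (fun e _ => e.map φ) (fun e he => IsLonely.map he φ) ?_ ?_
  · intro a b _ _ h
    exact Sym2.map.injective φ.injective h
  · intro b hb
    refine ⟨b.map φ.symm, IsLonely.map hb φ.symm, ?_⟩
    rw [Sym2.map_map]
    have : (φ ∘ φ.symm : W → W) = id := by funext; simp
    rw [this, Sym2.map_id, id]

theorem IsCubic.congr (h : IsCubic G) (φ : G ≃g H) : IsCubic H := by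
  intro b
  rw [← h (φ.symm b)]
  refine (Set.ncard_congr (fun a _ => φ a) ?_ ?_ ?_).symm
  · intro a ha
    have := φ.map_adj_iff.2 ha
    simpa using this
  · intro a b _ _ e
    exact φ.injective e
  · intro c hc
    refine ⟨φ.symm c, ?_, by simp⟩
    exact φ.symm.map_adj_iff.2 hc

/-- Deleting fewer than three vertices never separates the graph. -/
def CutConn (G : SimpleGraph V) : Prop :=
  ∀ S A : Set V, S.ncard < 3 → A.Nonempty → Disjoint A S →
    (∀ a ∈ A, ∀ b, G.Adj a b → b ∈ A ∨ b ∈ S) → ∀ b, b ∈ A ∨ b ∈ S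

theorem isThreeConnected_iff [Finite V] :
    IsThreeConnected G ↔ 3 < Nat.card V ∧ CutConn G := by
  refine and_congr_right fun hc => ⟨fun h S A hS ⟨a, ha⟩ hd hcl b => ?_, fun h S hS => ?_⟩
  · by_contra hb
    push Not at hb
    have haS : a ∈ Sᶜ := fun h => Set.disjoint_left.1 hd ha h
    obtain ⟨p⟩ := (h S hS).preconnected ⟨a, haS⟩ ⟨b, hb.2⟩
    have key : ∀ x y : (Sᶜ : Set V), (G.induce Sᶜ).Walk x y → x.1 ∈ A → y.1 ∈ A := by
      intro x y p
      induction p with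
      | nil => exact id
      | @cons u v w hadj _ ih =>
        intro hu
        exact ih ((hcl _ hu _ hadj).resolve_right v.2)
    exact hb.1 (key _ _ p ha)
  · have hne : (Sᶜ : Set V).Nonempty := by
      by_contra h0
      rw [Set.not_nonempty_iff_eq_empty, Set.compl_empty_iff] at h0
      rw [h0, Set.ncard_univ] at hS
      omega
    have : Nonempty (Sᶜ : Set V) := hne.to_subtype
    refine { preconnected := fun x y => ?_, nonempty := this }
    -- The set of vertices reachable from `x` outside `S` is closed, so it exhausts the complement
    -- of `S`.
    have := h S {v | ∃ hv : v ∈ Sᶜ, (G.induce Sᶜ).Reachable x ⟨v, hv⟩} hS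
      ⟨x, x.2, SimpleGraph.Reachable.refl _⟩
      (Set.disjoint_left.2 fun a ha => ha.1) ?_ y
    · rcases this with ⟨_, h⟩ | h
      · exact h
      · exact absurd h y.2
    · rintro a ⟨ha, hr⟩ b hab
      by_cases hb : b ∈ S
      · exact Or.inr hb
      · exact Or.inl ⟨hb, hr.trans (SimpleGraph.Adj.reachable (G := G.induce Sᶜ) hab)⟩

theorem CutConn.congr (h : CutConn G) (φ : G ≃g H) : CutConn H := by
  intro S A hS hA hd hcl b
  have := h (φ ⁻¹' S) (φ ⁻¹' A) ?_ ?_ ?_ ?_ (φ.symm b)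
  · simpa using this
  · rwa [Set.ncard_preimage_of_injective_subset_range φ.injective]
    rw [φ.surjective.range_eq]
    exact Set.subset_univ _
  · obtain ⟨a, ha⟩ := hA
    exact ⟨φ.symm a, by simpa using ha⟩
  · exact hd.preimage _
  · intro a ha c hac
    exact hcl _ ha _ (φ.map_adj_iff.2 hac)

theorem InU3.congr [Finite V] (h : InU3 G) (φ : G ≃g H) : InU3 H := by
  have := Finite.of_equiv _ φ.toEquiv
  obtain ⟨h1, h2, h3⟩ := h
  rw [isThreeConnected_iff] at h2
  exact ⟨h1.congr φ, isThreeConnected_iff.2 ⟨by rw [← Nat.card_congr φ.toEquiv]; exact h2.1,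
    h2.2.congr φ⟩, by rw [← numLonely_congr φ]; exact h3⟩

theorem inU3_congr [Finite V] (φ : G ≃g H) : InU3 G ↔ InU3 H := by
  have := Finite.of_equiv _ φ.toEquiv
  exact ⟨fun h => h.congr φ, fun h => h.congr φ.symm⟩

/-- An isomorphism carries expansions at a vertex to expansions at its image. -/
def expandIso (φ : G ≃g H) (v : V) : expand G v ≃g expand H (φ v) where
  toFun
    | Sum.inl a => Sum.inl ⟨φ a.1, fun h => a.2 (φ.injective h)⟩
    | Sum.inr x => Sum.inr ⟨φ x.1, φ.map_adj_iff.2 x.2⟩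
  invFun
    | Sum.inl a => Sum.inl ⟨φ.symm a.1, fun h => a.2 (φ.symm_apply_eq.1 h)⟩
    | Sum.inr x => Sum.inr ⟨φ.symm x.1, by
        have := φ.symm.map_adj_iff.2 x.2
        simpa using this⟩
  left_inv := by rintro (a | x) <;> simp
  right_inv := by rintro (a | x) <;> simp
  map_rel_iff' := by
    rintro (a | x) (b | y)
    · exact φ.map_adj_iff
    · exact φ.injective.eq_iff
    · exact φ.injective.eq_iff
    · show _ ≠ _ ↔ _ ≠ _
      simp [Subtype.ext_iff]

@[simp] theorem expandIso_inl (φ : G ≃g H) (v : V) (a) :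
    expandIso φ v (Sum.inl a) = Sum.inl ⟨φ a.1, fun h => a.2 (φ.injective h)⟩ := rfl

@[simp] theorem expandIso_inr (φ : G ≃g H) (v : V) (x) :
    expandIso φ v (Sum.inr x) = Sum.inr ⟨φ x.1, φ.map_adj_iff.2 x.2⟩ := rfl

end

end LonelyEdge
namespace LonelyEdge

/-! ### Neighbours in cubic graphs -/

section
variable {V : Type*} {G : SimpleGraph V}

theorem IsCubic.exists_nbrs (h : IsCubic G) (v : V) :
    ∃ p q r, p ≠ q ∧ p ≠ r ∧ q ≠ r ∧ ∀ a, G.Adj v a ↔ a = p ∨ a = q ∨ a = r := by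
  obtain ⟨p, q, r, h1, h2, h3, h4⟩ := Set.ncard_eq_three.1 (h v)
  refine ⟨p, q, r, h1, h2, h3, fun a => ?_⟩
  rw [← SimpleGraph.mem_neighborSet, h4]
  simp

theorem ncard_neighborSet_of {v p q r : V} (h1 : p ≠ q) (h2 : p ≠ r) (h3 : q ≠ r)
    (h4 : ∀ a, G.Adj v a ↔ a = p ∨ a = q ∨ a = r) : (G.neighborSet v).ncard = 3 := by
  refine Set.ncard_eq_three.2 ⟨p, q, r, h1, h2, h3, ?_⟩
  ext a
  rw [SimpleGraph.mem_neighborSet, h4]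
  simp

theorem IsCubic.exists_nbrs_of_adj (h : IsCubic G) {v p : V} (hp : G.Adj v p) :
    ∃ q r, p ≠ q ∧ p ≠ r ∧ q ≠ r ∧ ∀ a, G.Adj v a ↔ a = p ∨ a = q ∨ a = r := by
  obtain ⟨a, b, c, h1, h2, h3, h4⟩ := h.exists_nbrs v
  rcases (h4 p).1 hp with rfl | rfl | rfl
  · exact ⟨b, c, h1, h2, h3, h4⟩
  · exact ⟨a, c, h1.symm, h3, h2, fun d => by rw [h4]; tauto⟩
  · exact ⟨a, b, h2.symm, h3.symm, h1, fun d => by rw [h4]; tauto⟩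

theorem IsCubic.exists_nbr_of_adj (h : IsCubic G) {v p q : V} (hp : G.Adj v p) (hq : G.Adj v q)
    (hpq : p ≠ q) : ∃ r, p ≠ r ∧ q ≠ r ∧ ∀ a, G.Adj v a ↔ a = p ∨ a = q ∨ a = r := by
  obtain ⟨a, b, h1, h2, h3, h4⟩ := h.exists_nbrs_of_adj hp
  rcases (h4 q).1 hq with rfl | rfl | rfl
  · exact absurd rfl hpq
  · exact ⟨b, h2, h3, h4⟩
  · exact ⟨a, h1, h3.symm, fun d => by rw [h4]; tauto⟩

open Classical in
/-- A neighbour of `v` other than `x` and `c`. -/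
noncomputable def other (G : SimpleGraph V) (v : V) (x : G.neighborSet v) (c : V) :
    G.neighborSet v :=
  -- The fallback `x` never occurs in a cubic graph, by `IsCubic.other_spec`.
  if h : ∃ z : G.neighborSet v, z ≠ x ∧ z.1 ≠ c then h.choose else x

theorem IsCubic.other_spec (h : IsCubic G) {v : V} (x : G.neighborSet v) (c : V) :
    other G v x c ≠ x ∧ (other G v x c).1 ≠ c := by
  have hex : ∃ z : G.neighborSet v, z ≠ x ∧ z.1 ≠ c := by
    obtain ⟨q, r, h1, h2, h3, h4⟩ := h.exists_nbrs_of_adj x.2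
    by_cases hq : q = c
    · exact ⟨⟨r, (h4 r).2 (by tauto)⟩, fun e => h2 (congrArg Subtype.val e).symm,
        fun e => h3 (hq.trans e.symm)⟩
    · exact ⟨⟨q, (h4 q).2 (by tauto)⟩, fun e => h1 (congrArg Subtype.val e).symm, hq⟩
  rw [other, dif_pos hex]
  exact hex.choose_spec

theorem IsCubic.eq_other (h : IsCubic G) {v c : V} {x y : G.neighborSet v} (hc : G.Adj v c)
    (hx : x.1 ≠ c) (hy : y.1 ≠ c) (hxy : y ≠ x) : y = other G v x c := by
  obtain ⟨h1, h2⟩ := h.other_spec x c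
  obtain ⟨r, h3, h4, h5⟩ := h.exists_nbr_of_adj hc x.2 hx.symm
  have h6 := (h5 _).1 (other G v x c).2
  have h7 := (h5 _).1 y.2
  ext
  rw [Ne, Subtype.ext_iff] at h1 hxy
  grind

/-! ### The expansion of a cubic graph is cubic -/

@[simp] theorem expand_adj_inl_inl {v : V} {a b : {w : V // w ≠ v}} :
    (expand G v).Adj (Sum.inl a) (Sum.inl b) ↔ G.Adj a.1 b.1 := Iff.rfl

@[simp] theorem expand_adj_inl_inr {v : V} {a : {w : V // w ≠ v}} {x : G.neighborSet v} :
    (expand G v).Adj (Sum.inl a) (Sum.inr x) ↔ a.1 = x.1 := Iff.rfl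

@[simp] theorem expand_adj_inr_inl {v : V} {a : {w : V // w ≠ v}} {x : G.neighborSet v} :
    (expand G v).Adj (Sum.inr x) (Sum.inl a) ↔ a.1 = x.1 := Iff.rfl

@[simp] theorem expand_adj_inr_inr {v : V} {x y : G.neighborSet v} :
    (expand G v).Adj (Sum.inr x) (Sum.inr y) ↔ x ≠ y := Iff.rfl

theorem nbr_ne {v : V} (x : G.neighborSet v) : x.1 ≠ v := (G.ne_of_adj x.2).symm

theorem adj_nbr {v : V} (x : G.neighborSet v) : G.Adj v x.1 := x.2

theorem IsCubic.expand (h : IsCubic G) (v : V) : IsCubic (expand G v) := by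
  rintro (⟨a, ha⟩ | x)
  · by_cases hva : G.Adj v a
    · obtain ⟨q, r, h1, h2, h3, h4⟩ := h.exists_nbrs_of_adj hva.symm
      refine ncard_neighborSet_of (p := Sum.inr ⟨a, hva⟩) (q := Sum.inl ⟨q, h1.symm⟩)
        (r := Sum.inl ⟨r, h2.symm⟩) (by simp) (by simp) (by simpa) ?_
      rintro (⟨b, hb⟩ | y)
      · simp [h4, hb]
      · simp [Subtype.ext_iff, eq_comm]
    · obtain ⟨p, q, r, h1, h2, h3, h4⟩ := h.exists_nbrs a
      have hne : ∀ b, G.Adj a b → b ≠ v := fun b hb e => hva (e ▸ hb.symm)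
      refine ncard_neighborSet_of (p := Sum.inl ⟨p, hne p (by simp [h4])⟩)
        (q := Sum.inl ⟨q, hne q (by simp [h4])⟩)
        (r := Sum.inl ⟨r, hne r (by simp [h4])⟩) (by simpa) (by simpa) (by simpa) ?_
      rintro (⟨b, hb⟩ | y)
      · simp [h4]
      · simp only [expand_adj_inl_inr, reduceCtorEq, or_self, iff_false]
        rintro rfl
        exact hva y.2
  · obtain ⟨q, r, h1, h2, h3, h4⟩ := h.exists_nbrs_of_adj x.2
    refine ncard_neighborSet_of (p := Sum.inl ⟨x.1, nbr_ne x⟩)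
      (q := Sum.inr ⟨q, (h4 q).2 (by tauto)⟩)
      (r := Sum.inr ⟨r, (h4 r).2 (by tauto)⟩) (by simp) (by simp) (by simpa [Subtype.ext_iff]) ?_
    rintro (⟨b, hb⟩ | ⟨y, hy⟩)
    · simp
    · have := (h4 y).1 hy
      simp only [expand_adj_inr_inr, Ne, Subtype.ext_iff, reduceCtorEq, false_or, Sum.inr.injEq]
      grind

/-! ### Lifting matchings to the expansion -/

/-- `σ` is a perfect matching of the graph obtained by deleting `S`. -/
def IsMatchOff (G : SimpleGraph V) (S : Set V) (σ : V → V) : Prop :=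
  ∀ a ∉ S, σ a ∉ S ∧ G.Adj a (σ a) ∧ σ (σ a) = a

theorem isMatchOff_empty {σ : V → V} : IsMatchOff G ∅ σ ↔ IsPM G σ := by
  simp [IsMatchOff, IsPM]

/-- The vertex `v` together with its neighbours. -/
def closedNbhd (G : SimpleGraph V) (v : V) : Set V := {a | a = v ∨ G.Adj v a}

open Classical in
/-- The matching of `G^v` that uses one edge leaving the new triangle. -/
noncomputable def lift (G : SimpleGraph V) (v : V) (σ : V → V) : ExpandVert G v → ExpandVert G v
  | Sum.inl a => if h : σ a.1 = v then (if h2 : G.Adj v a.1 then Sum.inr ⟨a.1, h2⟩ else Sum.inl a)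
      else Sum.inl ⟨σ a.1, h⟩
  | Sum.inr x => if x.1 = σ v then Sum.inl ⟨x.1, nbr_ne x⟩ else Sum.inr (other G v x (σ v))

open Classical in
/-- The matching of `G^v` that uses all three edges leaving the new triangle. -/
noncomputable def lift3 (G : SimpleGraph V) (v : V) (σ : V → V) : ExpandVert G v → ExpandVert G v
  | Sum.inl a => if h : G.Adj v a.1 then Sum.inr ⟨a.1, h⟩
      else if h2 : σ a.1 = v then Sum.inl a else Sum.inl ⟨σ a.1, h2⟩
  | Sum.inr x => Sum.inl ⟨x.1, nbr_ne x⟩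

variable {v : V} {σ : V → V}

/-- The two triangle vertices not used by `σ v` are each other's `other`, so pairing them is an
involution. Deleted sets are allowed because matchings off a closed neighbourhood that misses `v`
have to be lifted too. -/
theorem IsMatchOff.lift (hG : IsCubic G) {S : Set V} (h : IsMatchOff G S σ) (hv : v ∉ S) :
    IsMatchOff (expand G v) {w | ∃ a ∈ S, ∃ ha, w = Sum.inl ⟨a, ha⟩} (lift G v σ) := by
  obtain ⟨hv1, hv2, hv3⟩ := h v hv
  rintro (⟨a, ha⟩ | x) hS
  · have haS : a ∉ S := fun h => hS ⟨a, h, ha, rfl⟩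
    obtain ⟨h1, h2, h3⟩ := h a haS
    by_cases hav : σ a = v
    · have hva : G.Adj v a := by rw [← hav]; exact h2.symm
      have hva' : σ v = a := by rw [← hav, h3]
      simp [LonelyEdge.lift, hav, hva, hva']
    · have : ¬ σ (σ a) = v := by rwa [h3]
      simp [LonelyEdge.lift, hav, h2, h1, h3, ha]
  · by_cases hx : x.1 = σ v
    · simp [LonelyEdge.lift, ← hx, show σ x.1 = v by rw [hx, hv3], hx ▸ hv1, adj_nbr x]
    · obtain ⟨h1, h2⟩ := hG.other_spec x (σ v)
      have := hG.eq_other (x := other G v x (σ v)) (y := x) hv2 h2 hx h1.symm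
      simp [LonelyEdge.lift, hx, h1.symm, h2, ← this]

theorem IsPM.lift (hG : IsCubic G) (h : IsPM G σ) : IsPM (expand G v) (lift G v σ) := by
  have := IsMatchOff.lift (v := v) hG (isMatchOff_empty.2 h) (by simp)
  exact isMatchOff_empty.1 (by simpa using this)

theorem IsMatchOff.lift3 (h : IsMatchOff G (closedNbhd G v) σ) :
    IsPM (expand G v) (lift3 G v σ) := by
  rintro (⟨a, ha⟩ | x)
  · by_cases hva : G.Adj v a
    · simp [LonelyEdge.lift3, hva]
    · obtain ⟨h1, h2, h3⟩ := h a (by simp [closedNbhd, ha, hva])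
      simp only [closedNbhd, Set.mem_ofPred_eq, not_or] at h1
      simp [LonelyEdge.lift3, hva, h1, h2, h3, ha]
  · have := x.2
    rw [SimpleGraph.mem_neighborSet] at this
    simp [LonelyEdge.lift3, this]

theorem lift_inl_eq_inl {a b : {w : V // w ≠ v}} (h : IsPM G σ) :
    lift G v σ (Sum.inl a) = Sum.inl b ↔ σ a.1 = b.1 := by
  by_cases hav : σ a.1 = v
  · have hva : G.Adj v a.1 := h.adj_of_eq hav
    simp [lift, hav, hva, b.2.symm]
  · simp [lift, hav, Subtype.ext_iff]

theorem lift_inl_eq_inr {a : {w : V // w ≠ v}} {x : G.neighborSet v} (h : IsPM G σ) :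
    lift G v σ (Sum.inl a) = Sum.inr x ↔ σ v = x.1 ∧ a.1 = x.1 := by
  by_cases hav : σ a.1 = v
  · have hva : G.Adj v a.1 := h.adj_of_eq hav
    have hva' : σ v = a.1 := h.eq_comm.1 hav
    simp [lift, hav, hva, hva', Subtype.ext_iff]
  · have : ¬ (σ v = x.1 ∧ a.1 = x.1) := by
      rintro ⟨h1, h2⟩
      exact hav (h.eq_comm.1 (h1.trans h2.symm))
    simp [lift, hav, this]

theorem lift_inr_eq_inl {a : {w : V // w ≠ v}} {x : G.neighborSet v} :
    lift G v σ (Sum.inr x) = Sum.inl a ↔ σ v = x.1 ∧ a.1 = x.1 := by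
  by_cases hx : x.1 = σ v
  · simp [lift, ← hx, Subtype.ext_iff, eq_comm]
  · simp [lift, hx, Ne.symm hx]

theorem lift_inr_eq_inr (hG : IsCubic G) (h : IsPM G σ) {x y : G.neighborSet v} :
    lift G v σ (Sum.inr x) = Sum.inr y ↔ x ≠ y ∧ σ v ≠ x.1 ∧ σ v ≠ y.1 := by
  by_cases hx : x.1 = σ v
  · simp [lift, ← hx]
  · obtain ⟨h1, h2⟩ := hG.other_spec x (σ v)
    have := fun hy hxy => hG.eq_other (x := x) (y := y) (h.adj v) hx hy hxy
    simp only [lift, hx, if_false, Sum.inr.injEq]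
    constructor
    · rintro rfl
      exact ⟨h1.symm, Ne.symm hx, h2.symm⟩
    · rintro ⟨h3, h4, h5⟩
      exact (this h5.symm h3.symm).symm

theorem lift3_inl_eq_inl {a b : {w : V // w ≠ v}} (h : IsMatchOff G (closedNbhd G v) σ) :
    lift3 G v σ (Sum.inl a) = Sum.inl b ↔ ¬ G.Adj v a.1 ∧ σ a.1 = b.1 := by
  by_cases hva : G.Adj v a.1
  · simp [lift3, hva]
  · obtain ⟨h1, h2, h3⟩ := h a.1 (by simp [closedNbhd, a.2, hva])
    simp only [closedNbhd, Set.mem_ofPred_eq, not_or] at h1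
    simp [lift3, hva, h1, Subtype.ext_iff]

theorem lift3_inl_eq_inr {a : {w : V // w ≠ v}} {x : G.neighborSet v} :
    lift3 G v σ (Sum.inl a) = Sum.inr x ↔ a.1 = x.1 := by
  by_cases hva : G.Adj v a.1
  · simp [lift3, hva, Subtype.ext_iff]
  · have : a.1 ≠ x.1 := fun e => hva (e ▸ x.2)
    simp only [lift3, hva, dite_false, this, iff_false]
    split_ifs <;> simp

theorem lift3_inr {x : G.neighborSet v} :
    lift3 G v σ (Sum.inr x) = Sum.inl ⟨x.1, nbr_ne x⟩ := rfl

/-- The lift shows the partner of every vertex other than `v`, and these determine the partner of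
`v`. -/
theorem lift_injective {τ : V → V} (hσ : IsPM G σ) (hτ : IsPM G τ)
    (h : lift G v σ = lift G v τ) : σ = τ := by
  have key : ∀ a, a ≠ v → σ a = τ a := by
    intro a ha
    by_cases hav : σ a = v
    · have hva : G.Adj v a := by rw [← hav]; exact (hσ.adj _).symm
      have := (lift_inl_eq_inr (v := v) (a := ⟨a, ha⟩) (x := ⟨a, hva⟩) hσ).2
        ⟨hσ.eq_comm.1 hav, rfl⟩
      rw [h, lift_inl_eq_inr hτ] at this
      rw [hav, hτ.eq_comm.1 this.1]
    · have := (lift_inl_eq_inl (v := v) (a := ⟨a, ha⟩) (b := ⟨σ a, hav⟩) hσ).2 rfl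
      rw [h, lift_inl_eq_inl hτ] at this
      exact this.symm
  funext a
  by_cases ha : a = v
  · subst ha
    have := key (σ a) (hσ.adj a).ne'
    rw [hσ.invol] at this
    exact (hτ.eq_comm.1 this.symm).symm
  · exact key a ha

/-- The vertex of `G` that a vertex of `G^v` comes from. -/
def proj (G : SimpleGraph V) (v : V) : ExpandVert G v → V
  | Sum.inl a => a.1
  | Sum.inr _ => v

/-- A triangle has three vertices, so a matching contains one of its edges or none. In the first
case the third triangle vertex is matched outwards and contracting the triangle gives a matching of
`G`; in the second case all three are matched outwards and the rest is a matching of `G - N[v]`. -/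
theorem IsPM.eq_lift_or {ρ : ExpandVert G v → ExpandVert G v} (hG : IsCubic G)
    (h : IsPM (LonelyEdge.expand G v) ρ) :
    (∃ σ, IsPM G σ ∧ ρ = LonelyEdge.lift G v σ) ∨
    (∃ σ, IsMatchOff G (closedNbhd G v) σ ∧ ρ = LonelyEdge.lift3 G v σ ∧
      ∀ x, ρ (Sum.inr x) = Sum.inl ⟨x.1, nbr_ne x⟩) := by
  classical
  have hinl : ∀ a b, ρ (Sum.inl a) = Sum.inl b → G.Adj a.1 b.1 := by
    intro a b e
    have := h.adj (Sum.inl a)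
    rwa [e] at this
  have hinr : ∀ a x, ρ (Sum.inl a) = Sum.inr x → a.1 = x.1 := by
    intro a x e
    have := h.adj (Sum.inl a)
    rwa [e] at this
  have hrl : ∀ a x, ρ (Sum.inr x) = Sum.inl a → a.1 = x.1 := fun a x e =>
    hinr a x (h.eq_comm.1 e)
  by_cases hx : ∃ x y, ρ (Sum.inr x) = Sum.inr y
  · left
    obtain ⟨x, y, hxy⟩ := hx
    have hne : x ≠ y := by
      have := h.adj (Sum.inr x)
      rwa [hxy] at this
    -- `z` is the neighbour of `v` whose triangle vertex is left over by the triangle edge; it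
    -- becomes the partner of `v`.
    obtain ⟨z, hz1, hz2, hz3⟩ := hG.exists_nbr_of_adj x.2 y.2 (fun e => hne (Subtype.ext e))
    have hz : G.Adj v z := (hz3 z).2 (by tauto)
    have hyx := h.eq_comm.1 hxy
    have hρz : ρ (Sum.inr ⟨z, hz⟩) = Sum.inl ⟨z, hz.ne'⟩ := by
      rcases e : ρ (Sum.inr ⟨z, hz⟩) with a | w
      · have := hrl _ _ e
        simp only at this
        subst this
        rfl
      · exfalso
        have hw := h.eq_comm.1 e
        have h1 := h.adj (Sum.inr ⟨z, hz⟩)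
        rw [e] at h1
        rcases (hz3 w.1).1 w.2 with e1 | e1 | e1
        · rw [Subtype.ext e1, hxy] at hw
          exact hz2 (congrArg Subtype.val (Sum.inr.inj hw))
        · rw [Subtype.ext e1, hyx] at hw
          exact hz1 (congrArg Subtype.val (Sum.inr.inj hw))
        · exact h1 (Subtype.ext e1.symm)
    have hzr := h.eq_comm.1 hρz
    have hone : ∀ a w, ρ (Sum.inl a) = Sum.inr w → a.1 = z := by
      intro a w e
      have h1 := hinr a w e
      have h2 := h.eq_comm.1 e
      rcases (hz3 w.1).1 w.2 with e1 | e1 | e1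
      · rw [Subtype.ext e1, hxy] at h2
        simp at h2
      · rw [Subtype.ext e1, hyx] at h2
        simp at h2
      · exact h1.trans e1
    let σ : V → V := fun a => if ha : a = v then z else proj G v (ρ (Sum.inl ⟨a, ha⟩))
    have hσv : σ v = z := by simp [σ]
    have hσz : σ z = v := by simp [σ, hz.ne', hzr, proj]
    have hσa : ∀ a b, ρ (Sum.inl a) = Sum.inl b → σ a.1 = b.1 := by
      intro a b e
      simp [σ, a.2, e, proj]
    have hPM : IsPM G σ := by
      intro a
      by_cases ha : a = v
      · subst ha
        rw [hσv]
        exact ⟨hz, hσz⟩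
      · rcases e : ρ (Sum.inl ⟨a, ha⟩) with b | w
        · have h1 := hσa _ _ e
          have h2 := hσa _ _ (h.eq_comm.1 e)
          simp only at h1 h2
          rw [h1, h2]
          exact ⟨hinl _ _ e, rfl⟩
        · have h1 := hone _ _ e
          simp only at h1
          rw [h1, hσz]
          exact ⟨hz.symm, hσv⟩
    refine ⟨σ, hPM, ?_⟩
    funext w
    symm
    rcases w with a | w
    · rcases e : ρ (Sum.inl a) with b | w
      · rw [lift_inl_eq_inl hPM]
        exact hσa _ _ e
      · rw [lift_inl_eq_inr hPM, hσv]
        have := hinr _ _ e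
        exact ⟨(hone _ _ e).symm.trans this, this⟩
    · rcases e : ρ (Sum.inr w) with b | u
      · rw [lift_inr_eq_inl, hσv]
        have := hrl _ _ e
        exact ⟨(hone _ _ (h.eq_comm.1 e)).symm.trans this, this⟩
      · rw [lift_inr_eq_inr hG hPM, hσv]
        refine ⟨?_, ?_, ?_⟩
        · have := h.adj (Sum.inr w)
          rwa [e] at this
        · intro e1
          rw [show w = ⟨z, hz⟩ from Subtype.ext e1.symm, hρz] at e
          simp at e
        · intro e1
          have := h.eq_comm.1 e
          rw [show u = ⟨z, hz⟩ from Subtype.ext e1.symm, hρz] at this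
          simp at this
  · right
    push Not at hx
    have hall : ∀ x, ρ (Sum.inr x) = Sum.inl ⟨x.1, nbr_ne x⟩ := by
      intro x
      rcases e : ρ (Sum.inr x) with a | w
      · have := hrl _ _ e
        congr 1
        exact Subtype.ext this
      · exact absurd e (hx _ _)
    let σ : V → V := fun a => if ha : a = v then v else proj G v (ρ (Sum.inl ⟨a, ha⟩))
    have hσa : ∀ a b, ρ (Sum.inl a) = Sum.inl b → σ a.1 = b.1 := by
      intro a b e
      simp [σ, a.2, e, proj]
    have hnot : ∀ a b, ρ (Sum.inl a) = Sum.inl b → ¬ G.Adj v a.1 := by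
      intro a b e hva
      have h1 := h.eq_comm.1 (hall ⟨a.1, hva⟩)
      simp only [Subtype.coe_eta] at h1
      rw [h1] at e
      simp at e
    have hPM : IsMatchOff G (closedNbhd G v) σ := by
      intro a ha
      simp only [closedNbhd, Set.mem_ofPred_eq, not_or] at ha ⊢
      rcases e : ρ (Sum.inl ⟨a, ha.1⟩) with b | w
      · have h1 := hσa _ _ e
        have h2 := hσa _ _ (h.eq_comm.1 e)
        simp only at h1 h2
        rw [h1, h2]
        exact ⟨⟨b.2, hnot _ _ (h.eq_comm.1 e)⟩, hinl _ _ e, rfl⟩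
      · have := hinr _ _ e
        simp only at this
        subst this
        exact absurd w.2 ha.2
    refine ⟨σ, hPM, ?_, hall⟩
    funext w
    symm
    rcases w with a | w
    · rcases e : ρ (Sum.inl a) with b | w
      · rw [lift3_inl_eq_inl hPM]
        exact ⟨hnot _ _ e, hσa _ _ e⟩
      · rw [lift3_inl_eq_inr]
        exact hinr _ _ e
    · rw [hall]
      rfl

end

end LonelyEdge
namespace LonelyEdge

/-! ### Connectivity of the expansion -/

section
variable {V : Type*} {G : SimpleGraph V} {v : V}

/-- A separation of the expansion is projected to one of `G`. If `S` misses the triangle, then the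
triangle lies wholly inside or wholly outside `A`. If `S` meets it, then `v` lies in the projected
`S`, and only the remaining triangle vertices need attention. -/
theorem CutConn.expand [Finite V] (hG : IsCubic G) (h : CutConn G) :
    CutConn (LonelyEdge.expand G v) := by
  intro S A hS hA hd hcl
  have hdis : ∀ w, w ∈ A → w ∉ S := fun w h1 h2 => Set.disjoint_left.1 hd h1 h2
  have hS0 : (proj G v '' S).ncard < 3 := lt_of_le_of_lt (Set.ncard_image_le S.toFinite) hS
  have hinl : ∀ (B : Set (ExpandVert G v)) (a) (ha : a ≠ v), a ∈ proj G v '' B →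
      Sum.inl ⟨a, ha⟩ ∈ B := by
    rintro B a ha ⟨b | x, hb, rfl⟩
    · exact hb
    · exact absurd rfl ha
  by_cases hT : ∃ x, Sum.inr x ∈ S
  · obtain ⟨x, hx⟩ := hT
    have hone : ∀ w ∈ S, w ≠ Sum.inr x → ∀ w' ∈ S, w' ≠ Sum.inr x → w = w' := by
      intro w hw h1 w' hw' h2
      by_contra h3
      have : ({Sum.inr x, w, w'} : Set (ExpandVert G v)).ncard ≤ S.ncard :=
        Set.ncard_le_ncard (by
          intro t ht
          simp only [Set.mem_insert_iff, Set.mem_singleton_iff] at ht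
          rcases ht with rfl | rfl | rfl <;> assumption) S.toFinite
      rw [Set.ncard_eq_three.2 ⟨_, _, _, h1.symm, h2.symm, h3, rfl⟩] at this
      omega
    -- Here `S` consists of the triangle vertex `x` and the outer neighbour of `y`, so the third
    -- triangle vertex and its outer neighbour are both free and provide a detour.
    have hthird : ∀ y, Sum.inl ⟨y.1, nbr_ne y⟩ ∈ S → y ≠ x → ∃ z, z ≠ y ∧
        Sum.inr z ∉ S ∧ Sum.inl ⟨z.1, nbr_ne z⟩ ∉ S := by
      intro y hy hyx
      obtain ⟨h1, h2⟩ := hG.other_spec y x.1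
      refine ⟨_, h1, fun hz => ?_, fun hz => ?_⟩
      · have := hone _ hz (by simpa [Subtype.ext_iff] using h2) _ hy (by simp)
        simp at this
      · have := hone _ hz (by simp) _ hy (by simp)
        simp only [Sum.inl.injEq, Subtype.mk.injEq] at this
        exact h1 (Subtype.ext this)
    by_cases hA0 : ∃ a, Sum.inl a ∈ A
    · obtain ⟨a, ha⟩ := hA0
      have hall := h (proj G v '' S) {b | ∃ hb : b ≠ v, Sum.inl ⟨b, hb⟩ ∈ A} hS0 ⟨a.1, a.2, ha⟩ ?_ ?_
      · have hl : ∀ a, Sum.inl a ∈ A ∨ Sum.inl a ∈ S := by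
          intro a
          rcases hall a.1 with ⟨_, h1⟩ | h1
          · exact Or.inl h1
          · exact Or.inr (hinl S _ a.2 h1)
        rintro (a | y)
        · exact hl a
        · by_contra hy
          push Not at hy
          have h1 := (hl ⟨y.1, nbr_ne y⟩).resolve_left fun h1 => by
            have := hcl _ h1 (Sum.inr y) (by simp)
            tauto
          obtain ⟨z, hz1, hz2, hz3⟩ := hthird y h1 (fun e => hy.2 (e ▸ hx))
          have h3 := (hcl _ ((hl ⟨z.1, nbr_ne z⟩).resolve_right hz3) (Sum.inr z)
            (by simp)).resolve_right hz2
          have := hcl _ h3 (Sum.inr y) (by simpa using hz1)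
          tauto
      · rw [Set.disjoint_left]
        rintro b ⟨hb, hbA⟩ hbS
        exact hdis _ hbA (hinl S b hb hbS)
      · rintro b ⟨hb, hbA⟩ c hbc
        by_cases hc : c = v
        · exact Or.inr ⟨Sum.inr x, hx, hc.symm⟩
        · rcases hcl _ hbA (Sum.inl ⟨c, hc⟩) hbc with h1 | h1
          · exact Or.inl ⟨hc, h1⟩
          · exact Or.inr ⟨_, h1, rfl⟩
    · exfalso
      push Not at hA0
      obtain ⟨a | y, ha⟩ := hA
      · exact hA0 _ ha
      · have h1 := (hcl _ ha (Sum.inl ⟨y.1, nbr_ne y⟩) (by simp)).resolve_left (hA0 _)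
        obtain ⟨z, hz1, hz2, hz3⟩ := hthird y h1 (fun e => hdis _ ha (e ▸ hx))
        have h2 := (hcl _ ha (Sum.inr z) (by simpa using hz1.symm)).resolve_right hz2
        rcases hcl _ h2 (Sum.inl ⟨z.1, nbr_ne z⟩) (by simp) with h3 | h3
        · exact hA0 _ h3
        · exact hz3 h3
  · push Not at hT
    have hr : ∀ x y, Sum.inr x ∈ A → Sum.inr y ∈ A := by
      intro x y hx
      by_cases hxy : x = y
      · exact hxy ▸ hx
      · exact (hcl _ hx (Sum.inr y) hxy).resolve_right (hT _)
    have hall := h (proj G v '' S) (proj G v '' A) hS0 (hA.image _) ?_ ?_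
    · rintro (a | y)
      · exact (hall a.1).imp (hinl A _ a.2) (hinl S _ a.2)
      · rcases hall v with ⟨a | x, h1, h2⟩ | ⟨a | x, h1, h2⟩
        · exact absurd h2 a.2
        · exact Or.inl (hr _ _ h1)
        · exact absurd h2 a.2
        · exact absurd h1 (hT _)
    · rw [Set.disjoint_left]
      rintro b hb ⟨a | x, h1, rfl⟩
      · exact hdis _ (hinl A _ a.2 hb) h1
      · exact hT _ h1
    · rintro _ ⟨a | x, ha, rfl⟩ b hab
      · by_cases hb : b = v
        · subst hb
          have hba := hab.symm
          rcases hcl _ ha (Sum.inr ⟨a.1, hba⟩) (by simp) with h1 | h1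
          · exact Or.inl ⟨_, h1, rfl⟩
          · exact absurd h1 (hT _)
        · exact (hcl _ ha (Sum.inl ⟨b, hb⟩) hab).imp (fun h => ⟨_, h, rfl⟩) (fun h => ⟨_, h, rfl⟩)
      · have h1 := hr x ⟨b, hab⟩ ha
        exact (hcl _ h1 (Sum.inl ⟨b, hab.ne'⟩) (by simp)).imp
          (fun h => ⟨_, h, rfl⟩) (fun h => ⟨_, h, rfl⟩)

end

/-! ### Klee graphs -/

/-- A Klee graph is `K₄` or arises from `K₄` by replacing vertices with triangles. -/
inductive Klee : ∀ {V : Type}, SimpleGraph V → Prop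
  | base {V : Type} {G : SimpleGraph V} (e : G ≃g (⊤ : SimpleGraph (Fin 4))) : Klee G
  | step {V W : Type} {H : SimpleGraph V} {G : SimpleGraph W} (v : V) (h : Klee H)
      (e : G ≃g expand H v) : Klee G

theorem Klee.expand {V : Type} {G : SimpleGraph V} (h : Klee G) (v : V) : Klee (expand G v) :=
  .step v h SimpleGraph.Iso.refl

theorem Klee.congr {V W : Type} {G : SimpleGraph V} {H : SimpleGraph W} (h : Klee G)
    (φ : G ≃g H) : Klee H := by
  cases h with
  | base e => exact .base (φ.symm.trans e)
  | step v h e => exact .step v h (φ.symm.trans e)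

theorem Klee.finite {V : Type} {G : SimpleGraph V} (h : Klee G) : Finite V := by
  induction h with
  | base e => exact Finite.of_equiv _ e.symm.toEquiv
  | step v h e ih => exact Finite.of_equiv _ e.symm.toEquiv

theorem Klee.isCubic {V : Type} {G : SimpleGraph V} (h : Klee G) : IsCubic G := by
  induction h with
  | base e =>
    refine IsCubic.congr ?_ e.symm
    intro v
    have : (⊤ : SimpleGraph (Fin 4)).neighborSet v = {v}ᶜ := by
      ext; simp [eq_comm]
    rw [this, Set.ncard_compl, Set.ncard_singleton, Nat.card_eq_fintype_card, Fintype.card_fin]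
  | step v h e ih => exact (ih.expand v).congr e.symm

theorem Klee.cutConn {V : Type} {G : SimpleGraph V} (h : Klee G) : CutConn G := by
  induction h with
  | base e =>
    refine CutConn.congr ?_ e.symm
    intro S A _ ⟨a, ha⟩ _ hcl b
    by_cases hab : a = b
    · exact Or.inl (hab ▸ ha)
    · exact hcl a ha b hab
  | step v h e ih =>
    have := h.finite
    exact (ih.expand h.isCubic).congr e.symm

theorem card_expand {V : Type} {G : SimpleGraph V} (h : Klee G) (v : V) :
    Nat.card (ExpandVert G v) = Nat.card V + 2 := by
  classical
  have := h.finite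
  have := Fintype.ofFinite V
  have h1 : Nat.card (G.neighborSet v) = 3 := h.isCubic v
  rw [Nat.card_sum, h1]
  have h2 := Nat.card_congr (Equiv.sumCompl (fun w : V => w = v)).symm
  rw [Nat.card_sum] at h2
  have h3 : Nat.card {w : V // w = v} = 1 := by simp
  have h4 : Nat.card {w : V // w ≠ v} = Nat.card {w : V // ¬ w = v} := rfl
  omega

theorem Klee.four_le_card {V : Type} {G : SimpleGraph V} (h : Klee G) : 4 ≤ Nat.card V := by
  induction h with
  | base e => rw [Nat.card_congr e.toEquiv]; simp
  | step v h e ih =>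
    rw [Nat.card_congr e.toEquiv, card_expand h]
    omega

theorem Klee.isThreeConnected {V : Type} {G : SimpleGraph V} (h : Klee G) :
    IsThreeConnected G := by
  have := h.finite
  exact isThreeConnected_iff.2 ⟨h.four_le_card, h.cutConn⟩

theorem Klee.inU3_iff {V : Type} {G : SimpleGraph V} (h : Klee G) :
    InU3 G ↔ numLonely G = 3 :=
  ⟨fun h => h.2.2, fun h' => ⟨h.isCubic, h.isThreeConnected, h'⟩⟩

/-! ### Matchings of Klee graphs -/

/-- The partial matching obtained from one of `G - N[a]` in the expansion at a neighbour. -/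
noncomputable def liftNear {V : Type*} (G : SimpleGraph V) (v a : V) (σ : V → V) :
    ExpandVert G v → ExpandVert G v
  | Sum.inl b => open Classical in if h : σ b.1 = v then Sum.inl b else Sum.inl ⟨σ b.1, h⟩
  | Sum.inr x => Sum.inr (other G v x a)

theorem IsMatchOff.liftNear {V : Type*} {G : SimpleGraph V} {v a : V} {σ : V → V} (hG : IsCubic G)
    (h : IsMatchOff G (closedNbhd G a) σ) (hva : G.Adj v a) :
    IsMatchOff (LonelyEdge.expand G v)
      (closedNbhd (LonelyEdge.expand G v) (Sum.inl ⟨a, hva.ne'⟩)) (liftNear G v a σ) := by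
  rintro (⟨b, hb⟩ | x) hw
  · simp only [closedNbhd, Set.mem_ofPred_eq, not_or, Sum.inl.injEq, Subtype.mk.injEq,
      expand_adj_inl_inl] at hw
    obtain ⟨h1, h2, h3⟩ := h b (by simp [closedNbhd, hw])
    simp only [closedNbhd, Set.mem_ofPred_eq, not_or] at h1
    have : σ b ≠ v := fun e => h1.2 (e ▸ hva.symm)
    simp [LonelyEdge.liftNear, this, h2, h3, hb, closedNbhd, h1]
  · simp only [closedNbhd, Set.mem_ofPred_eq, not_or, expand_adj_inl_inr, reduceCtorEq,
      not_false_eq_true, true_and] at hw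
    obtain ⟨h1, h2⟩ := hG.other_spec x a
    have := hG.eq_other (x := other G v x a) (y := x) hva h2 (Ne.symm hw) h1.symm
    simp [LonelyEdge.liftNear, closedNbhd, h1.symm, h2.symm, ← this]

theorem Klee.exists_isPM {V : Type} {G : SimpleGraph V} (h : Klee G) :
    ∀ a b, G.Adj a b → ∃ σ, IsPM G σ ∧ σ a = b := by
  induction h with
  | base e =>
    intro a b hab
    have key : ∀ a b : Fin 4, a ≠ b → ∃ σ, IsPM (⊤ : SimpleGraph (Fin 4)) σ ∧ σ a = b := by
      intro a b hab
      -- Identify the vertices of `K₄` with the Klein four-group: translation by a nonzero element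
      -- is a perfect matching.
      refine ⟨fun x => x ^^^ (a ^^^ b), ?_, ?_⟩
      · simp only [IsPM, SimpleGraph.top_adj]
        revert a b
        decide
      · revert a b
        decide
    obtain ⟨σ, hσ, h⟩ := key (e a) (e b) (e.map_adj_iff.2 hab)
    exact ⟨_, hσ.map e.symm, by simp [h]⟩
  | @step V W H G v hH e ih =>
    have hc := hH.isCubic
    have key : ∀ a b, (LonelyEdge.expand H v).Adj a b →
        ∃ σ, IsPM (LonelyEdge.expand H v) σ ∧ σ a = b := by
      rintro (a | x) (b | y) hab
      · obtain ⟨σ, hσ, h⟩ := ih _ _ hab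
        exact ⟨_, hσ.lift hc, (lift_inl_eq_inl hσ).2 h⟩
      · obtain ⟨σ, hσ, h⟩ := ih _ _ (adj_nbr y)
        exact ⟨_, hσ.lift hc, (lift_inl_eq_inr hσ).2 ⟨h, hab⟩⟩
      · obtain ⟨σ, hσ, h⟩ := ih _ _ (adj_nbr x)
        exact ⟨_, hσ.lift hc, lift_inr_eq_inl.2 ⟨h, hab⟩⟩
      -- A triangle edge lies in the lift of any matching that joins `v` to the third neighbour.
      · obtain ⟨h1, h2⟩ := hc.other_spec x y.1
        obtain ⟨σ, hσ, h⟩ := ih _ _ (adj_nbr (other H v x y.1))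
        refine ⟨_, hσ.lift hc, (lift_inr_eq_inr hc hσ).2 ⟨hab, ?_, ?_⟩⟩
        · rw [h]
          exact fun e => h1 (Subtype.ext e)
        · rw [h]
          exact h2
    intro a b hab
    obtain ⟨σ, hσ, h⟩ := key (e a) (e b) (e.map_adj_iff.2 hab)
    exact ⟨_, hσ.map e.symm, by simp [h]⟩

theorem IsMatchOff.map {V W : Type*} {G : SimpleGraph V} {H : SimpleGraph W} {a : V} {σ : V → V}
    (h : IsMatchOff G (closedNbhd G a) σ) (φ : G ≃g H) :
    IsMatchOff H (closedNbhd H (φ a)) (fun b => φ (σ (φ.symm b))) := by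
  have hmem : ∀ b, b ∈ closedNbhd H (φ a) ↔ φ.symm b ∈ closedNbhd G a := by
    intro b
    simp only [closedNbhd, Set.mem_ofPred_eq]
    rw [← φ.map_adj_iff, φ.symm_apply_eq, φ.apply_symm_apply]
  intro b hb
  obtain ⟨h1, h2, h3⟩ := h _ ((hmem b).not.1 hb)
  refine ⟨(hmem _).not.2 (by simpa using h1), ?_, by simp [h3]⟩
  have := φ.map_adj_iff.2 h2
  simpa using this

/-- This provides matchings of an expansion that use all three edges leaving the new triangle. In
the inductive step, if `a` is an old neighbour of `v`, the two triangle vertices not attached to `a`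
are paired; if `a` is another old vertex, the matching is lifted. If `a` is the triangle vertex at
`x`, its closed neighbourhood is the triangle with `x`, and a lifted matching through `vx` leaves
that set invariant. -/
theorem Klee.exists_isMatchOff {V : Type} {G : SimpleGraph V} (h : Klee G) :
    ∀ a, ∃ σ, IsMatchOff G (closedNbhd G a) σ := by
  induction h with
  | base e =>
    intro a
    refine ⟨id, fun b hb => absurd ?_ hb⟩
    by_cases hab : a = b
    · exact Or.inl hab.symm
    · exact Or.inr (e.map_adj_iff.1 (by simpa using hab))
  | @step V W H G v hH e ih =>
    have hc := hH.isCubic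
    have key : ∀ a, ∃ σ, IsMatchOff (LonelyEdge.expand H v)
        (closedNbhd (LonelyEdge.expand H v) a) σ := by
      rintro (⟨a, ha⟩ | x)
      · obtain ⟨σ, hσ⟩ := ih a
        by_cases hva : H.Adj v a
        · exact ⟨_, hσ.liftNear hc hva⟩
        · have := hσ.lift (v := v) hc (by simp [closedNbhd, ha.symm, SimpleGraph.adj_comm, hva])
          refine ⟨LonelyEdge.lift H v σ, ?_⟩
          convert this using 1
          ext (b | y)
          · simp [closedNbhd, Subtype.ext_iff, b.2, ha]
          · simp only [closedNbhd, Set.mem_ofPred_eq, reduceCtorEq, expand_adj_inl_inr, false_or,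
              exists_false, and_false, iff_false]
            rintro rfl
            exact hva y.2
      · obtain ⟨σ, hσ, h⟩ := hH.exists_isPM _ _ (adj_nbr x)
        refine ⟨_, fun w hw => ⟨?_, hσ.lift hc w⟩⟩
        rcases w with b | y
        · simp only [closedNbhd, Set.mem_ofPred_eq, reduceCtorEq, expand_adj_inr_inl,
            false_or] at hw
          rintro (h1 | h1)
          · exact hw ((lift_inl_eq_inr hσ).1 h1).2
          · rcases h2 : LonelyEdge.lift H v σ (Sum.inl b) with c | y
            · rw [h2] at h1
              have h3 := (lift_inl_eq_inl hσ).1 h2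
              rw [expand_adj_inr_inl] at h1
              rw [h1, ← h] at h3
              exact b.2 (hσ.inj h3)
            · have := (lift_inl_eq_inr hσ).1 h2
              exact hw (this.2.trans (this.1.symm.trans h))
        · exact absurd (by by_cases h : x = y <;> simp [closedNbhd, h, eq_comm (a := y)]) hw
    intro a
    obtain ⟨σ, hσ⟩ := key (e a)
    have := hσ.map e.symm
    simp only [RelIso.symm_apply_apply] at this
    exact ⟨_, this⟩

/-! ### Lonely edges under expansion -/

theorem ncard_le_of_rel {α β : Type*} [Finite α] {s : Set α} {t : Set β} (R : α → β → Prop)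
    (h1 : ∀ b ∈ t, ∃ a ∈ s, R a b) (h2 : ∀ a b c, R a b → R a c → b = c) :
    t.ncard ≤ s.ncard := by
  rcases isEmpty_or_nonempty α with h0 | h0
  · rw [Set.eq_empty_of_forall_notMem (s := t) fun b hb => isEmptyElim (h1 b hb).choose]
    simp
  choose! f hf hR using h1
  exact Set.ncard_le_ncard_of_injOn f hf (fun b hb c hc e => h2 _ _ _ (hR b hb) (e ▸ hR c hc))
    s.toFinite

/-- The edge `e'` of `G^v` arises from the edge `e` of `G`: either `e` avoids `v` and `e' = e`, or
`e = vx` and `e'` is the edge of the new triangle opposite to `v_x`. -/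
def EdgeRel {V : Type} (G : SimpleGraph V) (v : V) (e : Sym2 V) (e' : Sym2 (ExpandVert G v)) :
    Prop :=
  (∃ a b : {w : V // w ≠ v}, e = s(a.1, b.1) ∧ e' = s(Sum.inl a, Sum.inl b)) ∨
    ∃ x y z : G.neighborSet v, y ≠ z ∧ x ≠ y ∧ x ≠ z ∧ e = s(v, x.1) ∧
      e' = s(Sum.inr y, Sum.inr z)

/-- An edge leaving the new triangle is never lonely. Any other edge of the expansion has an edge of
`G` all of whose matchings lift to matchings through it. -/
theorem Klee.exists_edgeRel {V : Type} {G : SimpleGraph V} (hG : Klee G) {v : V}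
    {e' : Sym2 (ExpandVert G v)} (he' : IsLonely (LonelyEdge.expand G v) e') :
    ∃ e, IsLonely G e ∧ EdgeRel G v e e' := by
  have := hG.finite
  have hc := hG.isCubic
  obtain ⟨ρ, ⟨hρ, w, rfl⟩, hu⟩ := isLonely_iff.1 he'
  -- If all matchings through `ab` lift to matchings through the lonely edge, then their lifts
  -- coincide, and lifting is injective.
  have hlone : ∀ (a b : V), G.Adj a b →
      (∀ σ, IsPM G σ → σ a = b → HasEdge (LonelyEdge.lift G v σ) s(w, ρ w)) →
      IsLonely G s(a, b) := by
    intro a b hab hh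
    obtain ⟨σ, hσ, hab⟩ := hG.exists_isPM a b hab
    subst hab
    refine hσ.isLonely_iff.2 fun τ hτ hτσ => lift_injective (v := v) hτ hσ ?_
    rw [hu _ ⟨hτ.lift hc, hh _ hτ hτσ⟩, hu _ ⟨hσ.lift hc, hh _ hσ rfl⟩]
  -- The edge joining `x` to its triangle vertex lies in a `lift` and in a `lift3`, which differ at
  -- another triangle vertex.
  have hcross : ∀ x, ρ (Sum.inr x) ≠ Sum.inl ⟨x.1, nbr_ne x⟩ ∨
      ¬ HasEdge ρ s(w, ρ w) ∨ s(w, ρ w) ≠ s(Sum.inr x, Sum.inl ⟨x.1, nbr_ne x⟩) := by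
    intro x
    by_contra hcon
    push Not at hcon
    obtain ⟨h1, -, h3⟩ := hcon
    rw [h3] at hu
    obtain ⟨σ, hσ, hσx⟩ := hG.exists_isPM _ _ (adj_nbr x)
    obtain ⟨τ, hτ⟩ := hG.exists_isMatchOff v
    have e1 := hu _ ⟨hσ.lift hc, (hσ.lift hc).hasEdge_iff.2 (lift_inr_eq_inl.2 ⟨hσx, rfl⟩)⟩
    have e2 := hu _ ⟨hτ.lift3, hτ.lift3.hasEdge_iff.2 lift3_inr⟩
    obtain ⟨h4, -⟩ := hc.other_spec x v
    have h5 := lift3_inr (σ := τ) (x := other G v x v)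
    rw [e2, ← e1, lift_inr_eq_inl, hσx] at h5
    exact h4 (Subtype.ext h5.1.symm)
  have hadj := hρ.adj w
  rcases w with a | x
  · rcases hb : ρ (Sum.inl a) with b | y
    · rw [hb] at hadj
      refine ⟨s(a.1, b.1), hlone _ _ hadj fun σ hσ h => ?_,
        Or.inl ⟨a, b, rfl, rfl⟩⟩
      rw [hb, (hσ.lift hc).hasEdge_iff, lift_inl_eq_inl hσ]
      exact h
    · exfalso
      have hay : a = ⟨y.1, nbr_ne y⟩ := by
        rw [hb] at hadj
        exact Subtype.ext hadj
      subst hay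
      rcases hcross y with h | h | h
      · exact h (hρ.eq_comm.1 hb)
      · exact h ⟨_, rfl⟩
      · rw [hb, Sym2.eq_swap] at h
        exact h rfl
  · rcases hb : ρ (Sum.inr x) with b | y
    · exfalso
      have hay : b = ⟨x.1, nbr_ne x⟩ := by
        rw [hb] at hadj
        exact Subtype.ext hadj
      subst hay
      rcases hcross x with h | h | h
      · exact h hb
      · exact h ⟨_, rfl⟩
      · rw [hb] at h
        exact h rfl
    · rw [hb] at hadj
      obtain ⟨h1, h2⟩ := hc.other_spec x y.1
      have h2' : other G v x y.1 ≠ y := fun e => h2 (congrArg _ e)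
      refine ⟨_, hlone _ _ (adj_nbr (other G v x y.1)) fun σ hσ h => ?_,
        Or.inr ⟨_, x, y, hadj, h1, h2', rfl, rfl⟩⟩
      rw [hb, (hσ.lift hc).hasEdge_iff, lift_inr_eq_inr hc hσ, h]
      exact ⟨hadj, fun e => h1 (Subtype.ext e), h2⟩

theorem EdgeRel.eq {V : Type} {G : SimpleGraph V} (hc : IsCubic G) {v : V} {e : Sym2 V}
    {e1 e2 : Sym2 (ExpandVert G v)} : EdgeRel G v e e1 → EdgeRel G v e e2 → e1 = e2 := by
  rintro (⟨a, b, rfl, rfl⟩ | ⟨x, y, z, h1, h2, h3, rfl, rfl⟩)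
      (⟨a', b', h4, rfl⟩ | ⟨x', y', z', h4, h5, h6, h7, rfl⟩)
  · simpa [Sym2.eq_iff, Subtype.ext_iff] using h4
  · exfalso
    rcases Sym2.eq_iff.1 h7 with ⟨h, -⟩ | ⟨-, h⟩
    · exact a.2 h
    · exact b.2 h
  · exfalso
    rcases Sym2.eq_iff.1 h4 with ⟨h, -⟩ | ⟨h, -⟩
    · exact a'.2 h.symm
    · exact b'.2 h.symm
  · have hx : x' = x := by
      rcases Sym2.eq_iff.1 h7 with ⟨-, h⟩ | ⟨h, -⟩
      · exact Subtype.ext h.symm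
      · exact absurd h.symm (nbr_ne x')
    subst hx
    have hyz : ∀ u, u ≠ x' → u = y ∨ u = z := by
      intro u hu
      obtain ⟨r, h8, h9, h10⟩ := hc.exists_nbr_of_adj y.2 z.2 (fun e => h1 (Subtype.ext e))
      simp only [Subtype.ext_iff, Ne] at *
      have := (h10 u.1).1 u.2
      have := (h10 x'.1).1 x'.2
      grind
    have h11 := hyz y' h5.symm
    have h12 := hyz z' h6.symm
    rw [Sym2.eq_iff]
    grind

theorem Klee.numLonely_expand_le {V : Type} {G : SimpleGraph V} (hG : Klee G) (v : V) :
    numLonely (LonelyEdge.expand G v) ≤ numLonely G := by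
  have := hG.finite
  exact ncard_le_of_rel (EdgeRel G v) (fun _ he => hG.exists_edgeRel he)
    fun _ _ _ => EdgeRel.eq hG.isCubic

end LonelyEdge
namespace LonelyEdge

/-! ### Barriers -/

section
variable {V : Type*}

theorem even_card_of_involution {U : Finset V} {σ : V → V} (h : ∀ a ∈ U, σ a ∈ U)
    (h1 : ∀ a, σ (σ a) = a) (h2 : ∀ a, σ a ≠ a) : Even U.card := by
  rw [← ZMod.natCast_eq_zero_iff_even, Finset.cast_card]
  exact Finset.sum_involution (fun a _ => σ a) (fun _ _ => by decide) (fun a _ _ => h2 a) h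
    (fun a _ => h1 a)

/-- Tutte's theorem for the subgraph induced on `U`, with `K` the odd components left after removing
`S`. The surplus is 2 instead of 1 because the number of odd components has the parity of `S` when
`U` is even. -/
theorem exists_barrier [Finite V] [DecidableEq V] (G : SimpleGraph V) (U : Finset V)
    (hU : Even U.card)
    (hno : ¬ ∃ σ : V → V, ∀ a ∈ U, σ a ∈ U ∧ G.Adj a (σ a) ∧ σ (σ a) = a) :
    ∃ (S : Finset V) (K : Finset (Finset V)), S ⊆ U ∧
      (∀ B ∈ K, B ⊆ U ∧ Disjoint B S ∧ Odd B.card) ∧ (K : Set (Finset V)).PairwiseDisjoint id ∧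
      (∀ B ∈ K, ∀ p ∈ B, ∀ q ∈ U, G.Adj p q → q ∈ B ∨ q ∈ S) ∧ S.card + 2 ≤ K.card := by
  classical
  let H : SimpleGraph U := G.induce (U : Set V)
  have hH : ¬ ∃ M : H.Subgraph, M.IsPerfectMatching := by
    rw [← exists_isPM_iff]
    rintro ⟨σ, hσ⟩
    refine hno ⟨fun a => if h : a ∈ U then (σ ⟨a, h⟩).1 else a, fun a ha => ?_⟩
    simp only [ha, dif_pos, Finset.coe_mem, hσ.invol, Subtype.coe_eta, and_true, true_and]
    exact hσ.adj ⟨a, ha⟩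
  rw [SimpleGraph.tutte] at hH
  push Not at hH
  obtain ⟨u, hu⟩ := hH
  rw [SimpleGraph.IsTutteViolator] at hu
  set Q := ((⊤ : H.Subgraph).deleteVerts u) with hQ
  let f : Q.coe.ConnectedComponent → Finset V := fun c =>
    (c.supp.toFinite.toFinset).image fun w => w.1.1
  have hinj : Function.Injective fun w : Q.verts => (w.1.1 : V) := by
    intro a b h
    exact Subtype.ext (Subtype.ext h)
  have hmem : ∀ c (w : Q.verts), w.1.1 ∈ f c ↔ Q.coe.connectedComponentMk w = c := by
    intro c w
    simp only [f, Finset.mem_image, Set.Finite.mem_toFinset, SimpleGraph.ConnectedComponent.mem_supp_iff]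
    constructor
    · rintro ⟨w', h1, h2⟩
      rw [← hinj h2]
      exact h1
    · intro h
      exact ⟨w, h, rfl⟩
  have hmem' : ∀ c p, p ∈ f c → ∃ w : Q.verts, w.1.1 = p := by
    intro c p hp
    obtain ⟨w, -, h⟩ := Finset.mem_image.1 hp
    exact ⟨w, h⟩
  have hverts : ∀ w : U, w ∈ Q.verts ↔ w ∉ u := by
    intro w
    simp [hQ]
  have hfinj : Function.Injective f := by
    intro c d h
    obtain ⟨w, rfl⟩ := c.exists_rep
    have h1 := (hmem _ w).2 rfl
    exact (hmem _ w).1 (h ▸ h1)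
  have hcardf : ∀ c, (f c).card = c.supp.ncard := by
    intro c
    rw [Finset.card_image_of_injective _ hinj, Set.ncard_eq_toFinset_card]
  refine ⟨u.toFinite.toFinset.image Subtype.val,
    (Q.coe.oddComponents.toFinite.toFinset).image f, ?_, ?_, ?_, ?_, ?_⟩
  · intro a ha
    obtain ⟨w, -, rfl⟩ := Finset.mem_image.1 ha
    exact w.2
  · intro B hB
    obtain ⟨c, hc, rfl⟩ := Finset.mem_image.1 hB
    refine ⟨fun p hp => ?_, Finset.disjoint_left.2 fun p hp hpS => ?_, ?_⟩
    · obtain ⟨w, rfl⟩ := hmem' c p hp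
      exact w.1.2
    · obtain ⟨w, rfl⟩ := hmem' c p hp
      obtain ⟨z, hz, hzw⟩ := Finset.mem_image.1 hpS
      rw [Subtype.ext hzw] at hz
      exact (hverts _).1 w.2 (by simpa using hz)
    · rw [hcardf]
      simpa using hc
  · rintro B hB B' hB' hne
    obtain ⟨c, hc, rfl⟩ := Finset.mem_image.1 hB
    obtain ⟨c', hc', rfl⟩ := Finset.mem_image.1 hB'
    refine Finset.disjoint_left.2 fun p hp hp' => hne ?_
    obtain ⟨w, rfl⟩ := hmem' c p hp
    rw [← (hmem c w).1 hp, ← (hmem c' w).1 hp']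
  · intro B hB p hp q hq hpq
    obtain ⟨c, hc, rfl⟩ := Finset.mem_image.1 hB
    obtain ⟨w, rfl⟩ := hmem' c p hp
    by_cases hqu : (⟨q, hq⟩ : U) ∈ u
    · right
      exact Finset.mem_image.2 ⟨⟨q, hq⟩, by simpa using hqu, rfl⟩
    · left
      have hqv := (hverts _).2 hqu
      refine (hmem c ⟨⟨q, hq⟩, hqv⟩).2 ?_
      rw [← (hmem c w).1 hp]
      apply SimpleGraph.ConnectedComponent.sound
      apply SimpleGraph.Adj.reachable
      have hwv := (hverts _).1 w.2
      simp only [SimpleGraph.Subgraph.coe_adj, hQ, SimpleGraph.Subgraph.deleteVerts_adj,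
        SimpleGraph.Subgraph.verts_top, Set.mem_univ, true_and, SimpleGraph.Subgraph.top_adj]
      exact ⟨hqu, hwv, hpq.symm⟩
  · rw [Finset.card_image_of_injective _ hfinj,
      Finset.card_image_of_injective _ Subtype.val_injective, ← Set.ncard_eq_toFinset_card,
      ← Set.ncard_eq_toFinset_card]
    have hpar := SimpleGraph.odd_ncard_oddComponents (G := Q.coe)
    have h1 : Nat.card Q.verts = U.card - u.ncard := by
      have : Q.verts = uᶜ := by
        ext w
        simp [hverts]
      rw [this, Nat.card_coe_set_eq, Set.ncard_compl]
      simp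
    have h2 : u.ncard ≤ U.card := by
      have := Set.ncard_le_card u
      simpa using this
    rw [h1] at hpar
    rw [Nat.odd_sub h2, iff_false_left (Nat.not_odd_iff_even.2 hU), Nat.not_even_iff_odd] at hpar
    -- A surplus of exactly one contradicts the parity relation `hpar`.
    have h3 : Q.coe.oddComponents.ncard ≠ u.ncard + 1 := by
      intro h
      rw [h, Nat.odd_add_one] at hpar
      tauto
    omega

/-- On a finite set some point is periodic, and `f` permutes its periodic points; let the
permutation fix all other points. It serves to turn a choice of new partners into a new matching. -/
theorem exists_perm_of_map {α : Type*} [Finite α] [Nonempty α] (f : α → α) :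
    ∃ π : Equiv.Perm α, (∀ s, π s = f s ∨ π s = s) ∧ ∃ s, π s = f s := by
  classical
  let g : α → α := fun s => if s ∈ Function.periodicPts f then f s else s
  have hbij := Function.bijOn_periodicPts (f := f)
  have hg : Function.Injective g := by
    intro s t h
    by_cases hs : s ∈ Function.periodicPts f <;> by_cases ht : t ∈ Function.periodicPts f <;>
      simp only [g, hs, ht, if_true, if_false] at h
    · exact hbij.injOn hs ht h
    · exact absurd (h ▸ hbij.mapsTo hs) ht
    · exact absurd (h ▸ hbij.mapsTo ht) hs
    · exact h
  refine ⟨Equiv.ofBijective g (Finite.injective_iff_bijective.1 hg), fun s => ?_, ?_⟩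
  · by_cases hs : s ∈ Function.periodicPts f <;> simp [g, hs]
  · obtain ⟨s⟩ := ‹Nonempty α›
    obtain ⟨m, n, hmn, h⟩ := Finite.exists_ne_map_eq_of_infinite fun n : ℕ => f^[n] s
    have key : ∀ m n, m < n → f^[m] s = f^[n] s → ∃ s, s ∈ Function.periodicPts f := by
      intro m n hlt h
      refine ⟨f^[m] s, Function.mk_mem_periodicPts (n := n - m) (by omega) ?_⟩
      rw [Function.IsPeriodicPt, Function.IsFixedPt, ← Function.iterate_add_apply, h]
      congr 1
      omega
    have : ∃ s, s ∈ Function.periodicPts f := by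
      rcases lt_or_gt_of_ne hmn with h' | h'
      · exact key m n h' h
      · exact key n m h' h.symm
    obtain ⟨s, hs⟩ := this
    exact ⟨s, by simp [g, hs]⟩

end

end LonelyEdge
namespace LonelyEdge

/-! ### Edge cuts and the triangle forced by a lonely edge -/

section
variable {V : Type*} [Fintype V]

/-- The number of edges leaving `Y`. -/
def boundary (G : SimpleGraph V) [DecidableEq V] [DecidableRel G.Adj] (Y : Finset V) : ℕ :=
  ∑ p ∈ Y, (G.neighborFinset p \ Y).card

theorem IsCubic.card_neighborFinset {G : SimpleGraph V} [DecidableRel G.Adj] (h : IsCubic G)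
    (v : V) : (G.neighborFinset v).card = 3 := by
  rw [SimpleGraph.neighborFinset, ← Set.ncard_eq_toFinset_card']
  exact h v

variable [DecidableEq V]

/-- In a cubic graph, an edge cut of size at most two can be traded for a vertex cut: delete the
inner end of one edge and the outer end of the other. If one side becomes empty, it was a single
vertex with at most two neighbours, against cubicity. -/
theorem CutConn.three_le_boundary {G : SimpleGraph V} [DecidableRel G.Adj] (hc : IsCubic G)
    (h : CutConn G) {Y : Finset V} (hY : Y.Nonempty) (hY' : ∃ b, b ∉ Y) : 3 ≤ boundary G Y := by
  by_contra hlt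
  let P : Finset (V × V) := Y.biUnion fun p => (G.neighborFinset p \ Y).image fun q => (p, q)
  have hP : P.card ≤ 2 := by
    have : P.card ≤ boundary G Y := by
      refine Finset.card_biUnion_le.trans (Finset.sum_le_sum fun p _ => Finset.card_image_le)
    omega
  have hmem : ∀ p q, p ∈ Y → G.Adj p q → q ∉ Y → (p, q) ∈ P := by
    intro p q hp hpq hq
    simp only [P, Finset.mem_biUnion, Finset.mem_image]
    exact ⟨p, hp, q, by simp [hpq, hq], rfl⟩
  obtain ⟨b, hb⟩ := hY'
  obtain ⟨y, hy⟩ := hY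
  by_cases hP0 : P.Nonempty
  · obtain ⟨⟨p1, q1⟩, hpq1⟩ := hP0
    -- The second cut edge may coincide with the first one.
    obtain ⟨⟨p2, q2⟩, hpq2, hP12⟩ : ∃ y ∈ P, ∀ z ∈ P, z = (p1, q1) ∨ z = y := by
      by_cases h1 : ∃ y ∈ P, y ≠ (p1, q1)
      · obtain ⟨y, hy, hne⟩ := h1
        refine ⟨y, hy, fun z hz => ?_⟩
        by_contra hcon
        push Not at hcon
        have : ({(p1, q1), y, z} : Finset (V × V)).card ≤ P.card := Finset.card_le_card (by
          intro t
          simp only [Finset.mem_insert, Finset.mem_singleton]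
          rintro (rfl | rfl | rfl) <;> assumption)
        rw [Finset.card_eq_three.2 ⟨_, _, _, hne.symm, hcon.1.symm, hcon.2.symm, rfl⟩] at this
        omega
      · push Not at h1
        exact ⟨_, hpq1, fun z hz => Or.inl (h1 z hz)⟩
    have hcases : ∀ p q, p ∈ Y → G.Adj p q → q ∉ Y → (p = p1 ∧ q = q1) ∨ (p = p2 ∧ q = q2) := by
      intro p q hp hpq hq
      simpa using hP12 _ (hmem p q hp hpq hq)
    have hq2 : q2 ∉ Y := by
      simp only [P, Finset.mem_biUnion, Finset.mem_image] at hpq2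
      obtain ⟨p, hp, q, hq, h⟩ := hpq2
      simp only [Prod.mk.injEq] at h
      rw [← h.2]
      exact (Finset.mem_sdiff.1 hq).2
    by_cases hA : ∃ p ∈ Y, p ≠ p1
    · obtain ⟨p, hp, hpp⟩ := hA
      -- Nothing joins the rest of `Y` to the outside once `p1` and `q2` are deleted, so `q2` is the
      -- only vertex outside `Y`; its neighbours are then among `p1` and `p2`.
      have hall := h {p1, q2} {p | p ∈ Y ∧ p ≠ p1}
        (lt_of_le_of_lt (Set.ncard_insert_le _ _) (by simp)) ⟨p, hp, hpp⟩ ?_ ?_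
      · have hcompl : ∀ b, b ∉ Y → b = q2 := by
          intro b hb
          rcases hall b with h1 | h1 | h1
          · exact absurd h1.1 hb
          · have : p1 ∈ Y := by
              simp only [P, Finset.mem_biUnion, Finset.mem_image] at hpq1
              obtain ⟨p, hp, q, hq, h⟩ := hpq1
              simp only [Prod.mk.injEq] at h
              rwa [← h.1]
            exact absurd (h1 ▸ this) hb
          · exact h1
        obtain ⟨r1, r2, r3, h1, h2, h3, h4⟩ := hc.exists_nbrs q2
        have hr : ∀ r, G.Adj q2 r → r = p1 ∨ r = p2 := by
          intro r hr
          have hrY : r ∈ Y := by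
            by_contra hrY
            rw [hcompl r hrY] at hr
            exact G.irrefl hr
          exact (hcases r q2 hrY hr.symm hq2).imp And.left And.left
        have e1 := hr r1 (by simp [h4])
        have e2 := hr r2 (by simp [h4])
        have e3 := hr r3 (by simp [h4])
        grind
      · rw [Set.disjoint_left]
        rintro a ⟨ha, ha'⟩ (h1 | h1)
        · exact ha' h1
        · exact hq2 (h1 ▸ ha)
      · rintro a ⟨ha, ha'⟩ c hac
        by_cases hcY : c ∈ Y
        · by_cases hcp : c = p1
          · exact Or.inr (Or.inl hcp)
          · exact Or.inl ⟨hcY, hcp⟩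
        · rcases hcases a c ha hac hcY with h1 | h1
          · exact absurd h1.1 ha'
          · exact Or.inr (Or.inr h1.2)
    · push Not at hA
      obtain ⟨r1, r2, r3, h1, h2, h3, h4⟩ := hc.exists_nbrs p1
      have hr : ∀ r, G.Adj p1 r → r = q1 ∨ r = q2 := by
        intro r hr
        have hrY : r ∉ Y := fun hrY => G.irrefl (hA r hrY ▸ hr)
        exact (hcases p1 r (hA y hy ▸ hy) hr hrY).imp And.right And.right
      have e1 := hr r1 (by simp [h4])
      have e2 := hr r2 (by simp [h4])
      have e3 := hr r3 (by simp [h4])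
      grind
  · rw [Finset.not_nonempty_iff_eq_empty] at hP0
    rcases h ∅ Y (by simp) ⟨y, hy⟩ (by simp) (fun a ha c hac => Or.inl (by
      by_contra hcY
      have := hmem a c ha hac hcY
      rw [hP0] at this
      simp at this)) b with h1 | h1
    · exact hb h1
    · exact h1

/-- A set that a perfect matching leaves along one edge only and that has three edges leaving it
contains a triangle that shares an edge with the matching, if no other perfect matching agrees
with the given one outside the set. -/
theorem exists_triangle {G : SimpleGraph V} [DecidableRel G.Adj] (hc : IsCubic G)
    (hconn : CutConn G) {σ : V → V} (hσ : IsPM G σ) {u : V}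
    (huniq : ∀ τ, IsPM G τ → τ u = σ u → τ = σ) :
    ∀ (n : ℕ) (C : Finset V) (a : V), C.card = n → u ∉ C → a ∈ C → σ a ∉ C →
      (∀ c ∈ C, c ≠ a → σ c ∈ C) → boundary G C = 3 → 1 < C.card →
      ∃ x y z, G.Adj x y ∧ G.Adj y z ∧ G.Adj x z ∧ σ y = z := by
  intro n
  induction n using Nat.strong_induction_on with
  | _ n ih =>
  intro C a hn hu ha hσa hC hbd hcard
  by_contra hnotri
  push Not at hnotri
  have hσne : ∀ b, σ b ≠ b := fun b => (hσ.adj b).ne'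
  obtain ⟨x, hx, hxa⟩ := Finset.exists_mem_ne hcard a
  have hy := hC x hx hxa
  set y := σ x with hyx
  have hσy : σ y = x := hσ.invol x
  have hya : y ≠ a := fun h => hσa (by rw [← h, hσy]; exact hx)
  set U := C.erase a with hUdef
  have hUmem : ∀ p, p ∈ U ↔ p ≠ a ∧ p ∈ C := fun p => Finset.mem_erase
  have hσU : ∀ p ∈ U, σ p ∈ U := by
    intro p hp
    rw [hUmem] at hp ⊢
    exact ⟨fun h => hσa (by rw [← h, hσ.invol]; exact hp.2), hC p hp.2 hp.1⟩
  have hUeven : Even U.card := even_card_of_involution hσU hσ.invol hσne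
  -- A perfect matching of `U` that avoids `xy`, completed by `σ` outside `U`, would be a second
  -- perfect matching agreeing with `σ` at `u`. Hence `U` has none once `xy` is deleted.
  obtain ⟨S, K, hSU, hK, hKd, hKcl, hKcard⟩ := exists_barrier (G.deleteEdges {s(x, y)}) U hUeven (by
    rintro ⟨τ, hτ⟩
    have hσU' : ∀ p, p ∉ U → σ p ∉ U := fun p hp h => hp (by
      have := hσU _ h
      rwa [hσ.invol] at this)
    have hPM : IsPM G fun b => if b ∈ U then τ b else σ b := by
      intro b
      by_cases hb : b ∈ U
      · obtain ⟨h1, h2, h3⟩ := hτ b hb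
        rw [SimpleGraph.deleteEdges_adj] at h2
        simp [hb, h1, h2.1, h3]
      · simp [hb, hσU' b hb, hσ.adj, hσ.invol]
    have hxU : x ∈ U := (hUmem x).2 ⟨hxa, hx⟩
    have huU : u ∉ U := fun h => hu ((hUmem u).1 h).2
    have := congrFun (huniq _ hPM (by simp [huU])) x
    simp only [hxU, if_true] at this
    have h2 := (hτ x hxU).2.1
    rw [this, SimpleGraph.deleteEdges_adj] at h2
    exact h2.2 rfl)
  have hKcl' : ∀ B ∈ K, ∀ p ∈ B, ∀ q ∈ U, G.Adj p q → q ∈ B ∨ q ∈ S ∨ s(p, q) = s(x, y) := by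
    intro B hB p hp q hq hpq
    by_cases h : s(p, q) = s(x, y)
    · exact Or.inr (Or.inr h)
    · rcases hKcl B hB p hp q hq (by simpa [SimpleGraph.deleteEdges_adj, hpq] using h) with h | h
      · exact Or.inl h
      · exact Or.inr (Or.inl h)
  have hUC : U ⊆ C := Finset.erase_subset _ _
  set D := U \ S with hD
  set R := D \ K.biUnion id with hR
  have hKD : K.biUnion id ⊆ D := by
    intro p hp
    obtain ⟨B, hB, hpB⟩ := Finset.mem_biUnion.1 hp
    exact Finset.mem_sdiff.2 ⟨(hK B hB).1 hpB, Finset.disjoint_left.1 (hK B hB).2.1 hpB⟩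
  have hRcl : ∀ p ∈ R, ∀ q ∈ U, G.Adj p q → q ∈ R ∨ q ∈ S ∨ s(p, q) = s(x, y) := by
    intro p hp q hq hpq
    by_cases hqS : q ∈ S
    · exact Or.inr (Or.inl hqS)
    · by_cases hqK : q ∈ K.biUnion id
      · obtain ⟨B, hB, hqB⟩ := Finset.mem_biUnion.1 hqK
        rw [hR, Finset.mem_sdiff, hD, Finset.mem_sdiff] at hp
        rcases hKcl' B hB q hqB p hp.1.1 hpq.symm with h | h | h
        · exact absurd (Finset.mem_biUnion.2 ⟨B, hB, h⟩) hp.2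
        · exact absurd h hp.1.2
        · exact Or.inr (Or.inr (by rw [Sym2.eq_swap, h]))
      · exact Or.inl (Finset.mem_sdiff.2 ⟨Finset.mem_sdiff.2 ⟨hq, hqS⟩, hqK⟩)
  -- `w p` bounds the number of edges by which `p` leaves its part of `D`: such an edge goes to `S`,
  -- to `a`, out of `C`, or is `xy`.
  let w : V → ℕ := fun p => (G.neighborFinset p ∩ S).card + (G.neighborFinset p ∩ {a}).card +
    (G.neighborFinset p \ C).card + if p ∈ ({x, y} : Finset V) then 1 else 0
  have hblock : ∀ B : Finset V, B ⊆ U →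
      (∀ p ∈ B, ∀ q ∈ U, G.Adj p q → q ∈ B ∨ q ∈ S ∨ s(p, q) = s(x, y)) →
      boundary G B ≤ ∑ p ∈ B, w p := by
    intro B hBU hBcl
    refine Finset.sum_le_sum fun p hp => ?_
    have hsub : G.neighborFinset p \ B ⊆ (G.neighborFinset p ∩ S) ∪ (G.neighborFinset p ∩ {a}) ∪
        (G.neighborFinset p \ C) ∪ (if p ∈ ({x, y} : Finset V) then {σ p} else ∅) := by
      intro q hq
      rw [Finset.mem_sdiff, SimpleGraph.mem_neighborFinset] at hq
      simp only [Finset.mem_union, Finset.mem_inter, SimpleGraph.mem_neighborFinset, hq.1, true_and,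
        Finset.mem_sdiff, Finset.mem_singleton]
      by_cases hqC : q ∈ C
      · by_cases hqa : q = a
        · tauto
        · rcases hBcl p hp q ((hUmem q).2 ⟨hqa, hqC⟩) hq.1 with h | h | h
          · exact absurd h hq.2
          · tauto
          · right
            rcases Sym2.eq_iff.1 h with ⟨rfl, rfl⟩ | ⟨rfl, rfl⟩
            · simp [hyx]
            · simp [hσy]
      · tauto
    refine (Finset.card_le_card hsub).trans ((Finset.card_union_le _ _).trans ?_)
    refine add_le_add ((Finset.card_union_le _ _).trans
      (add_le_add_left (Finset.card_union_le _ _) _)) ?_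
    split_ifs <;> simp
  have hsumD : ∑ B ∈ K, ∑ p ∈ B, w p + ∑ p ∈ R, w p = ∑ p ∈ D, w p := by
    have := Finset.sum_biUnion (f := w) (s := K) (t := id) hKd
    simp only [id] at this
    rw [← this, add_comm, hR]
    exact Finset.sum_sdiff hKD
  have hKbd : ∑ B ∈ K, boundary G B ≤ ∑ B ∈ K, ∑ p ∈ B, w p :=
    Finset.sum_le_sum fun B hB => hblock B (hK B hB).1 (hKcl' B hB)
  have hRbd : boundary G R ≤ ∑ p ∈ R, w p :=
    hblock R (Finset.sdiff_subset.trans Finset.sdiff_subset) hRcl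
  have hthree : ∀ B : Finset V, B ⊆ U → B.Nonempty → 3 ≤ boundary G B := fun B hB hne =>
    hconn.three_le_boundary hc hne ⟨a, fun h => ((hUmem a).1 (hB h)).1 rfl⟩
  have hKne : ∀ B ∈ K, B.Nonempty := fun B hB => Finset.card_pos.1 (hK B hB).2.2.pos
  have hK3 : K.card * 3 ≤ ∑ B ∈ K, boundary G B := by
    rw [← smul_eq_mul]
    exact Finset.card_nsmul_le_sum _ _ _ fun B hB => hthree B (hK B hB).1 (hKne B hB)
  -- The total weight is at least `3|K| ≥ 3|S| + 6`, as at least three edges leave each member of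
  -- `K`. It is at most `3|S| + 2 + 2 + 2`: at most three edges at each vertex of `S`, two at `a`
  -- (the edge to `σ a` leaves `C`), two of the three edges leaving `C` (one is at `a`), and the two
  -- ends of `xy`. So all the bounds are equalities.
  have hw : ∑ p ∈ D, w p = ∑ p ∈ D, (G.neighborFinset p ∩ S).card +
      ∑ p ∈ D, (G.neighborFinset p ∩ {a}).card + ∑ p ∈ D, (G.neighborFinset p \ C).card +
      ∑ p ∈ D, if p ∈ ({x, y} : Finset V) then 1 else 0 := by
    simp only [w, Finset.sum_add_distrib]
  have hswap : ∀ T : Finset V, ∑ p ∈ D, (G.neighborFinset p ∩ T).card =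
      ∑ s ∈ T, (G.neighborFinset s ∩ D).card := by
    intro T
    have := Finset.sum_card_bipartiteAbove_eq_sum_card_bipartiteBelow (s := D) (t := T) G.Adj
    convert this using 3 with p hp p hp
    · ext q
      simp [Finset.bipartiteAbove, and_comm]
    · ext q
      simp [Finset.bipartiteBelow, and_comm, G.adj_comm]
  have hS3 : ∀ s ∈ S, (G.neighborFinset s ∩ D).card ≤ 3 := fun s _ =>
    (Finset.card_le_card Finset.inter_subset_left).trans (hc.card_neighborFinset s).le
  have hs1 : ∑ s ∈ S, (G.neighborFinset s ∩ D).card ≤ S.card * 3 := by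
    rw [← smul_eq_mul]
    exact Finset.sum_le_card_nsmul _ _ _ hS3
  have hDC : D ⊆ C := Finset.sdiff_subset.trans hUC
  have hs2 : (G.neighborFinset a ∩ D).card ≤ 2 := by
    have : G.neighborFinset a ∩ D ⊆ (G.neighborFinset a).erase (σ a) := by
      intro q hq
      rw [Finset.mem_inter] at hq
      exact Finset.mem_erase.2 ⟨fun h => hσa (h ▸ hDC hq.2), hq.1⟩
    refine (Finset.card_le_card this).trans ?_
    rw [Finset.card_erase_of_mem (by simpa using hσ.adj a), hc.card_neighborFinset]
  have hs3 : ∑ p ∈ D, (G.neighborFinset p \ C).card ≤ 2 := by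
    have h1 : 1 ≤ (G.neighborFinset a \ C).card :=
      Finset.card_pos.2 ⟨σ a, Finset.mem_sdiff.2 ⟨by simpa using hσ.adj a, hσa⟩⟩
    have h2 : ∑ p ∈ D, (G.neighborFinset p \ C).card ≤ ∑ p ∈ U, (G.neighborFinset p \ C).card :=
      Finset.sum_le_sum_of_subset Finset.sdiff_subset
    have h3 := Finset.add_sum_erase C (fun p => (G.neighborFinset p \ C).card) ha
    rw [boundary] at hbd
    rw [← hUdef] at h3
    omega
  have hs4' : ∑ p ∈ D, (if p ∈ ({x, y} : Finset V) then 1 else 0) = (D ∩ {x, y}).card := by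
    rw [Finset.sum_boole, Finset.filter_mem_eq_inter]
    simp
  have hxy : x ≠ y := (hσne x).symm
  have hs4 : (D ∩ {x, y}).card ≤ 2 :=
    (Finset.card_le_card Finset.inter_subset_right).trans (Finset.card_pair hxy).le
  rw [hswap S, hswap {a}, Finset.sum_singleton, hs4'] at hw
  have hR0 : R = ∅ := by
    by_contra hne
    have := hthree R (Finset.sdiff_subset.trans Finset.sdiff_subset)
      (Finset.nonempty_iff_ne_empty.2 hne)
    omega
  have hKcard' : K.card = S.card + 2 := by omega
  have hxyD : (D ∩ {x, y}).card = 2 := by omega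
  have haD : (G.neighborFinset a ∩ D).card = 2 := by omega
  have hSD : ∀ s ∈ S, (G.neighborFinset s ∩ D).card = 3 := by
    have : ∑ s ∈ S, (G.neighborFinset s ∩ D).card = ∑ s ∈ S, 3 := by
      rw [Finset.sum_const, smul_eq_mul]
      omega
    exact (Finset.sum_eq_sum_iff_of_le hS3).1 this
  have hK3' : ∀ B ∈ K, boundary G B = 3 := by
    have : ∑ B ∈ K, 3 = ∑ B ∈ K, boundary G B := by
      rw [Finset.sum_const, smul_eq_mul]
      omega
    intro B hB
    exact ((Finset.sum_eq_sum_iff_of_le fun B hB => hthree B (hK B hB).1 (hKne B hB)).1 this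
      B hB).symm
  have hxD : x ∈ D ∧ y ∈ D := by
    have := Finset.eq_of_subset_of_card_le (Finset.inter_subset_right (s₁ := D) (s₂ := {x, y}))
      (by rw [hxyD, Finset.card_pair hxy])
    constructor
    · exact Finset.inter_subset_left (this ▸ (by simp : x ∈ ({x, y} : Finset V)))
    · exact Finset.inter_subset_left (this ▸ (by simp : y ∈ ({x, y} : Finset V)))
  have hout : ∀ B ∈ K, ∀ p ∈ B, σ p ∉ B → σ p ∈ S ∨ p = x ∨ p = y := by
    intro B hB p hp hσp
    rcases hKcl' B hB p hp (σ p) (hσU p ((hK B hB).1 hp)) (hσ.adj p) with h | h | h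
    · exact absurd h hσp
    · exact Or.inl h
    · rcases Sym2.eq_iff.1 h with ⟨h, -⟩ | ⟨h, -⟩
      · exact Or.inr (Or.inl h)
      · exact Or.inr (Or.inr h)
  have hexit : ∀ B ∈ K, 1 ≤ (B.filter fun p => σ p ∉ B).card := by
    intro B hB
    by_contra hlt
    have h0 : B.filter (fun p => σ p ∉ B) = ∅ := by
      rw [← Finset.card_eq_zero]
      omega
    rw [Finset.filter_eq_empty_iff] at h0
    push Not at h0
    exact Nat.not_even_iff_odd.2 (hK B hB).2.2
      (even_card_of_involution (fun p hp => h0 hp) hσ.invol hσne)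
  -- `σ` leaves each odd set at least once, and every exit goes to `S` or starts at `x` or `y`. That
  -- is at most `|S| + 2 = |K|` exits, hence exactly one per member of `K`.
  have hexit1 : ∀ B ∈ K, (B.filter fun p => σ p ∉ B).card = 1 := by
    have hsum : ∑ B ∈ K, (B.filter fun p => σ p ∉ B).card ≤ K.card := by
      rw [← Finset.card_biUnion, hKcard']
      · refine (Finset.card_le_card (t := S.image σ ∪ {x, y}) ?_).trans
          ((Finset.card_union_le _ _).trans (add_le_add Finset.card_image_le
            (Finset.card_pair hxy).le))
        intro p hp
        obtain ⟨B, hB, hpB⟩ := Finset.mem_biUnion.1 hp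
        rw [Finset.mem_filter] at hpB
        rcases hout B hB p hpB.1 hpB.2 with h | h | h
        · exact Finset.mem_union_left _ (Finset.mem_image.2 ⟨_, h, hσ.invol p⟩)
        · simp [h]
        · simp [h]
      · intro B hB B' hB' hne
        exact (hKd hB hB' hne).mono (Finset.filter_subset _ _) (Finset.filter_subset _ _)
    have hge : ∑ B ∈ K, 1 ≤ ∑ B ∈ K, (B.filter fun p => σ p ∉ B).card :=
      Finset.sum_le_sum hexit
    have heq : ∑ B ∈ K, 1 = ∑ B ∈ K, (B.filter fun p => σ p ∉ B).card := by
      rw [Finset.sum_const, smul_eq_mul, mul_one] at hge ⊢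
      omega
    intro B hB
    exact ((Finset.sum_eq_sum_iff_of_le hexit).1 heq B hB).symm
  -- A larger member of `K` has three boundary edges and a single exit of `σ`, so the induction
  -- hypothesis applies to it.
  have hsing : ∀ B ∈ K, B.card = 1 := by
    intro B hB
    by_contra hne
    have hodd := (hK B hB).2.2
    have h1 : 1 < B.card := by
      have := hodd.pos
      omega
    obtain ⟨b, hb⟩ := Finset.card_eq_one.1 (hexit1 B hB)
    have hbm : ∀ p, (p ∈ B ∧ σ p ∉ B) ↔ p = b := by
      intro p
      rw [← Finset.mem_singleton, ← hb, Finset.mem_filter]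
    have hbB := (hbm b).2 rfl
    have hBC : B.card < n := by
      rw [← hn]
      refine Finset.card_lt_card ⟨(hK B hB).1.trans hUC, fun h => ?_⟩
      exact ((hUmem a).1 ((hK B hB).1 (h ha))).1 rfl
    obtain ⟨x, y, z, h1, h2, h3, h4⟩ := ih B.card hBC B b rfl
      (fun h => hu (hUC ((hK B hB).1 h))) hbB.1 hbB.2
      (fun p hp hpb => by
        by_contra h
        exact hpb ((hbm p).1 ⟨hp, h⟩))
      (hK3' B hB) h1
    exact hnotri x y z h1 h2 h3 h4
  have hDK : ∀ p ∈ D, {p} ∈ K := by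
    intro p hp
    have : p ∈ K.biUnion id := by
      by_contra h
      have h' : p ∈ R := Finset.mem_sdiff.2 ⟨hp, h⟩
      rw [hR0] at h'
      simp at h'
    obtain ⟨B, hB, hpB⟩ := Finset.mem_biUnion.1 this
    obtain ⟨q, hq⟩ := Finset.card_eq_one.1 (hsing B hB)
    have : p ∈ B := hpB
    rw [hq, Finset.mem_singleton] at this
    rw [this, ← hq]
    exact hB
  rcases S.eq_empty_or_nonempty with hS0 | hSne
  -- With `S` empty, `D` is just `{x, y}` and both vertices are adjacent to `a`: the triangle is `a
  -- x y`.
  · have hDcard : D.card = 2 := by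
      have h1 : D.card ≤ K.card :=
        Finset.card_le_card_of_injOn (fun p => {p}) hDK (fun p _ q _ h => Finset.singleton_inj.1 h)
      have h2 := Finset.card_le_card (Finset.inter_subset_left (s₁ := D) (s₂ := {x, y}))
      rw [hKcard', hS0, Finset.card_empty] at h1
      omega
    have hsub := Finset.eq_of_subset_of_card_le
      (Finset.inter_subset_right (s₁ := G.neighborFinset a) (s₂ := D)) (by omega)
    have h1 : ∀ p ∈ D, G.Adj a p := by
      intro p hp
      rw [← hsub, Finset.mem_inter] at hp
      simpa using hp.1
    exact hnotri a x y (h1 x hxD.1) (hσ.adj x) (h1 y hxD.2) rfl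
  · have hND : ∀ s ∈ S, ∀ q, G.Adj s q → q ∈ D := by
      intro s hs q hq
      have := Finset.eq_of_subset_of_card_le
        (Finset.inter_subset_left (s₁ := G.neighborFinset s) (s₂ := D))
        (by rw [hSD s hs, hc.card_neighborFinset])
      have hq' : q ∈ G.neighborFinset s := by simpa using hq
      rw [← this] at hq'
      exact (Finset.mem_inter.1 hq').2
    have hDS : ∀ p ∈ D, p ∉ S := fun p hp => (Finset.mem_sdiff.1 hp).2
    -- Otherwise the two neighbours of `s` other than `σ s` are `x` and `y`, and `s x y` is a
    -- triangle containing the matching edge `xy`.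
    have hφ : ∀ s ∈ S, ∃ q, G.Adj s q ∧ q ≠ x ∧ q ≠ y ∧ q ≠ σ s := by
      intro s hs
      obtain ⟨q, r, h1, h2, h3, h4⟩ := hc.exists_nbrs_of_adj (hσ.adj s)
      have hσs := hND s hs _ (hσ.adj s)
      by_contra hcon
      push Not at hcon
      have hq : G.Adj s q := (h4 q).2 (by tauto)
      have hr : G.Adj s r := (h4 r).2 (by tauto)
      have hqq := hcon q hq
      have hrr := hcon r hr
      by_cases hqx : q = x
      · by_cases hry : r = y
        · subst hqx hry
          exact hnotri s q _ hq (hσ.adj q) hr rfl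
        · exact absurd (hrr (fun h => h3 (hqx.trans h.symm)) hry).symm h2
      · by_cases hqy : q = y
        · by_cases hrx : r = x
          · subst hrx hqy
            exact hnotri s r _ hr (hσ.adj r) hq rfl
          · exact absurd (hrr hrx (fun h => h3 (hqy.trans h.symm))).symm h2
        · exact absurd (hqq hqx hqy).symm h1
    have hσD : ∀ p ∈ D, p ≠ x → p ≠ y → σ p ∈ S := by
      intro p hp hpx hpy
      rcases hout {p} (hDK p hp) p (by simp) (by simpa using hσne p) with h | h | h
      · exact h
      · exact absurd h hpx
      · exact absurd h hpy
    choose! φ hφ using hφ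
    have hne : Nonempty S := hSne.to_subtype
    -- Going from `s` to its new neighbour `φ s` and then along `σ` leads back to `S`. On the cycles
    -- of this map, `σ` can be rotated: `s` gets the old partner of `π s`. The result `ρ` agrees
    -- with `σ` at `u` but not at `s0`.
    obtain ⟨π, hπ, ⟨s0, hs0⟩⟩ := exists_perm_of_map fun s : S =>
      (⟨σ (φ s), hσD _ (hND s s.2 _ (hφ s s.2).1) (hφ s s.2).2.1 (hφ s s.2).2.2.1⟩ : S)
    have hσS : ∀ s ∈ S, σ s ∉ S := fun s hs => hDS _ (hND s hs _ (hσ.adj s))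
    let ρ : V → V := fun v => if h : v ∈ S then σ (π ⟨v, h⟩) else
      if h : σ v ∈ S then π.symm ⟨σ v, h⟩ else σ v
    have hadjS : ∀ s : S, G.Adj s (σ (π s)) := by
      intro s
      rcases hπ s with h | h
      · rw [h, hσ.invol]
        exact (hφ s s.2).1
      · rw [h]
        exact hσ.adj s
    have hPM : IsPM G ρ := by
      intro v
      by_cases hv : v ∈ S
      · have h1 := hσS _ (π ⟨v, hv⟩).2
        refine ⟨by simpa [ρ, hv] using hadjS ⟨v, hv⟩, ?_⟩
        simp [ρ, hv, h1, hσ.invol]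
      · by_cases hv' : σ v ∈ S
        · refine ⟨?_, by simp [ρ, hv, hv', hσ.invol]⟩
          have := hadjS (π.symm ⟨σ v, hv'⟩)
          simp only [Equiv.apply_symm_apply, hσ.invol] at this
          simpa [ρ, hv, hv'] using this.symm
        · simp [ρ, hv, hv', hσ.invol, hσ.adj]
    have huS : u ∉ S := fun h => hu (hUC (hSU h))
    have huS' : σ u ∉ S := fun h => hu (by
      have := hUC (hσU _ (hSU h))
      rwa [hσ.invol] at this)
    have := congrFun (huniq ρ hPM (by simp [ρ, huS, huS'])) s0
    simp only [ρ, s0.2, dif_pos, Subtype.coe_eta, hs0, hσ.invol] at this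
    exact (hφ s0 s0.2).2.2.2 this

end

end LonelyEdge
namespace LonelyEdge

/-! ### Contracting triangles -/

section
variable {V W : Type*} {G : SimpleGraph V} {H : SimpleGraph W}

/-- Injectivity maps the three neighbours of `a` onto three neighbours of its image, and there are
no others. So only one direction of adjacency ever has to be checked. -/
theorem IsCubic.nonempty_iso (hG : IsCubic G) (hH : IsCubic H) (f : V → W)
    (hf : Function.Bijective f) (hadj : ∀ a b, G.Adj a b → H.Adj (f a) (f b)) :
    ∃ φ : G ≃g H, ∀ a, φ a = f a := by
  refine ⟨{ toEquiv := Equiv.ofBijective f hf, map_rel_iff' := ?_ }, fun _ => rfl⟩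
  intro a b
  refine ⟨fun h => ?_, hadj a b⟩
  have hsub : f '' G.neighborSet a ⊆ H.neighborSet (f a) := by
    rintro _ ⟨c, hc, rfl⟩
    exact hadj a c hc
  have hfin : (H.neighborSet (f a)).Finite := Set.finite_of_ncard_ne_zero (by rw [hH]; simp)
  have := Set.eq_of_subset_of_ncard_le hsub
    (by rw [hH, Set.ncard_image_of_injective _ hf.1, hG]) hfin
  have hb : f b ∈ H.neighborSet (f a) := h
  rw [← this] at hb
  obtain ⟨c, hc, hcb⟩ := hb
  rwa [← hf.1 hcb]

end

section
variable {V : Type*} {G : SimpleGraph V}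

/-- A triangle `t` of `G` with its three outer neighbours `o`. -/
structure Triangle (G : SimpleGraph V) (t o : Fin 3 → V) : Prop where
  inj : Function.Injective t
  adj_iff : ∀ i b, G.Adj (t i) b ↔ (b ∈ Set.range t ∧ b ≠ t i) ∨ b = o i
  out : ∀ i, o i ∉ Set.range t

theorem fin3_cases {i k : Fin 3} (h : k ≠ i) : k = i + 1 ∨ k = i + 2 := by
  revert i k; decide

theorem fin3_third {i j : Fin 3} (h : i ≠ j) : ∃ k, k ≠ i ∧ k ≠ j ∧ ∀ l, l = i ∨ l = j ∨ l = k := by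
  revert i j; decide

theorem IsCubic.exists_triangle_outer (hG : IsCubic G) (t : Fin 3 → V)
    (ht : ∀ i j, i ≠ j → G.Adj (t i) (t j)) : ∃ o, Triangle G t o := by
  have hinj : Function.Injective t := by
    intro i j h
    by_contra hne
    exact G.irrefl (h ▸ ht i j hne)
  have hne : ∀ i j : Fin 3, i ≠ j → t i ≠ t j := fun i j h h' => h (hinj h')
  have : ∀ i : Fin 3, ∃ r, t (i + 1) ≠ r ∧ t (i + 2) ≠ r ∧
      ∀ a, G.Adj (t i) a ↔ a = t (i + 1) ∨ a = t (i + 2) ∨ a = r := fun i =>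
    hG.exists_nbr_of_adj (ht i (i + 1) (by revert i; decide)) (ht i (i + 2) (by revert i; decide))
      (hne _ _ (by revert i; decide))
  choose o h1 h2 h3 using this
  have hout : ∀ i, o i ∉ Set.range t := by
    rintro i ⟨k, hk⟩
    by_cases hki : k = i
    · subst hki
      have := (h3 k (o k)).2 (by tauto)
      rw [← hk] at this
      exact G.irrefl this
    · rcases fin3_cases hki with rfl | rfl
      · exact h1 i hk
      · exact h2 i hk
  refine ⟨o, hinj, fun i b => ?_, hout⟩
  rw [h3]
  constructor
  · rintro (rfl | rfl | rfl)
    · exact Or.inl ⟨⟨_, rfl⟩, hne _ _ (by revert i; decide)⟩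
    · exact Or.inl ⟨⟨_, rfl⟩, hne _ _ (by revert i; decide)⟩
    · exact Or.inr rfl
  · rintro (⟨⟨k, rfl⟩, hk⟩ | rfl)
    · rcases fin3_cases (i := i) (k := k) (fun h => hk (by rw [h])) with rfl | rfl <;> tauto
    · tauto

namespace Triangle
variable {t o : Fin 3 → V} (T : Triangle G t o)
include T

theorem adj_outer (i : Fin 3) : G.Adj (t i) (o i) := (T.adj_iff i _).2 (Or.inr rfl)

theorem eq_outer {i : Fin 3} {b : V} (h : G.Adj (t i) b) (hb : b ∉ Set.range t) : b = o i := by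
  rcases (T.adj_iff i b).1 h with h | h
  · exact absurd h.1 hb
  · exact h

/-- If `t i` and `t j` had a common outer neighbour, then that vertex and `t k` would separate `t i`
and `t j` from the rest. -/
theorem outer_injective [Finite V] (hconn : CutConn G) (hcard : 4 < Nat.card V) :
    Function.Injective o := by
  intro i j hij
  by_contra hne
  obtain ⟨k, hki, hkj, hk⟩ := fin3_third hne
  have hall := hconn {o i, t k} {t i, t j} (lt_of_le_of_lt (Set.ncard_insert_le _ _) (by simp))
    ⟨_, Or.inl rfl⟩ ?_ ?_
  · have : (Set.univ : Set V) ⊆ {t i, t j, o i, t k} := by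
      intro b _
      rcases hall b with h | h
      · rcases h with h | h
        · exact Or.inl h
        · exact Or.inr (Or.inl h)
      · exact Or.inr (Or.inr h)
    have h1 := Set.ncard_le_ncard this (Set.toFinite _)
    rw [Set.ncard_univ] at h1
    have h2 : ({t i, t j, o i, t k} : Set V).ncard ≤ 4 := by
      refine (Set.ncard_insert_le _ _).trans (Nat.succ_le_succ ?_)
      refine (Set.ncard_insert_le _ _).trans (Nat.succ_le_succ ?_)
      exact (Set.ncard_insert_le _ _).trans (Nat.succ_le_succ (by simp))
    omega
  · rw [Set.disjoint_left]
    have hoi := T.out i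
    rintro a (rfl | rfl) (h | h)
    · exact hoi ⟨i, h⟩
    · exact hki (T.inj h).symm
    · exact hoi ⟨j, h⟩
    · exact hkj (T.inj h).symm
  · have key : ∀ l b, o l = o i → G.Adj (t l) b → b ∈ ({t i, t j} : Set V) ∨ b ∈ ({o i, t k} : Set V) := by
      intro l b hl hb
      rcases (T.adj_iff l b).1 hb with ⟨⟨m, rfl⟩, -⟩ | rfl
      · rcases hk m with rfl | rfl | rfl <;> simp
      · simp [hl]
    rintro a (rfl | rfl) b hb
    · exact key i b rfl hb
    · exact key j b hij.symm hb

omit T in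
/-- The graph obtained by contracting the triangle `t` with outer neighbours `o`. -/
def contract (G : SimpleGraph V) (t o : Fin 3 → V) :
    SimpleGraph (Option {w : V // w ∉ Set.range t}) where
  Adj
    | none, none => False
    | none, some b => ∃ i, o i = b.1
    | some a, none => ∃ i, o i = a.1
    | some a, some b => G.Adj a.1 b.1
  symm := ⟨by
    rintro (_ | a) (_ | b) h
    · exact h
    · exact h
    · exact h
    · exact SimpleGraph.Adj.symm h⟩
  loopless := ⟨by
    rintro (_ | a) h
    · exact h
    · exact G.irrefl h⟩

omit T in
open Classical in
/-- The contraction map. -/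
noncomputable def contractMap (t : Fin 3 → V) (v : V) : Option {w : V // w ∉ Set.range t} :=
  if h : v ∈ Set.range t then none else some ⟨v, h⟩

omit T in
theorem contractMap_t (i : Fin 3) : contractMap t (t i) = none := by
  simp [contractMap]

omit T in
theorem contractMap_of_notMem {v : V} (h : v ∉ Set.range t) :
    contractMap t v = some ⟨v, h⟩ := dif_neg h

omit T in
theorem contractMap_eq_none {v : V} : contractMap t v = none ↔ v ∈ Set.range t := by
  by_cases h : v ∈ Set.range t
  · simp only [h, iff_true]
    exact dif_pos h
  · simp [contractMap_of_notMem h, h]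

omit T in
theorem contractMap_injOn {a b : V} (ha : a ∉ Set.range t) (h : contractMap t a = contractMap t b) :
    a = b := by
  have hb : b ∉ Set.range t := by
    rw [← contractMap_eq_none, ← h, contractMap_eq_none]
    exact ha
  rw [contractMap_of_notMem ha, contractMap_of_notMem hb] at h
  simpa using h

theorem contract_adj {a b : V} (h : G.Adj a b) (ha : a ∉ Set.range t) :
    (contract G t o).Adj (contractMap t a) (contractMap t b) := by
  rw [contractMap_of_notMem ha]
  by_cases hb : b ∈ Set.range t
  · obtain ⟨i, rfl⟩ := hb
    rw [contractMap_t]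
    exact ⟨i, (T.eq_outer h.symm ha).symm⟩
  · rw [contractMap_of_notMem hb]
    exact h

theorem contract_adj' {a b : V} (h : G.Adj a b) :
    contractMap t a = contractMap t b ∨
      (contract G t o).Adj (contractMap t a) (contractMap t b) := by
  by_cases ha : a ∈ Set.range t
  · by_cases hb : b ∈ Set.range t
    · left
      rw [contractMap_eq_none.2 ha, contractMap_eq_none.2 hb]
    · exact Or.inr (T.contract_adj h.symm hb).symm
  · exact Or.inr (T.contract_adj h ha)

theorem isCubic_contract (hG : IsCubic G) (ho : Function.Injective o) :
    IsCubic (contract G t o) := by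
  rintro (_ | ⟨a, ha⟩)
  · have hne : ∀ i j : Fin 3, i ≠ j → o i ≠ o j := fun i j h h' => h (ho h')
    refine ncard_neighborSet_of (p := some ⟨o 0, T.out 0⟩) (q := some ⟨o 1, T.out 1⟩)
      (r := some ⟨o 2, T.out 2⟩) (by simpa using hne 0 1 (by decide))
      (by simpa using hne 0 2 (by decide)) (by simpa using hne 1 2 (by decide)) ?_
    rintro (_ | ⟨b, hb⟩)
    · simp
    · simp only [contract, Option.some.injEq, Subtype.mk.injEq, Fin.exists_fin_succ, eq_comm (a := b)]
      simp
  · have hadj : ∀ b hb, (contract G t o).Adj (some ⟨a, ha⟩) (some ⟨b, hb⟩) ↔ G.Adj a b :=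
      fun _ _ => Iff.rfl
    by_cases h : ∃ i, o i = a
    · have hnone : (contract G t o).Adj (some ⟨a, ha⟩) none := h
      obtain ⟨i, rfl⟩ := h
      obtain ⟨q, r, h1, h2, h3, h4⟩ := hG.exists_nbrs_of_adj (T.adj_outer i).symm
      have hout : ∀ q, t i ≠ q → G.Adj (o i) q → q ∉ Set.range t := by
        rintro q hq hadj ⟨j, rfl⟩
        exact hq (by rw [ho (T.eq_outer hadj.symm (T.out i))])
      have hq := hout q h1 ((h4 q).2 (by tauto))
      have hr := hout r h2 ((h4 r).2 (by tauto))
      refine ncard_neighborSet_of (p := none) (q := some ⟨q, hq⟩) (r := some ⟨r, hr⟩) (by simp)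
        (by simp) (by simpa using h3) ?_
      rintro (_ | ⟨b, hb⟩)
      · simpa using hnone
      · have : b ≠ t i := fun e => hb ⟨i, e.symm⟩
        rw [hadj, h4]
        simp [this]
    · have hnone : ¬ (contract G t o).Adj (some ⟨a, ha⟩) none := h
      obtain ⟨p, q, r, h1, h2, h3, h4⟩ := hG.exists_nbrs a
      have hout : ∀ q, G.Adj a q → q ∉ Set.range t := by
        rintro q hq ⟨j, rfl⟩
        exact h ⟨j, (T.eq_outer hq.symm ha).symm⟩
      refine ncard_neighborSet_of (p := some ⟨p, hout p ((h4 p).2 (by tauto))⟩)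
        (q := some ⟨q, hout q ((h4 q).2 (by tauto))⟩) (r := some ⟨r, hout r ((h4 r).2 (by tauto))⟩)
        (by simpa using h1) (by simpa using h2) (by simpa using h3) ?_
      rintro (_ | ⟨b, hb⟩)
      · simpa using hnone
      · rw [hadj, h4]
        simp

theorem nonempty_iso_expand_contract (hG : IsCubic G) (ho : Function.Injective o) :
    ∃ φ : G ≃g expand (contract G t o) none, ∀ i, ∃ x, φ (t i) = Sum.inr x := by
  classical
  have hadjo : ∀ i, (contract G t o).Adj none (some ⟨o i, T.out i⟩) := fun i => ⟨i, rfl⟩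
  let f : V → ExpandVert (contract G t o) none := fun v =>
    if h : ∃ i, t i = v then Sum.inr ⟨some ⟨o h.choose, T.out _⟩, hadjo _⟩
    else Sum.inl ⟨some ⟨v, h⟩, by simp⟩
  have hft : ∀ i, f (t i) = Sum.inr ⟨some ⟨o i, T.out i⟩, hadjo i⟩ := by
    intro i
    have h : ∃ j, t j = t i := ⟨i, rfl⟩
    simp only [f, h, dif_pos]
    congr
    exact T.inj h.choose_spec
  have hfn : ∀ v (h : v ∉ Set.range t), f v = Sum.inl ⟨some ⟨v, h⟩, by simp⟩ := by
    intro v h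
    exact dif_neg h
  have hbij : Function.Bijective f := by
    constructor
    · intro a b hab
      by_cases ha : a ∈ Set.range t <;> by_cases hb : b ∈ Set.range t
      · obtain ⟨i, rfl⟩ := ha
        obtain ⟨j, rfl⟩ := hb
        rw [hft, hft] at hab
        have := congrArg Subtype.val (Sum.inr.inj hab)
        simp only [Option.some.injEq, Subtype.mk.injEq] at this
        rw [ho this]
      · obtain ⟨i, rfl⟩ := ha
        rw [hft, hfn b hb] at hab
        simp at hab
      · obtain ⟨i, rfl⟩ := hb
        rw [hft, hfn a ha] at hab
        simp at hab
      · rw [hfn a ha, hfn b hb] at hab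
        simpa using hab
    · rintro (⟨_ | ⟨a, ha⟩, h⟩ | ⟨_ | ⟨b, hb⟩, h⟩)
      · exact absurd rfl h
      · exact ⟨a, hfn a ha⟩
      · exact absurd h (by simp)
      · obtain ⟨i, rfl⟩ : ∃ i, o i = b := h
        exact ⟨t i, hft i⟩
  obtain ⟨φ, hφ⟩ := hG.nonempty_iso ((T.isCubic_contract hG ho).expand none) f hbij (by
    intro a b hab
    have key : ∀ i b, b ∉ Set.range t → G.Adj (t i) b →
        (expand (contract G t o) none).Adj (f (t i)) (f b) := by
      intro i b hb hab
      rw [hft, hfn b hb, expand_adj_inr_inl]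
      simp [T.eq_outer hab hb]
    by_cases ha : a ∈ Set.range t <;> by_cases hb : b ∈ Set.range t
    · obtain ⟨i, rfl⟩ := ha
      obtain ⟨j, rfl⟩ := hb
      rw [hft, hft, expand_adj_inr_inr]
      intro h
      have := congrArg Subtype.val h
      simp only [Option.some.injEq, Subtype.mk.injEq] at this
      exact G.irrefl (ho this ▸ hab)
    · obtain ⟨i, rfl⟩ := ha
      exact key i b hb hab
    · obtain ⟨i, rfl⟩ := hb
      exact (key i a ha hab.symm).symm
    · rw [hfn a ha, hfn b hb]
      exact hab)
  exact ⟨φ, fun i => ⟨_, (hφ _).trans (hft i)⟩⟩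

/-- If the contracted vertex is not deleted, a separation pulls back along the contraction. If it is
deleted, each side of the separation must contain at least two of the three outer neighbours, which
is impossible for two sides. -/
theorem cutConn_contract [Finite V] (hconn : CutConn G) : CutConn (contract G t o) := by
  intro S A hS hA hd hcl b
  have hdis : ∀ w, w ∈ A → w ∉ S := fun w h1 h2 => Set.disjoint_left.1 hd h1 h2
  have hsurj : ∀ b ≠ (none : Option {w : V // w ∉ Set.range t}),
      ∃ a, a ∉ Set.range t ∧ contractMap t a = b := by
    rintro (_ | ⟨b, hb⟩) h
    · exact absurd rfl h
    · exact ⟨b, hb, contractMap_of_notMem hb⟩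
  by_cases hn : none ∈ S
  · by_contra hbA
    -- If `X` could be reached from the triangle through `t i0` only, then deleting `t i0` instead
    -- of the contracted vertex would cut off `X` from the rest of the triangle.
    have key : ∀ X : Set (Option {w : V // w ∉ Set.range t}), X.Nonempty → Disjoint X S →
        (∀ a ∈ X, ∀ b, (contract G t o).Adj a b → b ∈ X ∨ b ∈ S) →
        ∀ i0, ∃ i, i ≠ i0 ∧ some ⟨o i, T.out i⟩ ∈ X := by
      intro X ⟨c, hc⟩ hXd hXcl i0
      by_contra hcon
      push Not at hcon
      have hnX : none ∉ X := fun h => Set.disjoint_left.1 hXd h hn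
      obtain ⟨c', hc', hcc⟩ := hsurj c (fun h => hnX (h ▸ hc))
      have hcard : (insert (t i0) (contractMap t ⁻¹' (S \ {none}))).ncard < 3 := by
        refine lt_of_le_of_lt (Set.ncard_insert_le _ _) ?_
        have h1 : (contractMap t ⁻¹' (S \ {none})).ncard ≤ (S \ {none}).ncard := by
          refine Set.ncard_le_ncard_of_injOn (contractMap t) (fun a ha => ha) ?_
          intro a ha b _ h
          exact contractMap_injOn (fun h' => ha.2 (contractMap_eq_none.2 h')) h
        have h2 := Set.ncard_sdiff_singleton_add_one hn
        omega
      have hall := hconn _ (contractMap t ⁻¹' X) hcard ⟨c', by simpa [hcc] using hc⟩ ?_ ?_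
        (t (i0 + 1))
      · rcases hall with h | h | h
        · rw [Set.mem_preimage, contractMap_t] at h
          exact hnX h
        · have h01 : ∀ i : Fin 3, i + 1 ≠ i := by decide
          exact h01 _ (T.inj h)
        · exact h.2 (contractMap_t _)
      · rw [Set.disjoint_left]
        rintro a ha (rfl | h)
        · rw [Set.mem_preimage, contractMap_t] at ha
          exact hnX ha
        · exact Set.disjoint_left.1 hXd ha h.1
      · intro a ha b hab
        have har : a ∉ Set.range t := fun h => hnX (contractMap_eq_none.2 h ▸ ha)
        by_cases hb : b ∈ Set.range t
        · obtain ⟨i, rfl⟩ := hb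
          right
          left
          by_contra hne
          refine hcon i (fun h => hne (by rw [h])) ?_
          have := T.eq_outer hab.symm har
          subst this
          rw [← contractMap_of_notMem har]
          exact ha
        · rcases hXcl _ ha _ (T.contract_adj hab har) with h | h
          · exact Or.inl h
          · exact Or.inr (Or.inr ⟨h, fun h' => hb (contractMap_eq_none.1 h')⟩)
    have hA' := key A hA hd hcl
    have hB' := key (A ∪ S)ᶜ ⟨b, fun h => hbA h⟩
      (Set.disjoint_left.2 fun a ha h => ha (Or.inr h)) (by
        intro a ha c hac
        by_contra hcon
        push Not at hcon
        have hc : c ∈ A := by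
          by_contra hcA
          exact hcon.1 (by
            rintro (h | h)
            · exact hcA h
            · exact hcon.2 h)
        exact ha (hcl c hc a hac.symm))
    obtain ⟨i, -, hi⟩ := hA' 0
    obtain ⟨j, hj, hjA⟩ := hA' i
    obtain ⟨k, hki, hkj, hk⟩ := fin3_third hj
    obtain ⟨l, hl, hlB⟩ := hB' k
    rcases hk l with rfl | rfl | rfl
    · exact hlB (Or.inl hjA)
    · exact hlB (Or.inl hi)
    · exact hl rfl
  · have hcard : (contractMap t ⁻¹' S).ncard < 3 := by
      refine lt_of_le_of_lt (Set.ncard_le_ncard_of_injOn (contractMap t) (fun a ha => ha) ?_) hS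
      intro a ha b _ h
      exact contractMap_injOn (fun h' => hn (contractMap_eq_none.2 h' ▸ ha)) h
    have hsurj' : Function.Surjective (contractMap t) := by
      rintro (_ | b)
      · exact ⟨t 0, contractMap_t 0⟩
      · obtain ⟨a, -, h⟩ := hsurj (some b) (by simp)
        exact ⟨a, h⟩
    obtain ⟨c, hc⟩ := hA
    obtain ⟨c', rfl⟩ := hsurj' c
    obtain ⟨b', rfl⟩ := hsurj' b
    refine hconn _ (contractMap t ⁻¹' A) hcard ⟨c', hc⟩ (hd.preimage _) ?_ b'
    intro a ha b hab
    rcases T.contract_adj' hab with h | h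
    · left
      rw [Set.mem_preimage, ← h]
      exact ha
    · exact hcl _ ha _ h

end Triangle

theorem nonempty_iso_top_of_card [Finite V] (hG : IsCubic G) (hcard : Nat.card V = 4) :
    Nonempty (G ≃g (⊤ : SimpleGraph (Fin 4))) := by
  let e : V ≃ Fin 4 := Finite.equivFinOfCardEq hcard
  refine ⟨⟨e, ?_⟩⟩
  intro a b
  rw [SimpleGraph.top_adj, e.injective.ne_iff]
  refine ⟨fun hab => ?_, G.ne_of_adj⟩
  have hsub : G.neighborSet a ⊆ {a}ᶜ := fun c hc => (G.ne_of_adj hc).symm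
  have := Set.eq_of_subset_of_ncard_le hsub (by
    rw [hG, Set.ncard_compl, Set.ncard_singleton, hcard])
  have hb : b ∈ ({a}ᶜ : Set V) := fun h => hab h.symm
  rw [← this] at hb
  exact hb

end

/-! ### Graphs with a lonely edge are Klee graphs -/

theorem exists_lonely_of_expand {V : Type*} {H : SimpleGraph V} {v : V} (hH : IsCubic H)
    {ρ : ExpandVert H v → ExpandVert H v} (hρ : IsPM (expand H v) ρ) {u : ExpandVert H v}
    (hu : ∀ τ, IsPM (expand H v) τ → τ u = ρ u → τ = ρ) {x y : H.neighborSet v}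
    (hxy : ρ (Sum.inr x) = Sum.inr y) :
    ∃ σ u, IsPM H σ ∧ ∀ τ, IsPM H τ → τ u = σ u → τ = σ := by
  -- A matching with an edge in the triangle is a lift, and agreement of matchings at the vertex
  -- from which `u` arises gives agreement of the lifts at `u`.
  rcases hρ.eq_lift_or hH with ⟨σ, hσ, rfl⟩ | ⟨σ, -, -, h⟩
  · rcases u with a | z
    · refine ⟨σ, a.1, hσ, fun τ hτ h => lift_injective hτ hσ (hu _ (hτ.lift hH) ?_)⟩
      by_cases hv : σ a.1 = v
      · simp only [lift, hv, h.trans hv, dif_pos]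
      · simp only [lift, hv, dif_neg, not_false_eq_true, h]
    · refine ⟨σ, v, hσ, fun τ hτ h => lift_injective hτ hσ (hu _ (hτ.lift hH) ?_)⟩
      by_cases hz : z.1 = σ v
      · simp only [lift, if_pos hz, if_pos (hz.trans h.symm)]
      · have hz' : ¬ z.1 = τ v := h ▸ hz
        simp only [lift, if_neg hz, if_neg hz', h]
  · rw [h] at hxy
    simp at hxy

/-- A cubic 3-connected graph with a lonely edge is a Klee graph. -/
theorem klee_of_lonely : ∀ (n : ℕ) {V : Type} [Finite V] (G : SimpleGraph V), Nat.card V = n →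
    3 < Nat.card V → IsCubic G → CutConn G →
    (∃ σ u, IsPM G σ ∧ ∀ τ, IsPM G τ → τ u = σ u → τ = σ) → Klee G := by
  classical
  intro n
  induction n using Nat.strong_induction_on with
  | _ n ih =>
  intro V _ G hn hcard hG hconn ⟨σ, u, hσ, hu⟩
  by_cases h4 : Nat.card V = 4
  · obtain ⟨e⟩ := nonempty_iso_top_of_card hG h4
    exact .base e
  have := Fintype.ofFinite V
  have hbd : boundary G (Finset.univ.erase u) = 3 := by
    have : ∀ p ∈ Finset.univ.erase u, (G.neighborFinset p \ Finset.univ.erase u).card =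
        if p ∈ G.neighborFinset u then 1 else 0 := by
      intro p _
      have : G.neighborFinset p \ Finset.univ.erase u = if p ∈ G.neighborFinset u then {u} else ∅ := by
        ext q
        split_ifs with h
        · simp only [Finset.mem_sdiff, SimpleGraph.mem_neighborFinset, Finset.mem_erase,
            Finset.mem_univ, and_true, not_not, Finset.mem_singleton]
          refine ⟨And.right, fun e => ⟨?_, e⟩⟩
          subst e
          simpa [G.adj_comm] using h
        · simp only [Finset.mem_sdiff, SimpleGraph.mem_neighborFinset, Finset.mem_erase,
            Finset.mem_univ, and_true, not_not, Finset.notMem_empty, iff_false]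
          rintro ⟨h1, rfl⟩
          exact h (by simpa using h1.symm)
      rw [this]
      split_ifs <;> simp
    rw [boundary, Finset.sum_congr rfl this, Finset.sum_boole, Finset.filter_mem_eq_inter,
      Finset.inter_eq_right.2, hG.card_neighborFinset]
    · rfl
    · intro p hp
      refine Finset.mem_erase.2 ⟨fun e => ?_, Finset.mem_univ _⟩
      subst e
      simp at hp
  -- The set is everything but `u`: it is left by the three edges at `u`, of which the matching
  -- contains only the one to `σ u`.
  obtain ⟨x, y, z, hxy, hyz, hxz, hσyz⟩ := exists_triangle hG hconn hσ hu _
    (Finset.univ.erase u) (σ u) rfl (by simp) (by simpa using (hσ.adj u).ne')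
    (by simp [hσ.invol]) (by
      intro c _ hc
      refine Finset.mem_erase.2 ⟨fun h => hc ?_, Finset.mem_univ _⟩
      rw [← h, hσ.invol]) hbd (by
      rw [Finset.card_erase_of_mem (Finset.mem_univ _), Finset.card_univ, ← Nat.card_eq_fintype_card]
      omega)
  obtain ⟨o, T⟩ := hG.exists_triangle_outer ![x, y, z] (by
    have h1 := hxy.symm
    have h2 := hyz.symm
    have h3 := hxz.symm
    intro i j hij
    fin_cases i <;> fin_cases j <;> first | exact absurd rfl hij | assumption)
  have ho := T.outer_injective hconn (by omega)
  obtain ⟨φ, hφ⟩ := T.nonempty_iso_expand_contract hG ho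
  have hK := T.isCubic_contract hG ho
  obtain ⟨p, hp⟩ := hφ 1
  obtain ⟨q, hq⟩ := hφ 2
  -- The triangle edge `yz` lies in `σ`, so `σ` descends to the contraction and is still determined
  -- there by a single edge.
  obtain ⟨σ', u', h1, h2⟩ := exists_lonely_of_expand hK (hσ.map φ) (u := φ u) (by
    intro τ hτ h
    have := hu _ (hτ.map φ.symm) (by
      simp only [RelIso.symm_symm, h, RelIso.symm_apply_apply])
    funext b
    rw [← this]
    simp) (x := p) (y := q) (by
      have : φ.symm (Sum.inr p) = y := φ.symm_apply_eq.2 hp.symm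
      rw [this, hσyz]
      exact hq)
  have hlt : Nat.card (Option {w : V // w ∉ Set.range ![x, y, z]}) < n := by
    rw [Finite.card_option, ← hn]
    have : Nat.card {w : V // w ∉ Set.range ![x, y, z]} + 3 = Nat.card V := by
      have h1 : (Set.range ![x, y, z]).ncard = 3 := by
        rw [← Set.image_univ, Set.ncard_image_of_injective _ T.inj, Set.ncard_univ]
        simp
      have h2 := Set.ncard_add_ncard_compl (Set.range ![x, y, z])
      rw [h1, ← Nat.card_coe_set_eq (Set.range ![x, y, z])ᶜ] at h2
      rw [← h2, add_comm]
      rfl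
    omega
  have hcut := T.cutConn_contract hconn
  refine .step none (ih _ hlt (Triangle.contract G ![x, y, z] o) rfl ?_ hK hcut
    ⟨σ', u', h1, h2⟩) φ
  have h3 := hK none
  have h4 := Set.ncard_le_card ((Triangle.contract G ![x, y, z] o).neighborSet none)
  have h5 : ((Triangle.contract G ![x, y, z] o).neighborSet none) ≠ Set.univ := by
    intro h
    have : none ∈ (Triangle.contract G ![x, y, z] o).neighborSet none := h ▸ Set.mem_univ _
    exact SimpleGraph.irrefl _ ((SimpleGraph.mem_neighborSet _ _ _).1 this)
  have h6 := Set.ncard_lt_card h5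
  omega

theorem klee_of_inU3 {V : Type} [Finite V] {G : SimpleGraph V} (h : InU3 G) : Klee G := by
  obtain ⟨h1, h2, h3⟩ := h
  rw [isThreeConnected_iff] at h2
  refine klee_of_lonely _ G rfl h2.1 h1 h2.2 ?_
  have hne : {e : Sym2 V | IsLonely G e}.Nonempty := by
    rw [Set.nonempty_iff_ne_empty]
    intro h
    rw [numLonely, h] at h3
    simp at h3
  obtain ⟨e, he⟩ := hne
  obtain ⟨σ, ⟨hσ, a, rfl⟩, hu⟩ := isLonely_iff.1 he
  exact ⟨σ, a, hσ, hσ.isLonely_iff.1 he⟩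

end LonelyEdge
namespace LonelyEdge

/-! ### Expansions at different vertices commute -/

section
variable {V : Type*} (G : SimpleGraph V)

open Classical in
/-- The natural map from `(G^v)^u` to `(G^u)^v`. -/
noncomputable def commFun {u v : V} (h : u ≠ v) :
    ExpandVert (expand G v) (Sum.inl ⟨u, h⟩) → ExpandVert (expand G u) (Sum.inl ⟨v, h.symm⟩)
  | Sum.inl ⟨Sum.inl w, hw⟩ => Sum.inl ⟨Sum.inl ⟨w.1, fun e => hw (by congr; exact Subtype.ext e)⟩,
      fun e => w.2 (by simpa using e)⟩
  | Sum.inl ⟨Sum.inr x, _⟩ =>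
      if hx : x.1 = u then Sum.inr ⟨Sum.inr ⟨v, hx ▸ x.2.symm⟩, rfl⟩
      else Sum.inr ⟨Sum.inl ⟨x.1, hx⟩, x.2⟩
  | Sum.inr ⟨Sum.inl w, hw⟩ => Sum.inl ⟨Sum.inr ⟨w.1, hw⟩, by simp⟩
  | Sum.inr ⟨Sum.inr x, hx⟩ => Sum.inl ⟨Sum.inr ⟨v, by
      have h1 : u = x.1 := hx
      exact h1 ▸ x.2.symm⟩, by simp⟩

theorem commFun_commFun {u v : V} (h : u ≠ v) (a) : commFun G h.symm (commFun G h a) = a := by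
  rcases a with ⟨w | x, hw⟩ | ⟨w | x, hw⟩
  · rfl
  · by_cases hx : x.1 = u
    · simp [commFun, hx, Subtype.ext_iff]
    · simp [commFun, hx]
  · have : w.1 ≠ v := w.2
    simp [commFun, this]
  · have h1 : u = x.1 := hw
    simp [commFun, h1]

theorem commFun_adj {u v : V} (h : u ≠ v) {a b}
    (hab : (expand (expand G v) (Sum.inl ⟨u, h⟩)).Adj a b) :
    (expand (expand G u) (Sum.inl ⟨v, h.symm⟩)).Adj (commFun G h a) (commFun G h b) := by
  rcases a with ⟨w | x, hw⟩ | ⟨w | x, hw⟩ <;> rcases b with ⟨w' | x', hw'⟩ | ⟨w' | x', hw'⟩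
  · exact hab
  · have h1 : w.1 = x'.1 := hab
    have h2 : x'.1 ≠ u := fun e => hw (by congr; exact Subtype.ext (h1.trans e))
    simp only [commFun, h2, dite_false]
    simpa using h1
  · have h1 : w = w' := by simpa using hab
    subst h1
    simp [commFun]
  · simp at hab
  · have h1 : w'.1 = x.1 := hab
    have h2 : x.1 ≠ u := fun e => hw' (by congr; exact Subtype.ext (h1.trans e))
    simp only [commFun, h2, dite_false]
    simpa using h1
  · have h1 : x ≠ x' := hab
    have h2 : x.1 ≠ x'.1 := fun e => h1 (Subtype.ext e)
    by_cases hx : x.1 = u <;> by_cases hx' : x'.1 = u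
    · exact absurd (hx.trans hx'.symm) h2
    · simp only [commFun, hx, hx', dite_true, dite_false, expand_adj_inr_inr]
      exact fun e => by simpa using congrArg Subtype.val e
    · simp only [commFun, hx, hx', dite_true, dite_false, expand_adj_inr_inr]
      exact fun e => by simpa using congrArg Subtype.val e
    · simp only [commFun, hx, hx', dite_false, expand_adj_inr_inr]
      exact fun e => h2 (by simpa [Subtype.ext_iff] using congrArg Subtype.val e)
  · simp at hab
  · have h1 : x = x' := by simpa using hab
    subst h1
    have h2 : u = x.1 := hw'
    simp [commFun, h2.symm]
  · have h1 : w' = w := by simpa using hab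
    subst h1
    simp [commFun]
  · simp at hab
  · have h1 : w.1 ≠ w'.1 := fun e => hab (by congr; exact Subtype.ext e)
    simpa [commFun, Subtype.ext_iff] using h1
  · simpa [commFun, Subtype.ext_iff] using w.2
  · simp at hab
  · have h1 : x' = x := by simpa using hab
    subst h1
    have h2 : u = x'.1 := hw
    simp [commFun, h2.symm]
  · simpa [commFun, Subtype.ext_iff] using w'.2.symm
  · exfalso
    have h1 : u = x.1 := hw
    have h2 : u = x'.1 := hw'
    exact hab (by congr; exact Subtype.ext (h1.symm.trans h2))

/-- The three clauses locate the vertices after the exchange: the triangle built first becomes the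
one built last, the converse holds too, and all untouched vertices stay. -/
theorem exists_expand_comm {u v : V} (h : u ≠ v) :
    ∃ ψ : expand (expand G v) (Sum.inl ⟨u, h⟩) ≃g expand (expand G u) (Sum.inl ⟨v, h.symm⟩),
      (∀ x, ∃ y, ψ (Sum.inl ⟨Sum.inr x, by simp⟩) = Sum.inr y) ∧
      (∀ y, ∃ x, ψ (Sum.inr y) = Sum.inl ⟨Sum.inr x, by simp⟩) ∧
      ∀ (w : V) (h1 : w ≠ v) (h2 : w ≠ u), ψ (Sum.inl ⟨Sum.inl ⟨w, h1⟩, by simpa using h2⟩) =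
        Sum.inl ⟨Sum.inl ⟨w, h2⟩, by simpa using h1⟩ := by
  refine ⟨⟨⟨commFun G h, commFun G h.symm, commFun_commFun G h, commFun_commFun G h.symm⟩, ?_⟩,
    ?_, ?_, ?_⟩
  · intro a b
    refine ⟨fun hab => ?_, commFun_adj G h⟩
    have := commFun_adj G h.symm hab
    simpa only [Equiv.coe_fn_mk, commFun_commFun] using this
  · intro x
    by_cases hx : x.1 = u
    · exact ⟨_, dif_pos hx⟩
    · exact ⟨_, dif_neg hx⟩
  · rintro ⟨w | x, hw⟩
    · exact ⟨_, rfl⟩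
    · exact ⟨_, rfl⟩
  · intro w h1 h2
    rfl

/-- The prism has an automorphism that exchanges its two triangles. -/
def prismSwap {W : Type*} (p : W) : expand (⊤ : SimpleGraph W) p ≃g expand (⊤ : SimpleGraph W) p where
  toFun
    | Sum.inl w => Sum.inr ⟨w.1, w.2.symm⟩
    | Sum.inr w => Sum.inl ⟨w.1, nbr_ne w⟩
  invFun
    | Sum.inl w => Sum.inr ⟨w.1, w.2.symm⟩
    | Sum.inr w => Sum.inl ⟨w.1, nbr_ne w⟩
  left_inv := by rintro (a | a) <;> rfl
  right_inv := by rintro (a | a) <;> rfl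
  map_rel_iff' := by
    rintro (a | a) (b | b)
    · simp [Subtype.ext_iff]
    · simp [eq_comm]
    · simp [eq_comm]
    · simp [Subtype.ext_iff]

end

/-- A Klee graph other than `K₄` arises by an expansion that leaves a given vertex untouched. -/
theorem Klee.exists_expand_avoiding {V : Type} {K : SimpleGraph V} (h : Klee K) :
    ∀ z : V, Nonempty (K ≃g (⊤ : SimpleGraph (Fin 4))) ∨
      ∃ (W : Type) (H : SimpleGraph W) (u a : W) (hau : a ≠ u) (e : K ≃g LonelyEdge.expand H u),
        Klee H ∧ e z = Sum.inl ⟨a, hau⟩ := by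
  induction h with
  | base e => exact fun z => Or.inl ⟨e⟩
  | @step V W H K v hH e ih =>
    intro z
    right
    rcases hz : e z with a | x
    · exact ⟨V, H, v, a.1, a.2, e, hH, hz⟩
    -- When `z` lies in the newest triangle, choose the last expansion of `H` to avoid `v` and
    -- exchange it with the one at `v`; then `z` is old. If `H` is `K₄`, the prism's two triangles
    -- are exchanged instead.
    · rcases ih v with ⟨⟨φ⟩⟩ | ⟨W2, H2, u2, a, hau, e2, hH2, hv⟩
      · refine ⟨Fin 4, ⊤, φ v, φ x.1, fun h => nbr_ne x (φ.injective h),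
          (e.trans (expandIso φ v)).trans (prismSwap _), .base SimpleGraph.Iso.refl, ?_⟩
        simp only [RelIso.trans_apply, hz, expandIso_inr]
        rfl
      · obtain ⟨ψ, -, h2, -⟩ := exists_expand_comm H2 hau
        obtain ⟨θ, hθ⟩ : ∃ θ : K ≃g LonelyEdge.expand (LonelyEdge.expand H2 u2) (Sum.inl ⟨a, hau⟩),
            ∃ y, θ z = Sum.inr y := by
          rw [← hv]
          exact ⟨e.trans (expandIso e2 v), _, by rw [RelIso.trans_apply, hz, expandIso_inr]⟩
        obtain ⟨y, hy⟩ := hθ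
        obtain ⟨x', hx'⟩ := h2 y
        refine ⟨_, LonelyEdge.expand H2 a, Sum.inl ⟨u2, hau.symm⟩, Sum.inr x', by simp,
          θ.trans ψ, hH2.expand a, ?_⟩
        rw [RelIso.trans_apply, hy, hx']

end LonelyEdge
namespace LonelyEdge

/-! ### Expanding at a non-trivial vertex of an extended prism yields the tricorn family -/

/-- `G` is the tricorn or one of its descendants. -/
def IsTricornFamily {V : Type} (G : SimpleGraph V) : Prop :=
  Nonempty (G ≃g tricorn) ∨
    ∃ (W : Type) (H : SimpleGraph W), IsDescendant tricorn H ∧ Nonempty (G ≃g H)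

theorem IsTricornFamily.congr {V W : Type} {G : SimpleGraph V} {H : SimpleGraph W}
    (h : IsTricornFamily H) (e : G ≃g H) : IsTricornFamily G := by
  rcases h with ⟨⟨f⟩⟩ | ⟨U, K, hK, ⟨f⟩⟩
  · exact Or.inl ⟨e.trans f⟩
  · exact Or.inr ⟨U, K, hK, ⟨e.trans f⟩⟩

theorem IsTricornFamily.expand {V : Type} {G : SimpleGraph V} (h : IsTricornFamily G) (v : V) :
    IsTricornFamily (expand G v) := by
  rcases h with ⟨⟨f⟩⟩ | ⟨U, K, hK, ⟨f⟩⟩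
  · exact Or.inr ⟨_, _, .child (f v), ⟨expandIso f v⟩⟩
  · exact Or.inr ⟨_, _, .step (f v) hK, ⟨expandIso f v⟩⟩

/-- The vertex type of an expansion depends on the expanded vertex. Keeping the image vertex as a
variable with an equation avoids transport along that equation. -/
theorem exists_expandIso {V W : Type*} {G : SimpleGraph V} {H : SimpleGraph W} (φ : G ≃g H)
    {u : V} {u' : W} (h : φ u = u') : ∃ F : expand G u ≃g expand H u',
      (∀ a, ∃ hb, F (Sum.inl a) = Sum.inl ⟨φ a.1, hb⟩) ∧
      ∀ x, ∃ hb, F (Sum.inr x) = Sum.inr ⟨φ x.1, hb⟩ := by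
  subst h
  exact ⟨expandIso φ u, fun a => ⟨_, expandIso_inl ..⟩, fun x => ⟨_, expandIso_inr ..⟩⟩

theorem exists_perm_fin4 (z x y : Fin 4) (h1 : x ≠ z) (h2 : y ≠ z) (h3 : x ≠ y) :
    ∃ π : Equiv.Perm (Fin 4), π z = 3 ∧ π x = 0 ∧ π y = 1 := by
  revert z x y
  decide

/-- The bijection between the tricorn and an iterated expansion of `K₄`. -/
def tricornMap : Fin 10 → ExpandVert (expand (expand (⊤ : SimpleGraph (Fin 4)) 3)
    (Sum.inr ⟨0, by simp⟩)) (Sum.inl ⟨Sum.inr ⟨1, by simp⟩, by simp⟩) :=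
  ![Sum.inl ⟨Sum.inl ⟨Sum.inr ⟨2, by simp⟩, by simp⟩, by simp⟩,
    Sum.inl ⟨Sum.inr ⟨Sum.inr ⟨2, by simp⟩, by simp⟩, by simp⟩,
    Sum.inr ⟨Sum.inl ⟨Sum.inr ⟨2, by simp⟩, by simp⟩, by simp⟩,
    Sum.inl ⟨Sum.inl ⟨Sum.inl ⟨2, by simp⟩, by simp⟩, by simp⟩,
    Sum.inl ⟨Sum.inr ⟨Sum.inl ⟨0, by simp⟩, by simp⟩, by simp⟩,
    Sum.inl ⟨Sum.inr ⟨Sum.inr ⟨1, by simp⟩, by simp⟩, by simp⟩,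
    Sum.inr ⟨Sum.inr ⟨Sum.inr ⟨1, by simp⟩, by simp⟩, by simp⟩,
    Sum.inr ⟨Sum.inl ⟨Sum.inl ⟨1, by simp⟩, by simp⟩, by simp⟩,
    Sum.inl ⟨Sum.inl ⟨Sum.inl ⟨1, by simp⟩, by simp⟩, by simp⟩,
    Sum.inl ⟨Sum.inl ⟨Sum.inl ⟨0, by simp⟩, by simp⟩, by simp⟩]

theorem tricorn_adj (a b : Fin 10) : tricorn.Adj a b ↔
    b ∈ (![[1, 2, 3], [0, 4, 5], [0, 6, 7], [0, 8, 9], [1, 5, 9], [1, 4, 6], [2, 5, 7], [2, 6, 8],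
      [3, 7, 9], [3, 8, 4]] : Fin 10 → List (Fin 10)) a := by
  have h : tricorn.Adj a b ↔ s(a, b) ∈ ([s(0, 1), s(0, 2), s(0, 3), s(1, 4), s(1, 5), s(2, 6),
      s(2, 7), s(3, 8), s(3, 9), s(4, 5), s(5, 6), s(6, 7), s(7, 8), s(8, 9), s(9, 4)] :
      List (Sym2 (Fin 10))) ∧ a ≠ b := by
    simp only [tricorn, SimpleGraph.fromEdgeSet_adj, Set.mem_insert_iff, Set.mem_singleton_iff,
      List.mem_cons, List.not_mem_nil, or_false]
  rw [h]
  clear h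
  revert a b
  decide

theorem isCubic_of_adj_mem {n : ℕ} {G : SimpleGraph (Fin n)} (l : Fin n → List (Fin n))
    (h : ∀ a b, G.Adj a b ↔ b ∈ l a) (h2 : ∀ a, (l a).Nodup ∧ (l a).length = 3) : IsCubic G := by
  intro a
  have : G.neighborSet a = ((l a).toFinset : Set (Fin n)) := by
    ext b
    simp [h]
  rw [this, Set.ncard_coe_finset, List.toFinset_card_of_nodup (h2 a).1, (h2 a).2]

theorem isCubic_tricorn : IsCubic tricorn :=
  isCubic_of_adj_mem _ tricorn_adj (by decide)

theorem isCubic_top : IsCubic (⊤ : SimpleGraph (Fin 4)) :=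
  (Klee.base SimpleGraph.Iso.refl).isCubic

/-- The tricorn is the prism with two vertices of the same triangle expanded. -/
theorem nonempty_tricorn_iso : Nonempty (tricorn ≃g expand (expand (expand (⊤ : SimpleGraph (Fin 4)) 3)
    (Sum.inr ⟨0, by simp⟩)) (Sum.inl ⟨Sum.inr ⟨1, by simp⟩, by simp⟩)) := by
  have hcub := ((isCubic_top.expand 3).expand (Sum.inr ⟨0, by simp⟩)).expand
    (Sum.inl ⟨Sum.inr ⟨1, by simp⟩, by simp⟩)
  have hinj : Function.Injective tricornMap := by
    intro a b
    fin_cases a <;> fin_cases b <;> simp [tricornMap]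
  have hK : Klee (⊤ : SimpleGraph (Fin 4)) := .base SimpleGraph.Iso.refl
  have hfin := (((hK.expand 3).expand (Sum.inr ⟨0, by simp⟩)).expand
    (Sum.inl ⟨Sum.inr ⟨1, by simp⟩, by simp⟩)).finite
  have hbij : Function.Bijective tricornMap := by
    refine (Nat.bijective_iff_injective_and_card _).2 ⟨hinj, ?_⟩
    rw [card_expand ((hK.expand 3).expand _), card_expand (hK.expand 3), card_expand hK]
    simp
  obtain ⟨φ, -⟩ := isCubic_tricorn.nonempty_iso hcub tricornMap hbij (by
    intro a b
    rw [tricorn_adj]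
    fin_cases a <;> fin_cases b <;> simp [tricornMap])
  exact ⟨φ⟩


/-- Expanding `K` at `z` and then at two vertices of the new triangle creates a tricorn. -/
theorem Klee.isTricornFamily_expand_expand (n : ℕ) : ∀ {V : Type} {K : SimpleGraph V}, Klee K →
    Nat.card V = n → ∀ (z : V) (x y : K.neighborSet z) (hxy : y ≠ x),
    IsTricornFamily (LonelyEdge.expand (LonelyEdge.expand (LonelyEdge.expand K z) (Sum.inr x))
      (Sum.inl ⟨Sum.inr y, by simpa using hxy⟩)) := by
  induction n using Nat.strong_induction_on with
  | _ n ih =>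
    intro V K hK hn z x y hxy
    rcases hK.exists_expand_avoiding z with ⟨⟨φ⟩⟩ | ⟨W, H, u, a, hau, e, hH, hz⟩
    · obtain ⟨π, h1, h2, h3⟩ := exists_perm_fin4 (φ z) (φ x.1) (φ y.1)
        (fun h => nbr_ne x (φ.injective h)) (fun h => nbr_ne y (φ.injective h))
        (fun h => hxy (Subtype.ext (φ.injective h)).symm)
      obtain ⟨θ, hθz, hθx, hθy⟩ : ∃ θ : K ≃g (⊤ : SimpleGraph (Fin 4)),
          θ z = 3 ∧ θ x.1 = 0 ∧ θ y.1 = 1 :=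
        ⟨φ.trans (SimpleGraph.Iso.completeGraph π), h1, h2, h3⟩
      obtain ⟨F, -, hF⟩ := exists_expandIso θ hθz
      obtain ⟨hbx, hFx⟩ := hF x
      obtain ⟨hby, hFy⟩ := hF y
      simp only [hθx] at hFx
      simp only [hθy] at hFy
      obtain ⟨F2, hF2, -⟩ := exists_expandIso F hFx
      obtain ⟨hc, hF2y⟩ := hF2 ⟨Sum.inr y, by simpa using hxy⟩
      simp only [hFy] at hF2y
      obtain ⟨F3, -, -⟩ := exists_expandIso F2 hF2y
      obtain ⟨f⟩ := nonempty_tricorn_iso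
      exact Or.inl ⟨F3.trans f.symm⟩
    -- Write `K` as an expansion of `H` at `u` with `z` an old vertex `a`. The expansion at `u` is
    -- moved past the three others to the end, and the induction hypothesis for `H` and `a` applies.
    · obtain ⟨F, -, hF⟩ := exists_expandIso e hz
      obtain ⟨hbx, hFx⟩ := hF x
      obtain ⟨hby, hFy⟩ := hF y
      obtain ⟨ψ, -, hψ, -⟩ := exists_expand_comm H hau
      obtain ⟨x', hx'⟩ := hψ ⟨e x.1, hbx⟩
      obtain ⟨y', hy'⟩ := hψ ⟨e y.1, hby⟩
      have hGx : (F.trans ψ) (Sum.inr x) = Sum.inl ⟨Sum.inr x', by simp⟩ := by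
        rw [RelIso.trans_apply, hFx, hx']
      have hGy : (F.trans ψ) (Sum.inr y) = Sum.inl ⟨Sum.inr y', by simp⟩ := by
        rw [RelIso.trans_apply, hFy, hy']
      have hxy' : y' ≠ x' := by
        rintro rfl
        exact hxy (Sum.inr_injective ((F.trans ψ).injective (hGy.trans hGx.symm)))
      obtain ⟨F2, hF2, -⟩ := exists_expandIso (F.trans ψ) hGx
      obtain ⟨hc, hF2y⟩ := hF2 ⟨Sum.inr y, by simpa using hxy⟩
      simp only [hGy] at hF2y
      obtain ⟨ψ2, -, -, hψ2⟩ := exists_expand_comm (LonelyEdge.expand H a)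
        (u := Sum.inr x') (v := Sum.inl ⟨u, hau.symm⟩) (by simp)
      have hGy2 : (F2.trans ψ2) (Sum.inl ⟨Sum.inr y, by simpa using hxy⟩) =
          Sum.inl ⟨Sum.inl ⟨Sum.inr y', by simpa using hxy'⟩, by simp⟩ := by
        rw [RelIso.trans_apply, hF2y]
        exact hψ2 (Sum.inr y') (by simp) (by simpa using hxy')
      obtain ⟨F3, -, -⟩ := exists_expandIso (F2.trans ψ2) hGy2
      obtain ⟨ψ3, -, -, -⟩ := exists_expand_comm
        (LonelyEdge.expand (LonelyEdge.expand H a) (Sum.inr x'))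
        (u := Sum.inl ⟨Sum.inr y', by simpa using hxy'⟩)
        (v := Sum.inl ⟨Sum.inl ⟨u, hau.symm⟩, by simp⟩) (by simp)
      have hcard : Nat.card V = Nat.card W + 2 := by
        rw [Nat.card_congr e.toEquiv, card_expand hH]
      exact ((ih (Nat.card W) (by omega) hH rfl a x' y' hxy').expand _).congr (F3.trans ψ3)

/-- `IsTower K z`: the graph `K` arises from `K₄` by expansions each of which, but for the first,
is at a vertex of the triangle created just before, and `z` is in the last of these triangles. -/
inductive IsTower : ∀ {V : Type}, SimpleGraph V → V → Prop
  | base {V : Type} {G : SimpleGraph V} (e : G ≃g (⊤ : SimpleGraph (Fin 4))) (z : V) : IsTower G z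
  | step {V W : Type} {G : SimpleGraph V} {H : SimpleGraph W} {u : W} (y : H.neighborSet u) (z : V)
      (e : G ≃g expand H u) : IsTower H u → e z = Sum.inr y → IsTower G z

theorem IsTower.klee {V : Type} {G : SimpleGraph V} {z : V} (h : IsTower G z) : Klee G := by
  induction h with
  | base e z => exact .base e
  | step y z e h hz ih => exact .step _ ih e

/-- Write `K` as `H^u` with `z` an old vertex `a`. If `H^a` is in the tricorn family, so is its
expansion at `u`, which is `K^z`. Otherwise `H` is a tower ending at `a`, and the position of `u`
relative to its last triangle decides. -/
theorem Klee.isTower_or (n : ℕ) : ∀ {V : Type} {K : SimpleGraph V}, Klee K →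
    Nat.card V = n → ∀ z : V, IsTower K z ∨ IsTricornFamily (LonelyEdge.expand K z) := by
  induction n using Nat.strong_induction_on with
  | _ n ih =>
    intro V K hK hn z
    rcases hK.exists_expand_avoiding z with ⟨⟨φ⟩⟩ | ⟨W, H, u, a, hau, e, hH, hz⟩
    · exact Or.inl (.base φ z)
    have hcard : Nat.card V = Nat.card W + 2 := by
      rw [Nat.card_congr e.toEquiv, card_expand hH]
    obtain ⟨F, -, -⟩ := exists_expandIso e hz
    obtain ⟨ψ, -, -, -⟩ := exists_expand_comm H hau
    rcases ih (Nat.card W) (by omega) hH rfl a with hT | hT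
    · cases hT with
      -- Here `K` is the prism and `z` lies in its old triangle; exchanging the triangles puts `z`
      -- in the new one.
      | base φ =>
        left
        obtain ⟨F2, hF2, -⟩ := exists_expandIso φ (u := u) rfl
        obtain ⟨hb, hF2a⟩ := hF2 ⟨a, hau⟩
        refine .step (H := (⊤ : SimpleGraph (Fin 4))) (u := φ u) ⟨φ a, hb.symm⟩ z
          ((e.trans F2).trans (prismSwap _)) (.base SimpleGraph.Iso.refl _) ?_
        simp only [RelIso.trans_apply, hz, hF2a]
        rfl
      | @step _ W' _ H' u' y' _ e2 hT hy =>
        have hH' : Klee H' := hT.klee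
        have hcard' : Nat.card W = Nat.card W' + 2 := by
          rw [Nat.card_congr e2.toEquiv, card_expand hH']
        -- If `u` is outside the last triangle of the tower, its expansion is moved before the last
        -- one, and the induction hypothesis is applied to the result, which has as many vertices as
        -- `H`. If `u` is in that triangle, then `u` and `z` are two expanded vertices of it and a
        -- tricorn appears.
        rcases hu : e2 u with ⟨b, hbu⟩ | x'
        · obtain ⟨F2, hF2, -⟩ := exists_expandIso e2 hu
          obtain ⟨hb, hF2a⟩ := hF2 ⟨a, hau⟩
          simp only [hy] at hF2a
          obtain ⟨ψ', hψ', -, -⟩ := exists_expand_comm H' hbu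
          obtain ⟨y2, hy2⟩ := hψ' y'
          have hz2 : (e.trans (F2.trans ψ')) z = Sum.inr y2 := by
            rw [RelIso.trans_apply, hz, RelIso.trans_apply, hF2a, hy2]
          rcases ih (Nat.card W) (by omega) (hH'.expand b) (by rw [card_expand hH', hcard'])
            (Sum.inl ⟨u', hbu.symm⟩) with hT2 | hT2
          · exact Or.inl (.step y2 z _ hT2 hz2)
          · obtain ⟨F4, -, -⟩ := exists_expandIso _ hz2
            exact Or.inr ((hT2.expand _).congr F4)
        · obtain ⟨F2, hF2, -⟩ := exists_expandIso e2 hu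
          obtain ⟨hb, hF2a⟩ := hF2 ⟨a, hau⟩
          simp only [hy] at hF2a
          have hxy : y' ≠ x' := by
            rintro rfl
            exact hau (e2.injective (hy.trans hu.symm))
          have hz2 : (e.trans F2) z = Sum.inl ⟨Sum.inr y', by simpa using hxy⟩ := by
            rw [RelIso.trans_apply, hz, hF2a]
          obtain ⟨F4, -, -⟩ := exists_expandIso _ hz2
          exact Or.inr ((hH'.isTricornFamily_expand_expand _ rfl u' x' y' hxy).congr F4)
    · exact Or.inr ((hT.expand _).congr (F.trans ψ))

end LonelyEdge
namespace LonelyEdge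

/-! ### Lonely edges of the expansion at a vertex of a triangle -/

/-- The lonely edges whose perfect matching contains the edge `ab`. -/
def lonelyWith {V : Type*} (G : SimpleGraph V) (a b : V) : Set (Sym2 V) :=
  {e | IsLonely G e ∧ ∃ σ, IsPM G σ ∧ HasEdge σ e ∧ σ a = b}

section
variable {V : Type} {G : SimpleGraph V} {v : V}

theorem mem_lonelyWith {a b c d : V} : s(c, d) ∈ lonelyWith G a b ↔
    ∃ σ, IsPM G σ ∧ σ a = b ∧ σ c = d ∧ ∀ τ, IsPM G τ → τ c = d → τ = σ := by
  constructor
  · rintro ⟨h, σ, hσ, he, hab⟩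
    rw [hσ.hasEdge_iff] at he
    subst he
    exact ⟨σ, hσ, hab, rfl, hσ.isLonely_iff.1 h⟩
  · rintro ⟨σ, hσ, hab, rfl, hu⟩
    exact ⟨hσ.isLonely_iff.2 hu, σ, hσ, ⟨c, rfl⟩, hab⟩

theorem exists_of_mem_lonelyWith {a b : V} {e : Sym2 V} (h : e ∈ lonelyWith G a b) :
    ∃ c σ, e = s(c, σ c) ∧ IsPM G σ ∧ σ a = b ∧ ∀ τ, IsPM G τ → τ c = σ c → τ = σ := by
  obtain ⟨h1, σ, hσ, ⟨c, rfl⟩, hab⟩ := h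
  exact ⟨c, σ, rfl, hσ, hab, hσ.isLonely_iff.1 h1⟩

theorem lonelyWith_comm (a b : V) : lonelyWith G a b = lonelyWith G b a := by
  ext e
  refine and_congr_right fun _ => exists_congr fun σ => and_congr_right fun hσ =>
    and_congr_right fun _ => hσ.eq_comm

theorem existsUnique_isPM_comm (a b : V) :
    (∃! σ, IsPM G σ ∧ σ a = b) ↔ ∃! σ, IsPM G σ ∧ σ b = a :=
  existsUnique_congr fun _ => and_congr_right fun hσ => hσ.eq_comm

/-- Two matchings with different restrictions make an edge non-lonely. -/
theorem not_isLonely_of_ne {a b : V} {σ τ : V → V} (hσ : IsPM G σ) (hτ : IsPM G τ) (h1 : σ a = b)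
    (h2 : τ a = b) (hne : σ ≠ τ) : ¬ IsLonely G s(a, b) := fun h =>
  hne (h.eq hσ hτ (hσ.hasEdge_iff.2 h1) (hτ.hasEdge_iff.2 h2))

/-- A lift pairs the two triangle vertices not attached to `σ v`, whereas `lift3` matches every
triangle vertex outwards. -/
theorem lift_ne_lift3 (hG : IsCubic G) {σ μ : V → V} : lift G v σ ≠ lift3 G v μ := by
  intro e
  obtain ⟨x, y, h1, h2, h3⟩ : ∃ x y : G.neighborSet v, x ≠ y ∧ x.1 ≠ σ v ∧ y.1 ≠ σ v := by
    obtain ⟨p, q, r, h1, h2, h3, h4⟩ := hG.exists_nbrs v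
    by_cases hp : p = σ v
    · exact ⟨⟨q, by simp [h4]⟩, ⟨r, by simp [h4]⟩, by simpa using h3, fun h => h1 (hp.trans h.symm),
        fun h => h2 (hp.trans h.symm)⟩
    · by_cases hq : q = σ v
      · exact ⟨⟨p, by simp [h4]⟩, ⟨r, by simp [h4]⟩, by simpa using h2, hp,
          fun h => h3 (hq.trans h.symm)⟩
      · exact ⟨⟨p, by simp [h4]⟩, ⟨q, by simp [h4]⟩, by simpa using h1, hp, hq⟩
  have := congrFun e (Sum.inr x)
  simp [lift, lift3, h2] at this

theorem Klee.not_isLonely_spoke (hG : Klee G) (x : G.neighborSet v) :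
    ¬ IsLonely (LonelyEdge.expand G v) s(Sum.inr x, Sum.inl ⟨x.1, nbr_ne x⟩) := by
  obtain ⟨σ, hσ, hσx⟩ := hG.exists_isPM _ _ (adj_nbr x)
  obtain ⟨τ, hτ⟩ := hG.exists_isMatchOff v
  exact not_isLonely_of_ne (hσ.lift hG.isCubic) hτ.lift3 (lift_inr_eq_inl.2 ⟨hσx, rfl⟩) lift3_inr
    (lift_ne_lift3 hG.isCubic)

theorem Klee.lonely_expand_cases (hG : Klee G) {e : Sym2 (ExpandVert G v)}
    (he : IsLonely (LonelyEdge.expand G v) e) : (∃ a b, e = s(Sum.inl a, Sum.inl b)) ∨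
      ∃ x y, x ≠ y ∧ e = s(Sum.inr x, Sum.inr y) := by
  induction e using Sym2.ind with
  | _ a b =>
    have hadj : (LonelyEdge.expand G v).Adj a b := he.1
    rcases a with a | x <;> rcases b with b | y
    · exact Or.inl ⟨a, b, rfl⟩
    · obtain rfl : a = ⟨y.1, nbr_ne y⟩ := Subtype.ext hadj
      rw [Sym2.eq_swap] at he
      exact absurd he (hG.not_isLonely_spoke y)
    · obtain rfl : b = ⟨x.1, nbr_ne x⟩ := Subtype.ext hadj
      exact absurd he (hG.not_isLonely_spoke x)
    · exact Or.inr ⟨x, y, hadj, rfl⟩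

end

/-- `v`, `p`, `q` are the vertices of a triangle and `o` is the third neighbour of `v`. -/
structure IsCorner {V : Type} (G : SimpleGraph V) (v p q o : V) : Prop where
  ne_pq : p ≠ q
  ne_po : p ≠ o
  ne_qo : q ≠ o
  adj_iff : ∀ a, G.Adj v a ↔ a = p ∨ a = q ∨ a = o
  adj_pq : G.Adj p q

namespace IsCorner
variable {V : Type} {G : SimpleGraph V} {v p q o : V}

theorem symm (h : IsCorner G v p q o) : IsCorner G v q p o :=
  ⟨h.ne_pq.symm, h.ne_qo, h.ne_po, fun a => by rw [h.adj_iff]; tauto, h.adj_pq.symm⟩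

theorem adj_p (h : IsCorner G v p q o) : G.Adj v p := (h.adj_iff p).2 (Or.inl rfl)
theorem adj_q (h : IsCorner G v p q o) : G.Adj v q := (h.adj_iff q).2 (Or.inr (Or.inl rfl))
theorem adj_o (h : IsCorner G v p q o) : G.Adj v o := (h.adj_iff o).2 (Or.inr (Or.inr rfl))

theorem isPM_cases (h : IsCorner G v p q o) {σ : V → V} (hσ : IsPM G σ) :
    σ v = p ∨ σ v = q ∨ σ v = o :=
  (h.adj_iff _).1 (hσ.adj v)

/-- The new vertices. -/
def P (h : IsCorner G v p q o) : ExpandVert G v := Sum.inr ⟨p, h.adj_p⟩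
def Q (h : IsCorner G v p q o) : ExpandVert G v := Sum.inr ⟨q, h.adj_q⟩
def O (h : IsCorner G v p q o) : ExpandVert G v := Sum.inr ⟨o, h.adj_o⟩

theorem eq_o_of (h : IsCorner G v p q o) {σ : V → V} (hσ : IsPM G σ)
    (hpq : σ p = q) : σ v = o := by
  rcases h.isPM_cases hσ with e | e | e
  · exact absurd (hpq.symm.trans (hσ.eq_comm.1 e)) h.adj_q.ne'
  · exact absurd ((hσ.eq_comm.1 hpq).symm.trans (hσ.eq_comm.1 e)) h.adj_p.ne'
  · exact e

theorem lift_O (h : IsCorner G v p q o) (hG : IsCubic G) {σ : V → V} (hσ : IsPM G σ) :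
    lift G v σ h.O = h.P ↔ σ v = q := by
  rw [O, P, lift_inr_eq_inr hG hσ]
  have := h.isPM_cases hσ
  have := h.ne_pq
  have := h.ne_po
  have := h.ne_qo
  simp only [Ne]
  grind

theorem lift_P (h : IsCorner G v p q o) (hG : IsCubic G) {σ : V → V} (hσ : IsPM G σ) :
    lift G v σ h.P = h.Q ↔ σ v = o := by
  rw [P, Q, lift_inr_eq_inr hG hσ]
  have := h.isPM_cases hσ
  have := h.ne_pq
  have := h.ne_po
  have := h.ne_qo
  simp only [Ne]
  grind

/-- A matching containing an edge of the new triangle is a lift. -/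
theorem exists_lift {x y : G.neighborSet v} (hG : IsCubic G)
    {ρ : ExpandVert G v → ExpandVert G v} (hρ : IsPM (expand G v) ρ)
    (e : ρ (Sum.inr x) = Sum.inr y) : ∃ σ, IsPM G σ ∧ ρ = lift G v σ := by
  rcases hρ.eq_lift_or hG with h1 | ⟨μ, -, -, h3⟩
  · exact h1
  · rw [h3] at e
    simp at e

/-- A matching off the closed neighbourhood of `v` extends to the whole graph. -/
theorem exists_extension (h : IsCorner G v p q o) {μ : V → V}
    (hμ : IsMatchOff G (closedNbhd G v) μ) :
    ∃ σ, IsPM G σ ∧ σ p = q ∧ σ v = o ∧ ∀ a ∉ closedNbhd G v, σ a = μ a := by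
  classical
  have hp := h.adj_p.ne'
  have hq := h.adj_q.ne'
  have ho := h.adj_o.ne'
  have h1 := h.ne_pq
  have h2 := h.ne_po
  have h3 := h.ne_qo
  have hmem : ∀ a, a ∈ closedNbhd G v ↔ a = v ∨ a = p ∨ a = q ∨ a = o := by
    intro a
    simp [closedNbhd, h.adj_iff]
  refine ⟨fun a => if a = v then o else if a = o then v else if a = p then q else
    if a = q then p else μ a, ?_, ?_, ?_, ?_⟩
  · intro a
    have hcase : a = v ∨ a = p ∨ a = q ∨ a = o ∨ a ∉ closedNbhd G v := by
      rw [hmem]; tauto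
    rcases hcase with rfl | rfl | rfl | rfl | ha
    · simp [ho, h.adj_o]
    · simp [hp, hq, h1.symm, h2, h3, h.adj_pq]
    · simp [hp, hq, h1.symm, h2, h3, h.adj_pq.symm]
    · simp [ho, h.adj_o.symm]
    · obtain ⟨h4, h5, h6⟩ := hμ a ha
      rw [hmem] at ha h4
      push Not at ha h4
      simp only [ha, h4, if_false]
      exact ⟨h5, h6⟩
  · simp [hp, h2]
  · simp
  · intro a ha
    rw [hmem] at ha
    push Not at ha
    simp [ha]

/-- A matching containing the triangle edge opposite to `v` restricts off the closed
neighbourhood of `v`. -/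
theorem isMatchOff (h : IsCorner G v p q o) {σ : V → V} (hσ : IsPM G σ)
    (hpq : σ p = q) : IsMatchOff G (closedNbhd G v) σ := by
  have hv := h.eq_o_of hσ hpq
  have hmem : ∀ a, a ∈ closedNbhd G v ↔ a = v ∨ a = p ∨ a = q ∨ a = o := by
    intro a
    simp [closedNbhd, h.adj_iff]
  intro a ha
  refine ⟨fun h1 => ha ?_, hσ a⟩
  rw [hmem] at h1 ⊢
  rw [← hσ.invol a]
  rcases h1 with h1 | h1 | h1 | h1 <;> rw [h1]
  · simp [hv]
  · simp [hpq]
  · simp [hσ.eq_comm.1 hpq]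
  · simp [hσ.eq_comm.1 hv]

theorem existsUnique_OP_iff (h : IsCorner G v p q o) (hG : IsCubic G) :
    (∃! ρ, IsPM (expand G v) ρ ∧ ρ h.O = h.P) ↔ ∃! σ, IsPM G σ ∧ σ v = q := by
  constructor
  · rintro ⟨ρ, ⟨hρ, e⟩, hu⟩
    obtain ⟨σ, hσ, rfl⟩ := exists_lift hG hρ e
    rw [h.lift_O hG hσ] at e
    refine ⟨σ, ⟨hσ, e⟩, fun τ hτ => lift_injective hτ.1 hσ (hu _ ⟨hτ.1.lift hG, ?_⟩)⟩
    rw [h.lift_O hG hτ.1]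
    exact hτ.2
  · rintro ⟨σ, ⟨hσ, e⟩, hu⟩
    refine ⟨lift G v σ, ⟨hσ.lift hG, (h.lift_O hG hσ).2 e⟩, ?_⟩
    rintro ρ ⟨hρ, e2⟩
    obtain ⟨τ, hτ, rfl⟩ := exists_lift hG hρ e2
    rw [h.lift_O hG hτ] at e2
    rw [hu τ ⟨hτ, e2⟩]

/-- The matchings through `OP` are the lifts of the matchings through `vq`. The edge `vq` turns into
`OP` and the other relevant edges stay. Loneliness is not lost, since a matching using all three
edges leaving the new triangle would yield a second matching of `G` through the same old edge. -/
theorem ncard_lonelyWith_OP (h : IsCorner G v p q o) (hK : Klee G) :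
    (lonelyWith (expand G v) h.O h.P).ncard = (lonelyWith G v q).ncard := by
  have hG := hK.isCubic
  have := hK.finite
  have := (hK.expand v).finite
  apply le_antisymm
  · refine ncard_le_of_rel (fun e e' =>
      (∃ a b : {w : V // w ≠ v}, e = s(a.1, b.1) ∧ e' = s(Sum.inl a, Sum.inl b)) ∨
      (e = s(v, q) ∧ e' = s(h.O, h.P))) ?_ ?_
    · intro e' he'
      rcases hK.lonely_expand_cases he'.1 with ⟨a, b, rfl⟩ | ⟨x, y, hxy, rfl⟩
      · obtain ⟨ρ, hρ, hOP, e, hu⟩ := mem_lonelyWith.1 he'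
        obtain ⟨σ, hσ, rfl⟩ := exists_lift hG hρ hOP
        rw [h.lift_O hG hσ] at hOP
        rw [lift_inl_eq_inl hσ] at e
        exact ⟨s(a.1, b.1), mem_lonelyWith.2 ⟨σ, hσ, hOP, e, fun τ hτ h1 =>
          lift_injective hτ hσ (hu _ (hτ.lift hG) ((lift_inl_eq_inl hτ).2 h1))⟩,
          Or.inl ⟨a, b, rfl, rfl⟩⟩
      · have hOx : s(Sum.inr x, Sum.inr y) = s(h.O, h.P) := by
          obtain ⟨ρ, hρ, hOP, e, hu⟩ := mem_lonelyWith.1 he'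
          obtain ⟨σ, hσ, rfl⟩ := exists_lift hG hρ hOP
          rw [h.lift_O hG hσ] at hOP
          rw [lift_inr_eq_inr hG hσ, hOP] at e
          have h1 := (h.adj_iff _).1 x.2
          have h2 := (h.adj_iff _).1 y.2
          rw [Ne, Subtype.ext_iff] at hxy
          rw [Sym2.eq_iff, O, P]
          simp only [Sum.inr.injEq, Subtype.ext_iff]
          grind
        rw [hOx] at he' ⊢
        obtain ⟨ρ, hρ, hOP, e, hu⟩ := mem_lonelyWith.1 he'
        obtain ⟨σ, hσ, rfl⟩ := exists_lift hG hρ hOP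
        rw [h.lift_O hG hσ] at hOP
        exact ⟨s(v, q), mem_lonelyWith.2 ⟨σ, hσ, hOP, hOP, fun τ hτ h1 =>
          lift_injective hτ hσ (hu _ (hτ.lift hG) ((h.lift_O hG hτ).2 h1))⟩, Or.inr ⟨rfl, rfl⟩⟩
    · rintro _ _ _ (⟨a, b, rfl, rfl⟩ | ⟨rfl, rfl⟩) (⟨a', b', e, rfl⟩ | ⟨e, rfl⟩)
      · simpa [Sym2.eq_iff, Subtype.ext_iff] using e
      · rcases Sym2.eq_iff.1 e with e | e
        · exact absurd e.1 a.2
        · exact absurd e.2 b.2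
      · rcases Sym2.eq_iff.1 e with e | e
        · exact absurd e.1.symm a'.2
        · exact absurd e.1.symm b'.2
      · rfl
  · refine ncard_le_of_rel (fun e' e =>
      (∃ a b : {w : V // w ≠ v}, e = s(a.1, b.1) ∧ e' = s(Sum.inl a, Sum.inl b)) ∨
      (e = s(v, q) ∧ e' = s(h.O, h.P))) ?_ ?_
    · intro e he
      obtain ⟨c, σ, rfl, hσ, hvq, hu⟩ := exists_of_mem_lonelyWith he
      have hOP : (∀ τ, IsPM G τ → τ v = q → τ = σ) → s(h.O, h.P) ∈ lonelyWith (expand G v) h.O h.P := by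
        intro hu
        refine mem_lonelyWith.2 ⟨lift G v σ, hσ.lift hG, (h.lift_O hG hσ).2 hvq,
          (h.lift_O hG hσ).2 hvq, fun ρ hρ e => ?_⟩
        obtain ⟨τ, hτ, rfl⟩ := exists_lift hG hρ e
        rw [h.lift_O hG hτ] at e
        rw [hu τ hτ e]
      by_cases hcv : c = v
      · subst hcv
        rw [hvq] at hu ⊢
        exact ⟨_, hOP hu, Or.inr ⟨rfl, rfl⟩⟩
      by_cases hcv' : σ c = v
      · have hqc : q = c := by rw [← hvq, ← hcv', hσ.invol]
        subst hqc
        rw [hcv'] at hu ⊢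
        exact ⟨_, hOP fun τ hτ e => hu τ hτ (hτ.eq_comm.1 e), Or.inr ⟨Sym2.eq_swap, rfl⟩⟩
      refine ⟨s(Sum.inl ⟨c, hcv⟩, Sum.inl ⟨σ c, hcv'⟩), mem_lonelyWith.2 ⟨lift G v σ, hσ.lift hG,
        (h.lift_O hG hσ).2 hvq, (lift_inl_eq_inl hσ).2 rfl, fun ρ hρ e => ?_⟩,
        Or.inl ⟨_, _, rfl, rfl⟩⟩
      rcases hρ.eq_lift_or hG with ⟨τ, hτ, rfl⟩ | ⟨μ, hμ, rfl, -⟩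
      · rw [lift_inl_eq_inl hτ] at e
        rw [hu τ hτ e]
      -- Completing the partial matching by `pq` and `vo` gives a matching through the lonely edge
      -- that does not contain `vq`.
      · exfalso
        rw [lift3_inl_eq_inl hμ] at e
        obtain ⟨τ, hτ, -, hvo, hτμ⟩ := h.exists_extension hμ
        have h1 := hu τ hτ (by rw [hτμ c (by simp [closedNbhd, hcv, e.1]), e.2])
        exact h.ne_qo (by rw [← hvq, ← hvo, h1])
    · rintro _ _ _ (⟨a, b, rfl, rfl⟩ | ⟨rfl, rfl⟩) (⟨a', b', rfl, e⟩ | ⟨rfl, e⟩)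
      · simpa [Sym2.eq_iff, Subtype.ext_iff] using e
      · simp [O, P] at e
      · simp [O, P] at e
      · rfl

/-- No lonely edge lies in a matching that uses all edges leaving the new triangle. -/
theorem not_isLonely_of_lift3 (h : IsCorner G v p q o) (hK : Klee G) {μ : V → V}
    (hμ : IsMatchOff G (closedNbhd G v) μ) (w : ExpandVert G v) :
    ¬ IsLonely (expand G v) s(w, lift3 G v μ w) := by
  intro hl
  rcases hK.lonely_expand_cases hl with ⟨a, b, e⟩ | ⟨x, y, hxy, e⟩
  · have hab : lift3 G v μ (Sum.inl a) = Sum.inl b := by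
      rw [← hμ.lift3.hasEdge_iff, ← e]
      exact ⟨_, rfl⟩
    rw [e] at hl
    obtain ⟨τ, hτ, -, -, hτμ⟩ := h.exists_extension hμ
    refine not_isLonely_of_ne (hτ.lift hK.isCubic) hμ.lift3 ?_ hab (lift_ne_lift3 hK.isCubic) hl
    rw [lift3_inl_eq_inl hμ] at hab
    rw [lift_inl_eq_inl hτ, hτμ _ (by simp [closedNbhd, a.2, hab.1]), hab.2]
  · have hab : lift3 G v μ (Sum.inr x) = Sum.inr y := by
      rw [← hμ.lift3.hasEdge_iff, ← e]
      exact ⟨_, rfl⟩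
    simp [lift3_inr] at hab

/-- Matchings through `PQ` are lifts of matchings through `vo`. By `h0`, only those that also
contain `pq` can carry a lonely edge; such a matching also restricts to `G - N[v]`, and its edges
there lie in a `lift3` as well. Only `pq` itself remains. -/
theorem lonelyWith_PQ_subset (h : IsCorner G v p q o) (hK : Klee G)
    (h0 : ∀ σ, IsPM G σ → σ v = o → σ p ≠ q → ∀ a, ¬ IsLonely G s(a, σ a))
    (hex : ∃ σ, IsPM G σ ∧ σ v = o ∧ σ p ≠ q) {e : Sym2 (ExpandVert G v)}
    (he : e ∈ lonelyWith (expand G v) h.P h.Q) :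
    e = s(Sum.inl ⟨p, h.adj_p.ne'⟩, Sum.inl ⟨q, h.adj_q.ne'⟩) ∧ ∃! σ, IsPM G σ ∧ σ p = q := by
  have hG := hK.isCubic
  obtain ⟨τ1, hτ1, hpq1⟩ := hK.exists_isPM p q h.adj_pq
  obtain ⟨τ0, hτ0, hv0, hpq0⟩ := hex
  rcases hK.lonely_expand_cases he.1 with ⟨a, b, rfl⟩ | ⟨x, y, hxy, rfl⟩
  · obtain ⟨ρ, hρ, hPQ, e, hu⟩ := mem_lonelyWith.1 he
    obtain ⟨σ, hσ, rfl⟩ := exists_lift hG hρ hPQ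
    rw [h.lift_P hG hσ] at hPQ
    rw [lift_inl_eq_inl hσ] at e
    have hlone : ∀ τ, IsPM G τ → τ a.1 = b.1 → τ = σ := fun τ hτ h1 =>
          lift_injective hτ hσ (hu _ (hτ.lift hG) ((lift_inl_eq_inl hτ).2 h1))
    have hpq : σ p = q := by
      by_contra hpq
      refine h0 σ hσ hPQ hpq a ?_
      rw [hσ.isLonely_iff, e]
      exact hlone
    have hμ := h.isMatchOff hσ hpq
    have hva : G.Adj v a.1 := by
      by_contra hva
      have := hu _ hμ.lift3 ((lift3_inl_eq_inl hμ).2 ⟨hva, e⟩)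
      exact lift_ne_lift3 hG this.symm
    have hab : (a.1 = p ∧ b.1 = q) ∨ (a.1 = q ∧ b.1 = p) := by
      rcases (h.adj_iff _).1 hva with h1 | h1 | h1
      · exact Or.inl ⟨h1, by rw [← e, h1, hpq]⟩
      · exact Or.inr ⟨h1, by rw [← e, h1, hσ.eq_comm.1 hpq]⟩
      · exact absurd (by rw [← e, h1, hσ.eq_comm.1 hPQ]) b.2
    refine ⟨?_, σ, ⟨hσ, hpq⟩, fun τ hτ => hlone τ hτ.1 ?_⟩
    · rw [Sym2.eq_iff]
      simpa [Subtype.ext_iff] using hab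
    · rcases hab with ⟨h1, h2⟩ | ⟨h1, h2⟩
      · rw [h1, h2, hτ.2]
      · rw [h1, h2, hτ.1.eq_comm.1 hτ.2]
  -- Whether a triangle edge lies in a lift depends only on the partner of `v`. So this edge lies in
  -- the lifts of two matchings through `vo`, one with `pq` and one without.
  · exfalso
    obtain ⟨ρ, hρ, hPQ, e, hu⟩ := mem_lonelyWith.1 he
    have h1 : ∀ τ, IsPM G τ → τ v = o → lift G v τ (Sum.inr x) = Sum.inr y := by
      obtain ⟨σ, hσ, rfl⟩ := exists_lift hG hρ hPQ
      rw [h.lift_P hG hσ] at hPQ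
      intro τ hτ hvo
      rw [lift_inr_eq_inr hG hσ] at e
      rw [lift_inr_eq_inr hG hτ, hvo, ← hPQ]
      exact e
    have e1 := hu _ (hτ1.lift hG) (h1 τ1 hτ1 (h.eq_o_of hτ1 hpq1))
    have e0 := hu _ (hτ0.lift hG) (h1 τ0 hτ0 hv0)
    have := lift_injective hτ1 hτ0 (e1.trans e0.symm)
    exact hpq0 (this ▸ hpq1)

theorem ncard_lonelyWith_PQ_of_unique (h : IsCorner G v p q o) (hK : Klee G)
    (h0 : ∀ σ, IsPM G σ → σ v = o → σ p ≠ q → ∀ a, ¬ IsLonely G s(a, σ a))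
    (hex : ∃ σ, IsPM G σ ∧ σ v = o ∧ σ p ≠ q) (hu : ∃! σ, IsPM G σ ∧ σ p = q) :
    (lonelyWith (expand G v) h.P h.Q).ncard = 1 := by
  have hG := hK.isCubic
  rw [Set.ncard_eq_one]
  refine ⟨s(Sum.inl ⟨p, h.adj_p.ne'⟩, Sum.inl ⟨q, h.adj_q.ne'⟩), Set.eq_singleton_iff_unique_mem.2
    ⟨?_, fun e he => (h.lonelyWith_PQ_subset hK h0 hex he).1⟩⟩
  obtain ⟨σ, ⟨hσ, hpq⟩, hu⟩ := hu
  refine mem_lonelyWith.2 ⟨lift G v σ, hσ.lift hG, (h.lift_P hG hσ).2 (h.eq_o_of hσ hpq),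
    (lift_inl_eq_inl hσ).2 hpq, fun ρ hρ e => ?_⟩
  rcases hρ.eq_lift_or hG with ⟨τ, hτ, rfl⟩ | ⟨μ, hμ, rfl, -⟩
  · rw [lift_inl_eq_inl hτ] at e
    rw [hu τ ⟨hτ, e⟩]
  · rw [lift3_inl_eq_inl hμ] at e
    exact absurd h.adj_p e.1

theorem ncard_lonelyWith_PQ_of_not_unique (h : IsCorner G v p q o) (hK : Klee G)
    (h0 : ∀ σ, IsPM G σ → σ v = o → σ p ≠ q → ∀ a, ¬ IsLonely G s(a, σ a))
    (hex : ∃ σ, IsPM G σ ∧ σ v = o ∧ σ p ≠ q) (hu : ¬ ∃! σ, IsPM G σ ∧ σ p = q) :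
    (lonelyWith (expand G v) h.P h.Q).ncard = 0 := by
  rw [Set.eq_empty_of_forall_notMem (s := lonelyWith (expand G v) h.P h.Q)
    fun e he => hu (h.lonelyWith_PQ_subset hK h0 hex he).2]
  simp

theorem not_existsUnique_PQ (h : IsCorner G v p q o) (hK : Klee G)
    (hex : ∃ σ, IsPM G σ ∧ σ v = o ∧ σ p ≠ q) :
    ¬ ∃! ρ, IsPM (expand G v) ρ ∧ ρ h.P = h.Q := by
  have hG := hK.isCubic
  obtain ⟨τ1, hτ1, hpq1⟩ := hK.exists_isPM p q h.adj_pq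
  obtain ⟨τ0, hτ0, hv0, hpq0⟩ := hex
  intro hu
  have := lift_injective hτ1 hτ0 (hu.unique
    ⟨hτ1.lift hG, (h.lift_P hG hτ1).2 (h.eq_o_of hτ1 hpq1)⟩
    ⟨hτ0.lift hG, (h.lift_P hG hτ0).2 hv0⟩)
  exact hpq0 (this ▸ hpq1)

end IsCorner

end LonelyEdge
namespace LonelyEdge

/-! ### Counting lonely edges along a sequence of extensions -/

/-- The effect of an extension of index `s` on the numbers of lonely edges, sorted by the edge of the
labelled triangle that their matching contains. -/
def shift (s : Fin 3) (r : Fin 3 → ℕ) : Fin 3 → ℕ := fun k => if k = s then r s - 1 else r (-(s + k))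

/-- The indices 0, 1, 2 sum to zero modulo 3, so `-(s + i)` is the third index. -/
theorem shift_of_ne {s i j : Fin 3} (r : Fin 3 → ℕ) (h1 : s ≠ i) (h2 : s ≠ j) (h3 : i ≠ j) :
    shift s r i = r j := by
  have : -(s + i) = j := by
    revert s i j
    decide
  rw [shift, if_neg h1.symm, this]

theorem shift_self {s : Fin 3} (r : Fin 3 → ℕ) : shift s r s = r s - 1 := if_pos rfl

theorem exists_others (s : Fin 3) : ∃ i j, s ≠ i ∧ s ≠ j ∧ i ≠ j := by
  revert s
  decide

theorem eq_or_eq_or_eq {s i j : Fin 3} (h1 : s ≠ i) (h2 : s ≠ j) (h3 : i ≠ j) (k : Fin 3) :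
    k = s ∨ k = i ∨ k = j := by
  revert s i j k
  decide

/-- `x` labels a triangle of `G`, and the number of lonely edges whose matching contains the edge
of this triangle opposite to `x k` is `r k`, and it is two if and only if there is just one such
matching. -/
structure TriangleState {V : Type} (G : SimpleGraph V) (x : Fin 3 → V) (r : Fin 3 → ℕ) : Prop where
  klee : Klee G
  inj : Function.Injective x
  adj : ∀ i j, i ≠ j → G.Adj (x i) (x j)
  -- This field and the next one are what `lonelyWith_PQ_subset` needs: matchings that avoid the
  -- triangle exist but contain no lonely edge.
  exists_off : ∃ σ, IsPM G σ ∧ ∀ i j, σ (x i) ≠ x j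
  not_lonely : ∀ σ, IsPM G σ → (∀ i j, σ (x i) ≠ x j) → ∀ a, ¬ IsLonely G s(a, σ a)
  le_two : ∀ k, r k ≤ 2
  unique_iff : ∀ k i j, k ≠ i → k ≠ j → i ≠ j → ((∃! σ, IsPM G σ ∧ σ (x i) = x j) ↔ r k = 2)
  ncard_eq : ∀ k i j, k ≠ i → k ≠ j → i ≠ j → (lonelyWith G (x i) (x j)).ncard = r k

theorem exists_isCorner {V : Type} {G : SimpleGraph V} (hG : IsCubic G) {x : Fin 3 → V}
    (hx : Function.Injective x) (hadj : ∀ i j, i ≠ j → G.Adj (x i) (x j)) {s i j : Fin 3}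
    (h1 : s ≠ i) (h2 : s ≠ j) (h3 : i ≠ j) : ∃ o, IsCorner G (x s) (x i) (x j) o := by
  obtain ⟨o, h4, h5, h6⟩ := hG.exists_nbr_of_adj (hadj s i h1) (hadj s j h2) (hx.ne h3)
  exact ⟨o, hx.ne h3, h4, h5, h6, hadj i j h3⟩

theorem IsRelabelling.eq {V : Type} {G : SimpleGraph V} {x : Fin 3 → V} {s i j : Fin 3}
    {x' : Fin 3 → ExpandVert G (x s)} (hx' : IsRelabelling G x s x') (h1 : s ≠ i) (h2 : s ≠ j)
    {o : V} (h : IsCorner G (x s) (x i) (x j) o) :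
    x' i = h.P ∧ x' j = h.Q ∧ x' s = h.O := by
  obtain ⟨⟨hinj, hinr⟩, hadj⟩ := hx'
  choose y hy using hinr
  have key : ∀ k, k ≠ s → x k = (y k).1 := by
    intro k hk
    obtain ⟨h4, h5⟩ := hadj k hk
    rw [hy] at h5
    exact h5
  have hi : y i = ⟨x i, h.adj_p⟩ := Subtype.ext (key i h1.symm).symm
  have hj : y j = ⟨x j, h.adj_q⟩ := Subtype.ext (key j h2.symm).symm
  have hs : y s = ⟨o, h.adj_o⟩ := by
    rcases (h.adj_iff _).1 (y s).2 with e | e | e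
    · exact absurd (hinj ((hy s).trans ((congrArg Sum.inr ((Subtype.ext e).trans hi.symm)).trans
        (hy i).symm))) h1
    · exact absurd (hinj ((hy s).trans ((congrArg Sum.inr ((Subtype.ext e).trans hj.symm)).trans
        (hy j).symm))) h2
    · exact Subtype.ext e
  exact ⟨by rw [hy, hi]; rfl, by rw [hy, hj]; rfl, by rw [hy, hs]; rfl⟩

theorem exists_isRelabelling {V : Type} {G : SimpleGraph V} (hG : IsCubic G) {x : Fin 3 → V}
    (hx : Function.Injective x) (hadj : ∀ i j, i ≠ j → G.Adj (x i) (x j)) (s : Fin 3) :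
    ∃ x', IsRelabelling G x s x' := by
  obtain ⟨i, j, h1, h2, h3⟩ := exists_others s
  obtain ⟨o, h⟩ := exists_isCorner hG hx hadj h1 h2 h3
  have hPQ : h.P ≠ h.Q := fun e =>
    h.ne_pq (congrArg Subtype.val (Sum.inr_injective e))
  have hPO : h.P ≠ h.O := fun e =>
    h.ne_po (congrArg Subtype.val (Sum.inr_injective e))
  have hQO : h.Q ≠ h.O := fun e =>
    h.ne_qo (congrArg Subtype.val (Sum.inr_injective e))
  have hcase := eq_or_eq_or_eq h1 h2 h3
  refine ⟨fun k => if k = s then h.O else if k = i then h.P else h.Q, ⟨?_, ?_⟩, ?_⟩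
  · intro a b e
    rcases hcase a with rfl | rfl | rfl <;> rcases hcase b with rfl | rfl | rfl <;> grind
  · intro k
    dsimp only
    split_ifs
    exacts [⟨_, rfl⟩, ⟨_, rfl⟩, ⟨_, rfl⟩]
  · intro k hk
    refine ⟨hx.ne hk, ?_⟩
    rcases hcase k with rfl | rfl | rfl
    · exact absurd rfl hk
    · simp [hk, IsCorner.P]
    · simp [hk, h3.symm, IsCorner.Q]

namespace TriangleState
variable {V : Type} {G : SimpleGraph V} {x : Fin 3 → V} {r : Fin 3 → ℕ}

/-- For `k ≠ s`, a matching through the edge of the new triangle opposite to `k` is a lift of a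
matching through the edge of the old one opposite to the third index, so these two counts are
exchanged. Opposite to `s`, the count is one if the old edge lies in a unique matching, that is if
`r s = 2`, and zero otherwise. In both cases this is the truncated `r s - 1`. -/
theorem shift (h : TriangleState G x r) {s : Fin 3} {x' : Fin 3 → ExpandVert G (x s)}
    (hx' : IsRelabelling G x s x') : TriangleState (expand G (x s)) x' (shift s r) := by
  have hG := h.klee.isCubic
  have hK := h.klee
  have hcor : ∀ i j, s ≠ i → s ≠ j → i ≠ j → ∃ o, ∃ c : IsCorner G (x s) (x i) (x j) o,
      x' i = c.P ∧ x' j = c.Q ∧ x' s = c.O := by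
    intro i j h1 h2 h3
    obtain ⟨o, c⟩ := exists_isCorner hG h.inj h.adj h1 h2 h3
    exact ⟨o, c, hx'.eq h1 h2 c⟩
  have hex : ∀ i j, s ≠ i → s ≠ j → i ≠ j → ∀ o, IsCorner G (x s) (x i) (x j) o →
      ∃ σ, IsPM G σ ∧ σ (x s) = o ∧ σ (x i) ≠ x j := by
    intro i j h1 h2 h3 o c
    obtain ⟨σ, hσ, hoff⟩ := h.exists_off
    refine ⟨σ, hσ, ?_, hoff i j⟩
    rcases c.isPM_cases hσ with e | e | e
    · exact absurd e (hoff s i)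
    · exact absurd e (hoff s j)
    · exact e
  have h0 : ∀ i j, s ≠ i → s ≠ j → i ≠ j → ∀ o, IsCorner G (x s) (x i) (x j) o →
      ∀ σ, IsPM G σ → σ (x s) = o → σ (x i) ≠ x j → ∀ a, ¬ IsLonely G s(a, σ a) := by
    intro i j h1 h2 h3 o c σ hσ hso hij
    refine h.not_lonely σ hσ ?_
    have hc1 := c.ne_po
    have hc2 := c.ne_qo
    have hc3 := c.adj_o.ne
    have hself : ∀ a, σ a ≠ a := fun a => (hσ.adj a).ne'
    have hcomm : ∀ a b, σ a = b → σ b = a := fun a b => hσ.eq_comm.1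
    have hcase := eq_or_eq_or_eq h1 h2 h3
    intro a b
    rcases hcase a with rfl | rfl | rfl <;> rcases hcase b with rfl | rfl | rfl <;> grind
  obtain ⟨i, j, h1, h2, h3⟩ := exists_others s
  obtain ⟨o, c, hci, hcj, hcs⟩ := hcor i j h1 h2 h3
  have hadj : ∀ a b, a ≠ b → (expand G (x s)).Adj (x' a) (x' b) := by
    intro a b hab
    obtain ⟨y, hy⟩ := hx'.1.2 a
    obtain ⟨z, hz⟩ := hx'.1.2 b
    rw [hy, hz, expand_adj_inr_inr]
    rintro rfl
    exact hab (hx'.1.1 (hy.trans hz.symm))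
  refine ⟨hK.expand _, hx'.1.1, hadj, ?_, ?_, ?_, ?_, ?_⟩
  -- The matchings that avoid the new triangle are those using all three edges leaving it.
  · obtain ⟨μ, hμ⟩ := hK.exists_isMatchOff (x s)
    refine ⟨_, hμ.lift3, fun a b => ?_⟩
    obtain ⟨y, hy⟩ := hx'.1.2 a
    obtain ⟨z, hz⟩ := hx'.1.2 b
    rw [hy, hz, lift3_inr]
    simp
  · intro ρ hρ hoff
    rcases hρ.eq_lift_or hG with ⟨σ, hσ, rfl⟩ | ⟨μ, hμ, rfl, -⟩
    · exfalso
      rcases c.isPM_cases hσ with e | e | e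
      · exact hoff s j (by rw [hcs, hcj]; exact (c.symm.lift_O hG hσ).2 e)
      · exact hoff s i (by rw [hcs, hci]; exact (c.lift_O hG hσ).2 e)
      · exact hoff i j (by rw [hci, hcj]; exact (c.lift_P hG hσ).2 e)
    · exact c.not_isLonely_of_lift3 hK hμ
  · intro k
    rw [LonelyEdge.shift]
    split_ifs
    · have := h.le_two s
      omega
    · exact h.le_two _
  · intro k a b h4 h5 h6
    rcases eq_or_eq_or_eq h4 h5 h6 s with rfl | rfl | rfl
    · obtain ⟨o, c, hca, hcb, hcs⟩ := hcor a b h4 h5 h6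
      have := h.le_two s
      rw [hca, hcb, shift_self, iff_false_left (c.not_existsUnique_PQ hK (hex a b h4 h5 h6 o c))]
      omega
    · obtain ⟨o, c, hcb, hcc, hcs⟩ := hcor b k h6 h4.symm h5.symm
      rw [hcs, hcb, c.existsUnique_OP_iff hG, shift_of_ne r h4.symm h6 h5,
        h.unique_iff b s k h6.symm h5.symm h4.symm]
    · obtain ⟨o, c, hcb, hcc, hcs⟩ := hcor a k h6.symm h5.symm h4.symm
      rw [existsUnique_isPM_comm, hcs, hcb, c.existsUnique_OP_iff hG,
        shift_of_ne r h5.symm h6.symm h4, h.unique_iff a s k h6 h4.symm h5.symm]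
  · intro k a b h4 h5 h6
    rcases eq_or_eq_or_eq h4 h5 h6 s with rfl | rfl | rfl
    · obtain ⟨o, c, hca, hcb, hcs⟩ := hcor a b h4 h5 h6
      rw [hca, hcb, shift_self]
      by_cases hu : ∃! σ, IsPM G σ ∧ σ (x a) = x b
      · rw [c.ncard_lonelyWith_PQ_of_unique hK (h0 a b h4 h5 h6 o c) (hex a b h4 h5 h6 o c) hu,
          (h.unique_iff s a b h4 h5 h6).1 hu]
      · rw [c.ncard_lonelyWith_PQ_of_not_unique hK (h0 a b h4 h5 h6 o c) (hex a b h4 h5 h6 o c) hu]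
        rw [h.unique_iff s a b h4 h5 h6] at hu
        have := h.le_two s
        omega
    · obtain ⟨o, c, hcb, hcc, hcs⟩ := hcor b k h6 h4.symm h5.symm
      rw [hcs, hcb, c.ncard_lonelyWith_OP hK, shift_of_ne r h4.symm h6 h5,
        h.ncard_eq b s k h6.symm h5.symm h4.symm]
    · obtain ⟨o, c, hcb, hcc, hcs⟩ := hcor a k h6.symm h5.symm h4.symm
      rw [lonelyWith_comm, hcs, hcb, c.ncard_lonelyWith_OP hK,
        shift_of_ne r h5.symm h6.symm h4, h.ncard_eq a s k h6 h4.symm h5.symm]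

/-- The unique matching of a lonely edge contains an edge of the triangle by `not_lonely`, and it
cannot contain two. -/
theorem numLonely_eq (h : TriangleState G x r) : numLonely G = r 0 + r 1 + r 2 := by
  have := h.klee.finite
  have hset : {e | IsLonely G e} =
      lonelyWith G (x 1) (x 2) ∪ (lonelyWith G (x 2) (x 0) ∪ lonelyWith G (x 0) (x 1)) := by
    ext e
    constructor
    · intro he
      obtain ⟨σ, ⟨hσ, a, rfl⟩, -⟩ := isLonely_iff.1 he
      have hon : ∃ i j, σ (x i) = x j := by
        by_contra hoff
        push Not at hoff
        exact h.not_lonely σ hσ hoff a he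
      obtain ⟨i, j, hij⟩ := hon
      have hne : i ≠ j := fun e => (hσ.adj (x i)).ne (by rw [hij, e])
      have key : ∀ i j, σ (x i) = x j → s(a, σ a) ∈ lonelyWith G (x i) (x j) := fun i j e =>
        ⟨he, σ, hσ, ⟨a, rfl⟩, e⟩
      have key' := key _ _ (hσ.eq_comm.1 hij)
      have key := key _ _ hij
      clear hij
      fin_cases i <;> fin_cases j <;> simp at hne key key' <;> tauto
    · rintro (he | he | he) <;> exact he.1
  have hdisj : ∀ i j k, i ≠ j → k ≠ j →  i ≠ k →
      Disjoint (lonelyWith G (x i) (x j)) (lonelyWith G (x j) (x k)) := by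
    intro i j k h1 h2 h3
    rw [Set.disjoint_left]
    rintro e ⟨he, σ, hσ, heσ, e1⟩ ⟨-, τ, hτ, heτ, e2⟩
    rw [he.eq hσ hτ heσ heτ, hτ.eq_comm, e2] at e1
    exact h3 (h.inj e1).symm
  rw [numLonely, hset, Set.ncard_union_eq _ (Set.toFinite _) (Set.toFinite _),
    Set.ncard_union_eq (hdisj 2 0 1 (by decide) (by decide) (by decide)) (Set.toFinite _)
      (Set.toFinite _),
    h.ncard_eq 0 1 2 (by decide) (by decide) (by decide),
    h.ncard_eq 1 2 0 (by decide) (by decide) (by decide),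
    h.ncard_eq 2 0 1 (by decide) (by decide) (by decide)]
  · omega
  · rw [Set.disjoint_union_right]
    exact ⟨hdisj 1 2 0 (by decide) (by decide) (by decide),
      (hdisj 0 1 2 (by decide) (by decide) (by decide)).symm⟩

end TriangleState

end LonelyEdge
namespace LonelyEdge

/-! ### The prism and the extension patterns -/

set_option maxRecDepth 10000 in
theorem isPM_top_cases {σ : Fin 4 → Fin 4} (h : IsPM ⊤ σ) :
    σ = ![1, 0, 3, 2] ∨ σ = ![2, 3, 0, 1] ∨ σ = ![3, 2, 1, 0] := by
  have h1 : ∀ a, σ a ≠ a ∧ σ (σ a) = a := fun a => ⟨(h.adj a).ne', h.invol a⟩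
  have h2 : ∀ a b c d : Fin 4, (∀ i, ![a, b, c, d] i ≠ i ∧ ![a, b, c, d] (![a, b, c, d] i) = i) →
      ![a, b, c, d] = ![1, 0, 3, 2] ∨ ![a, b, c, d] = ![2, 3, 0, 1] ∨
        ![a, b, c, d] = ![3, 2, 1, 0] := by
    decide
  have h3 : σ = ![σ 0, σ 1, σ 2, σ 3] := by
    ext i
    fin_cases i <;> rfl
  rw [h3] at h1 ⊢
  exact h2 _ _ _ _ h1

theorem eq_of_isPM_top {σ τ : Fin 4 → Fin 4} (hσ : IsPM ⊤ σ) (hτ : IsPM ⊤ τ) {a : Fin 4}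
    (h : σ a = τ a) : σ = τ := by
  rcases isPM_top_cases hσ with rfl | rfl | rfl <;> rcases isPM_top_cases hτ with rfl | rfl | rfl <;>
    revert a <;> decide

theorem klee_top : Klee (⊤ : SimpleGraph (Fin 4)) := .base SimpleGraph.Iso.refl

theorem existsUnique_isPM_top {a b : Fin 4} (hab : a ≠ b) : ∃! σ, IsPM ⊤ σ ∧ σ a = b := by
  obtain ⟨σ, hσ, e⟩ := klee_top.exists_isPM a b hab
  exact ⟨σ, ⟨hσ, e⟩, fun τ hτ => eq_of_isPM_top hτ.1 hσ (hτ.2.trans e.symm)⟩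

theorem ncard_lonelyWith_top {a b : Fin 4} (hab : a ≠ b) : (lonelyWith ⊤ a b).ncard = 2 := by
  obtain ⟨σ, hσ, e⟩ := klee_top.exists_isPM a b hab
  have h : lonelyWith ⊤ a b =
      (({s(0, σ 0), s(1, σ 1), s(2, σ 2), s(3, σ 3)} : Finset (Sym2 (Fin 4))) : Set (Sym2 (Fin 4))) := by
    ext f
    constructor
    · intro hf
      obtain ⟨c, τ, rfl, hτ, e2, -⟩ := exists_of_mem_lonelyWith hf
      rw [eq_of_isPM_top hτ hσ (e2.trans e.symm)]
      fin_cases c <;> simp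
    · have key : ∀ c, s(c, σ c) ∈ lonelyWith ⊤ a b := fun c =>
        mem_lonelyWith.2 ⟨σ, hσ, e, rfl, fun τ hτ h => eq_of_isPM_top hτ hσ h⟩
      simp only [Finset.coe_insert, Finset.coe_singleton]
      rintro (rfl | rfl | rfl | rfl) <;> exact key _
  rw [h, Set.ncard_coe_finset]
  rcases isPM_top_cases hσ with rfl | rfl | rfl <;> rfl

/-- Each edge of `K₄` is in exactly one perfect matching, so both edges of each matching are lonely.
Matchings through an edge of the new triangle are lifts of these, which gives the count 2. -/
theorem triangleState_prism {x : Fin 3 → ExpandVert (⊤ : SimpleGraph (Fin 4)) 3}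
    (hx : LabelsNewTriangle x) : TriangleState prism x fun _ => 2 := by
  obtain ⟨hinj, hinr⟩ := hx
  choose y hy using hinr
  have hyinj : ∀ i j, i ≠ j → (y i).1 ≠ (y j).1 := fun i j hij e =>
    hij (hinj (by rw [hy, hy, Subtype.ext e]))
  have hcor : ∀ k i j, k ≠ i → k ≠ j → i ≠ j →
      ∃ c : IsCorner (⊤ : SimpleGraph (Fin 4)) 3 (y k).1 (y j).1 (y i).1, x i = c.O ∧ x j = c.Q := by
    intro k i j h1 h2 h3
    have h4 : ∀ a b c d : Fin 4, a ≠ d → b ≠ d → c ≠ d → a ≠ b → a ≠ c → b ≠ c → ∀ e,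
      d ≠ e ↔ e = a ∨ e = b ∨ e = c := by decide
    exact ⟨⟨hyinj k j h2, hyinj k i h1, hyinj j i h3.symm, h4 _ _ _ _ (nbr_ne _) (nbr_ne _)
      (nbr_ne _) (hyinj k j h2) (hyinj k i h1) (hyinj j i h3.symm), hyinj k j h2⟩, hy i, hy j⟩
  have hadj : ∀ a b, a ≠ b → prism.Adj (x a) (x b) := by
    intro a b hab
    rw [hy, hy, prism, expand_adj_inr_inr]
    exact fun e => hyinj a b hab (congrArg Subtype.val e)
  refine ⟨klee_top.expand 3, hinj, hadj, ?_, ?_, fun _ => le_rfl, ?_, ?_⟩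
  · obtain ⟨μ, hμ⟩ := klee_top.exists_isMatchOff 3
    exact ⟨_, hμ.lift3, fun a b => by rw [hy, hy, lift3_inr]; simp⟩
  · intro ρ hρ hoff
    obtain ⟨c, hc1, hc2⟩ := hcor 0 1 2 (by decide) (by decide) (by decide)
    rcases hρ.eq_lift_or isCubic_top with ⟨σ, hσ, rfl⟩ | ⟨μ, hμ, rfl, -⟩
    · exfalso
      have hc0 : x 0 = c.P := hy 0
      rcases c.isPM_cases hσ with e | e | e
      · exact hoff 1 2 (by rw [hc1, hc2]; exact (c.symm.lift_O isCubic_top hσ).2 e)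
      · exact hoff 1 0 (by rw [hc1, hc0]; exact (c.lift_O isCubic_top hσ).2 e)
      · exact hoff 0 2 (by rw [hc0, hc2]; exact (c.lift_P isCubic_top hσ).2 e)
    · exact c.not_isLonely_of_lift3 klee_top hμ
  · intro k i j h1 h2 h3
    obtain ⟨c, hc1, hc2⟩ := hcor k i j h1 h2 h3
    rw [hc1, hc2]
    exact iff_of_true ((c.symm.existsUnique_OP_iff isCubic_top).2
      (existsUnique_isPM_top c.adj_p.ne)) rfl
  · intro k i j h1 h2 h3
    obtain ⟨c, hc1, hc2⟩ := hcor k i j h1 h2 h3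
    rw [hc1, hc2]
    exact (c.symm.ncard_lonelyWith_OP klee_top).trans (ncard_lonelyWith_top c.adj_p.ne)

theorem IsExtension.exists_state {W : Type*} {H : SimpleGraph W} (p : List (Fin 3)) :
    ∀ {V : Type} {G : SimpleGraph V} {x : Fin 3 → V} {r : Fin 3 → ℕ}, TriangleState G x r →
      IsExtension G x p H → ∃ (U : Type) (K : SimpleGraph U) (y : Fin 3 → U),
        Nonempty (H ≃g K) ∧ TriangleState K y (p.foldl (fun r s => shift s r) r) := by
  induction p with
  | nil => exact fun h1 h2 => ⟨_, _, _, h2, h1⟩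
  | cons s p ih =>
    rintro V G x r h1 ⟨x', hx', h2⟩
    exact ih (h1.shift hx') h2

/-- The total number of lonely edges of an extended prism with pattern `p`. -/
def patternCount (p : List (Fin 3)) : ℕ :=
  let r := p.foldl (fun r s => shift s r) fun _ => 2
  r 0 + r 1 + r 2

theorem IsExtendedPrism.inU3_iff {W : Type*} [Finite W] {H : SimpleGraph W} {p : List (Fin 3)}
    (h : IsExtendedPrism H p) : InU3 H ↔ patternCount p = 3 := by
  obtain ⟨x, hx, hH⟩ := h
  obtain ⟨U, K, y, ⟨φ⟩, hK⟩ := hH.exists_state p (triangleState_prism hx)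
  rw [inU3_congr φ, hK.klee.inU3_iff, hK.numLonely_eq, patternCount]

/-- Permuting the labels of the starting triangle permutes the indices of the pattern, so patterns
matter only up to such a permutation. -/
theorem IsExtension.relabel {W : Type*} {H : SimpleGraph W} {π : Fin 3 → Fin 3}
    (hπ : Function.Injective π) (p : List (Fin 3)) :
    ∀ {V : Type} {G : SimpleGraph V} {x : Fin 3 → V},
      IsExtension G x (p.map π) H → IsExtension G (x ∘ π) p H := by
  induction p with
  | nil => exact fun h => h
  | cons s p ih =>
    rintro V G x ⟨x', ⟨⟨h1, h2⟩, h3⟩, h4⟩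
    exact ⟨x' ∘ π, ⟨⟨h1.comp hπ, fun i => h2 (π i)⟩, fun j hj => h3 (π j) (hπ.ne hj)⟩, ih h4⟩

theorem IsExtendedPrism.relabel {W : Type*} {H : SimpleGraph W} {π : Fin 3 → Fin 3}
    (hπ : Function.Injective π) {p : List (Fin 3)} (h : IsExtendedPrism H (p.map π)) :
    IsExtendedPrism H p := by
  obtain ⟨x, ⟨h1, h2⟩, h3⟩ := h
  exact ⟨x ∘ π, ⟨h1.comp hπ, fun i => h2 (π i)⟩, h3.relabel hπ p⟩

end LonelyEdge
namespace LonelyEdge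

/-! ### Towers are extended prisms -/

/-- As `IsExtension`, with the labelling of the last triangle recorded. -/
def IsLabelledExtension {W : Type} (H : SimpleGraph W) (y : Fin 3 → W) :
    ∀ {V : Type}, SimpleGraph V → (Fin 3 → V) → List (Fin 3) → Prop
  | _, G, x, [] => ∃ φ : H ≃g G, φ ∘ y = x
  | _, G, x, s :: p => ∃ x' : Fin 3 → ExpandVert G (x s),
      IsRelabelling G x s x' ∧ IsLabelledExtension H y (expand G (x s)) x' p

theorem IsLabelledExtension.isExtension {W : Type} {H : SimpleGraph W} {y : Fin 3 → W}
    (p : List (Fin 3)) : ∀ {V : Type} {G : SimpleGraph V} {x : Fin 3 → V},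
      IsLabelledExtension H y G x p → IsExtension G x p H := by
  induction p with
  | nil => exact fun ⟨φ, _⟩ => ⟨φ⟩
  | cons s p ih => exact fun ⟨x', h1, h2⟩ => ⟨x', h1, ih h2⟩

theorem IsLabelledExtension.congr {W U : Type} {H : SimpleGraph W} {K : SimpleGraph U}
    (φ : K ≃g H) {y : Fin 3 → U} (p : List (Fin 3)) :
    ∀ {V : Type} {G : SimpleGraph V} {x : Fin 3 → V},
      IsLabelledExtension H (φ ∘ y) G x p → IsLabelledExtension K y G x p := by
  induction p with
  | nil => exact fun ⟨ψ, h⟩ => ⟨φ.trans ψ, h⟩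
  | cons s p ih => exact fun ⟨x', h1, h2⟩ => ⟨x', h1, ih h2⟩

/-- Towers grow at their last triangle while extensions are defined by recursion from the first
step; this appends a step at the end. -/
theorem IsLabelledExtension.snoc {W : Type} {H : SimpleGraph W} {y : Fin 3 → W} {s : Fin 3}
    {y' : Fin 3 → ExpandVert H (y s)} (hy : IsRelabelling H y s y') (p : List (Fin 3)) :
    ∀ {V : Type} {G : SimpleGraph V} {x : Fin 3 → V},
      IsLabelledExtension H y G x p → IsLabelledExtension (expand H (y s)) y' G x (p ++ [s]) := by
  induction p with
  | nil =>
    rintro V G x ⟨φ, rfl⟩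
    obtain ⟨⟨h1, h2⟩, h3⟩ := hy
    refine ⟨expandIso φ (y s) ∘ y', ⟨⟨(expandIso φ (y s)).injective.comp h1, fun i => ?_⟩,
      fun j hj => ?_⟩, expandIso φ (y s), rfl⟩
    · obtain ⟨z, hz⟩ := h2 i
      exact ⟨_, (congrArg (expandIso φ (y s)) hz).trans (expandIso_inr ..)⟩
    · obtain ⟨h4, h5⟩ := h3 j hj
      refine ⟨φ.injective.ne h4, ?_⟩
      have := (expandIso φ (y s)).map_adj_iff.2 h5
      rwa [expandIso_inl] at this
  | cons t p ih => exact fun ⟨x', h1, h2⟩ => ⟨x', h1, ih h2⟩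

theorem LabelsNewTriangle.congr {V W : Type*} {G : SimpleGraph V} {H : SimpleGraph W} (φ : G ≃g H)
    {u : V} {x : Fin 3 → ExpandVert G u} (h : LabelsNewTriangle x) :
    LabelsNewTriangle (expandIso φ u ∘ x) := by
  refine ⟨(expandIso φ u).injective.comp h.1, fun i => ?_⟩
  obtain ⟨z, hz⟩ := h.2 i
  exact ⟨_, by rw [Function.comp_apply, hz, expandIso_inr]⟩

theorem IsCubic.exists_labelsNewTriangle {V : Type*} {G : SimpleGraph V} (hG : IsCubic G) (v : V) :
    ∃ x : Fin 3 → ExpandVert G v, LabelsNewTriangle x := by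
  obtain ⟨p, q, r, h1, h2, h3, h4⟩ := hG.exists_nbrs v
  refine ⟨![Sum.inr ⟨p, by simp [h4]⟩, Sum.inr ⟨q, by simp [h4]⟩, Sum.inr ⟨r, by simp [h4]⟩],
    ?_, ?_⟩
  · intro i j
    fin_cases i <;> fin_cases j <;> simp [h1, h2, h3, h1.symm, h2.symm, h3.symm]
  · intro i
    fin_cases i
    exacts [⟨_, rfl⟩, ⟨_, rfl⟩, ⟨_, rfl⟩]

theorem LabelsNewTriangle.surj {V : Type*} {G : SimpleGraph V} {v : V} (hG : IsCubic G)
    {x : Fin 3 → ExpandVert G v} (h : LabelsNewTriangle x) (z : G.neighborSet v) :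
    ∃ i, x i = Sum.inr z := by
  obtain ⟨hinj, hinr⟩ := h
  choose y hy using hinr
  have hyinj : Function.Injective y := fun i j e => hinj (by rw [hy, hy, e])
  have hcard : Nat.card (G.neighborSet v) = 3 := hG v
  have : Finite (G.neighborSet v) := Nat.finite_of_card_ne_zero (by omega)
  obtain ⟨i, rfl⟩ := ((Nat.bijective_iff_injective_and_card y).2 ⟨hyinj, by simp [hcard]⟩).2 z
  exact ⟨i, hy i⟩

/-- Each step of a tower expands a vertex of the newest triangle, and the label of that vertex is
the next index. -/
theorem IsTower.exists_labelledExtension {V : Type} {K : SimpleGraph V} {z : V} (h : IsTower K z) :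
    ∃ (p : List (Fin 3)) (x : Fin 3 → ExpandVert (⊤ : SimpleGraph (Fin 4)) 3)
      (y : Fin 3 → ExpandVert K z), LabelsNewTriangle x ∧ LabelsNewTriangle y ∧
        IsLabelledExtension (expand K z) y prism x p := by
  induction h with
  | @base V K e z =>
    obtain ⟨y, hy⟩ := (Klee.base e).isCubic.exists_labelsNewTriangle z
    obtain ⟨θ, hθ⟩ : ∃ θ : K ≃g (⊤ : SimpleGraph (Fin 4)), 3 = θ z :=
      ⟨e.trans (SimpleGraph.Iso.completeGraph (Equiv.swap (e z) 3)), by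
        exact (Equiv.swap_apply_left _ _).symm⟩
    obtain ⟨F, hF⟩ : ∃ F : expand K z ≃g prism, LabelsNewTriangle (v := (3 : Fin 4)) (F ∘ y) := by
      rw [prism, hθ]
      exact ⟨expandIso θ z, hy.congr θ⟩
    exact ⟨[], F ∘ y, y, hF, hy, F, rfl⟩
  | @step V W K H u y0 z e hT hz ih =>
    obtain ⟨p, x, y, hx, hy, hp⟩ := ih
    have hH := hT.klee.isCubic
    obtain ⟨s, hs⟩ := hy.surj hH y0
    have hadj : ∀ i j, i ≠ j → (expand H u).Adj (y i) (y j) := by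
      intro a b hab
      obtain ⟨c, hc⟩ := hy.2 a
      obtain ⟨d, hd⟩ := hy.2 b
      rw [hc, hd, expand_adj_inr_inr]
      rintro rfl
      exact hab (hy.1 (hc.trans hd.symm))
    obtain ⟨y', hy'⟩ := exists_isRelabelling (hH.expand u) hy.1 hadj s
    have hez : e.symm (y s) = z := by rw [hs, ← hz, e.symm_apply_apply]
    obtain ⟨F, hF⟩ : ∃ F : expand K z ≃g expand (expand H u) (y s),
        LabelsNewTriangle (F.symm ∘ y') := by
      rw [← hez]
      exact ⟨(expandIso e.symm (y s)).symm, hy'.1.congr e.symm⟩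
    refine ⟨p ++ [s], x, F.symm ∘ y', hx, hF, IsLabelledExtension.congr F _ ?_⟩
    have : F ∘ F.symm ∘ y' = y' := by
      funext i
      simp
    rw [this]
    exact hp.snoc hy' p

theorem IsTower.isExtendedPrism {V : Type} {K : SimpleGraph V} {z : V} (h : IsTower K z) :
    ∃ p, IsExtendedPrism (expand K z) p := by
  obtain ⟨p, x, y, hx, -, hp⟩ := h.exists_labelledExtension
  exact ⟨p, x, hx, hp.isExtension⟩

/-! ### The patterns with three lonely edges -/

def patternState (p : List (Fin 3)) : Fin 3 → ℕ := p.foldl (fun r s => shift s r) fun _ => 2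

theorem patternState_append_singleton (p : List (Fin 3)) (s : Fin 3) :
    patternState (p ++ [s]) = shift s (patternState p) := by
  simp [patternState]

theorem patternCount_eq (p : List (Fin 3)) :
    patternCount p = patternState p 0 + patternState p 1 + patternState p 2 := rfl

theorem sum_eq_sum {s t u : Fin 3} (h1 : s ≠ t) (h2 : s ≠ u) (h3 : t ≠ u) (r : Fin 3 → ℕ) :
    r 0 + r 1 + r 2 = r s + r t + r u := by
  fin_cases s <;> fin_cases t <;> fin_cases u <;> simp at h1 h2 h3 ⊢ <;> omega

/-- Once the total has dropped below three it stays there, which makes `PatternShape.small`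
absorbing. -/
theorem sum_shift_le (s : Fin 3) (r : Fin 3 → ℕ) :
    shift s r 0 + shift s r 1 + shift s r 2 ≤ r 0 + r 1 + r 2 := by
  obtain ⟨t, u, h1, h2, h3⟩ := exists_others s
  rw [sum_eq_sum h1 h2 h3, sum_eq_sum h1 h2 h3, shift_self, shift_of_ne r h1 h2 h3,
    shift_of_ne r h2 h1 h3.symm]
  omega

/-- The patterns with at least three lonely edges, together with the resulting counts. -/
inductive PatternShape : List (Fin 3) → (Fin 3 → ℕ) → Prop
  | small {p r} (h : r 0 + r 1 + r 2 ≤ 2) : PatternShape p r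
  | nil : PatternShape [] fun _ => 2
  -- The subtraction is truncated: the repeated index has count 1 after one step and 0 from the
  -- second step on.
  | rep {s t u r} (h1 : s ≠ t) (h2 : s ≠ u) (h3 : t ≠ u) (a : ℕ) (hs : r s = 1 - a) (ht : r t = 2)
      (hu : r u = 2) : PatternShape (List.replicate (a + 1) s) r
  | two {s t u r} (h1 : s ≠ t) (h2 : s ≠ u) (h3 : t ≠ u) (hs : r s = 2) (ht : r t = 1)
      (hu : r u = 1) : PatternShape [s, t] r
  | sts {s t u r} (h1 : s ≠ t) (h2 : s ≠ u) (h3 : t ≠ u) (hs : r s = 1) (ht : r t = 1)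
      (hu : r u = 1) : PatternShape [s, t, s] r
  | stu {s t u r} (h1 : s ≠ t) (h2 : s ≠ u) (h3 : t ≠ u) (a b : ℕ) (hab : 1 ≤ a + b)
      (hu : r u = 0) (hst : r s = 1 ∧ r t = 2 ∨ r s = 2 ∧ r t = 1) :
      PatternShape (List.replicate (a + 1) s ++ [t] ++ List.replicate b u) r
  | stt {s t u r} (h1 : s ≠ t) (h2 : s ≠ u) (h3 : t ≠ u) (b : ℕ) (ht : r t = 0)
      (hsu : r s = 1 ∧ r u = 2 ∨ r s = 2 ∧ r u = 1) :
      PatternShape (s :: List.replicate (b + 2) t) r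

/-- From a total of three, every next index with a positive count leads to `small`. So `sts` has no
good continuation, and `stu` and `stt` continue only with the index whose count is zero, which
exchanges the other two counts. -/
theorem PatternShape.shift {p : List (Fin 3)} {r : Fin 3 → ℕ} (h : PatternShape p r) (c : Fin 3) :
    PatternShape (p ++ [c]) (shift c r) := by
  cases h with
  | small h => exact .small ((sum_shift_le c r).trans h)
  | nil =>
    obtain ⟨t, u, h1, h2, h3⟩ := exists_others c
    exact .rep h1 h2 h3 0 (by rw [shift_self]) (by rw [shift_of_ne _ h1 h2 h3])
      (by rw [shift_of_ne _ h2 h1 h3.symm])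
  | @rep s t u _ h1 h2 h3 a hs ht hu =>
    rcases eq_or_eq_or_eq h1 h2 h3 c with rfl | rfl | rfl
    · rw [← List.replicate_succ']
      exact .rep h1 h2 h3 (a + 1) (by rw [shift_self]; omega) (by rw [shift_of_ne _ h1 h2 h3, hu])
        (by rw [shift_of_ne _ h2 h1 h3.symm, ht])
    · rcases a with - | a
      · exact .two h1 h2 h3 (by rw [shift_of_ne _ h1.symm h3 h2, hu]) (by rw [shift_self, ht])
          (by rw [shift_of_ne _ h3 h1.symm h2.symm, hs])
      · rw [← List.append_nil (_ ++ _)]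
        exact .stu h1 h2 h3 (a + 1) 0 (by omega)
          (by rw [shift_of_ne _ h3 h1.symm h2.symm, hs]; omega)
          (Or.inr ⟨by rw [shift_of_ne _ h1.symm h3 h2, hu], by rw [shift_self, ht]⟩)
    · rcases a with - | a
      · exact .two h2 h1 h3.symm (by rw [shift_of_ne _ h2.symm h3.symm h1, ht])
          (by rw [shift_self, hu]) (by rw [shift_of_ne _ h3.symm h2.symm h1.symm, hs])
      · rw [← List.append_nil (_ ++ _)]
        exact .stu h2 h1 h3.symm (a + 1) 0 (by omega)
          (by rw [shift_of_ne _ h3.symm h2.symm h1.symm, hs]; omega)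
          (Or.inr ⟨by rw [shift_of_ne _ h2.symm h3.symm h1, ht], by rw [shift_self, hu]⟩)
  | @two s t u _ h1 h2 h3 hs ht hu =>
    rcases eq_or_eq_or_eq h1 h2 h3 c with rfl | rfl | rfl
    · exact .sts h1 h2 h3 (by rw [shift_self, hs]) (by rw [shift_of_ne _ h1 h2 h3, hu])
        (by rw [shift_of_ne _ h2 h1 h3.symm, ht])
    · exact .stt h1 h2 h3 0 (by rw [shift_self, ht])
        (Or.inl ⟨by rw [shift_of_ne _ h1.symm h3 h2, hu],
          by rw [shift_of_ne _ h3 h1.symm h2.symm, hs]⟩)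
    · exact .stu h1 h2 h3 0 1 (by omega) (by rw [shift_self, hu])
        (Or.inl ⟨by rw [shift_of_ne _ h2.symm h3.symm h1, ht],
          by rw [shift_of_ne _ h3.symm h2.symm h1.symm, hs]⟩)
  | @sts s t u _ h1 h2 h3 hs ht hu =>
    refine .small ?_
    obtain ⟨i, j, h4, h5, h6⟩ := exists_others c
    have key : ∀ k, r k = 1 := by
      intro k
      rcases eq_or_eq_or_eq h1 h2 h3 k with rfl | rfl | rfl <;> assumption
    rw [sum_eq_sum h4 h5 h6, shift_self, shift_of_ne r h4 h5 h6, shift_of_ne r h5 h4 h6.symm]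
    simp [key]
  | @stu s t u _ h1 h2 h3 a b hab hu hst =>
    rcases eq_or_eq_or_eq h1 h2 h3 c with rfl | rfl | rfl
    · refine .small ?_
      rw [sum_eq_sum h1 h2 h3, shift_self, shift_of_ne r h1 h2 h3, shift_of_ne r h2 h1 h3.symm]
      omega
    · refine .small ?_
      rw [sum_eq_sum h1.symm h3 h2, shift_self, shift_of_ne r h1.symm h3 h2,
        shift_of_ne r h3 h1.symm h2.symm]
      omega
    · rw [List.append_assoc, ← List.replicate_succ']
      refine .stu h1 h2 h3 a (b + 1) (by omega) (by rw [shift_self, hu]) ?_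
      rw [shift_of_ne r h2.symm h3.symm h1, shift_of_ne r h3.symm h2.symm h1.symm]
      omega
  | @stt s t u _ h1 h2 h3 b ht hsu =>
    rcases eq_or_eq_or_eq h1 h2 h3 c with rfl | rfl | rfl
    · refine .small ?_
      rw [sum_eq_sum h1 h2 h3, shift_self, shift_of_ne r h1 h2 h3, shift_of_ne r h2 h1 h3.symm]
      omega
    · rw [List.cons_append, ← List.replicate_succ']
      refine .stt h1 h2 h3 (b + 1) (by rw [shift_self, ht]) ?_
      rw [shift_of_ne r h1.symm h3 h2, shift_of_ne r h3 h1.symm h2.symm]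
      omega
    · refine .small ?_
      rw [sum_eq_sum h2.symm h3.symm h1, shift_self, shift_of_ne r h2.symm h3.symm h1,
        shift_of_ne r h3.symm h2.symm h1.symm]
      omega

theorem patternShape_patternState (p : List (Fin 3)) : PatternShape p (patternState p) := by
  induction p using List.reverseRecOn with
  | nil => exact .nil
  | append_singleton p c ih =>
    rw [patternState_append_singleton]
    exact ih.shift c

/-- Only the shapes `sts`, `stu` and `stt` have total three. In each case `π` lists the indices to
which 1, 2 and 3 are sent. -/
theorem exists_relabelling_of_patternCount_eq_three {p : List (Fin 3)} (h : patternCount p = 3) :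
    ∃ π : Fin 3 → Fin 3, Function.Injective π ∧ (p = [i3, i1, i3].map π ∨
      ∃ k h : ℕ, 3 ≤ k ∧ 1 ≤ h ∧ h ≤ k ∧
        p = (List.replicate (h - 1) i3 ++ [i2] ++ List.replicate (k - h) i1).map π) := by
  rw [patternCount_eq] at h
  have hinj : ∀ s t u : Fin 3, s ≠ t → s ≠ u → t ≠ u → Function.Injective ![u, t, s] := by
    intro s t u h1 h2 h3 i j
    fin_cases i <;> fin_cases j <;> simp [h1, h2, h3, h1.symm, h2.symm, h3.symm]
  have hp := patternShape_patternState p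
  generalize patternState p = r at h hp
  cases hp with
  | small h' => omega
  | nil => simp at h
  | rep h1 h2 h3 a hs ht hu =>
    rw [sum_eq_sum h1 h2 h3] at h
    omega
  | two h1 h2 h3 hs ht hu =>
    rw [sum_eq_sum h1 h2 h3] at h
    omega
  | @sts s t u _ h1 h2 h3 hs ht hu => exact ⟨![t, u, s], hinj _ _ _ h2 h1 h3.symm, Or.inl rfl⟩
  | @stu s t u _ h1 h2 h3 a b hab hu hst =>
    -- There are `a + 1 = h - 1` threes and `b = k - h` ones.
    refine ⟨![u, t, s], hinj _ _ _ h1 h2 h3, Or.inr ⟨a + b + 2, a + 2, by omega, by omega, by omega,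
      ?_⟩⟩
    have : a + b + 2 - (a + 2) = b := by omega
    simp [this]
    rfl
  | @stt s t u _ h1 h2 h3 b ht hsu =>
    -- No threes here: the pattern is a single 2 followed by `b + 2 = k - 1` ones.
    refine ⟨![t, s, u], hinj _ _ _ h2.symm h3.symm h1, Or.inr ⟨b + 3, 1, by omega, by omega,
      by omega, ?_⟩⟩
    simp

/-- With a zero at index 0, a further extension of that index only exchanges the other two counts.
-/
theorem foldl_shift_replicate_zero {r : Fin 3 → ℕ} (n : ℕ)
    (h : r 0 = 0 ∧ (r 1 = 1 ∧ r 2 = 2 ∨ r 1 = 2 ∧ r 2 = 1)) :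
    let r' := (List.replicate n 0).foldl (fun r s => shift s r) r
    r' 0 = 0 ∧ (r' 1 = 1 ∧ r' 2 = 2 ∨ r' 1 = 2 ∧ r' 2 = 1) := by
  induction n generalizing r with
  | zero => exact h
  | succ n ih =>
    have h0 : shift 0 r 0 = 0 := by rw [shift_self, h.1]
    have h1 : shift 0 r 1 = r 2 := shift_of_ne r (by decide) (by decide) (by decide)
    have h2 : shift 0 r 2 = r 1 := shift_of_ne r (by decide) (by decide) (by decide)
    exact ih (r := shift 0 r) ⟨h0, by rw [h1, h2]; tauto⟩

theorem patternState_replicate_two (n : ℕ) :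
    patternState (List.replicate (n + 2) 2) = ![2, 2, 0] := by
  induction n with
  | zero => decide
  | succ n ih =>
    rw [List.replicate_succ', patternState_append_singleton, ih]
    decide

theorem patternCount_family {k h : ℕ} (hk : 3 ≤ k) (h1 : 1 ≤ h) (hkh : h ≤ k) :
    patternCount (List.replicate (h - 1) i3 ++ [i2] ++ List.replicate (k - h) i1) = 3 := by
  have key : ∀ (q : List (Fin 3)) (n : ℕ), patternState q 0 = 0 ∧
      (patternState q 1 = 1 ∧ patternState q 2 = 2 ∨ patternState q 1 = 2 ∧ patternState q 2 = 1) →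
      patternCount (q ++ List.replicate n 0) = 3 := by
    intro q n hq
    have := foldl_shift_replicate_zero n hq
    rw [patternCount_eq]
    simp only [patternState, List.foldl_append] at this ⊢
    omega
  obtain ⟨h, rfl⟩ := Nat.exists_eq_add_of_le' h1
  obtain ⟨m, rfl⟩ := Nat.exists_eq_add_of_le hkh
  have e1 : h + 1 - 1 = h := by omega
  have e2 : h + 1 + m - (h + 1) = m := by omega
  rw [e1, e2]
  -- The count at index 1 must first drop to zero. With no three in front this takes two ones after
  -- the 2, with a single three it takes one, and otherwise none; `k ≥ 3` supplies them.
  rcases h with - | - | h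
  · obtain ⟨m, rfl⟩ : ∃ n, m = n + 2 := ⟨m - 2, by omega⟩
    exact key [1, 0, 0] m (by decide)
  · obtain ⟨m, rfl⟩ : ∃ n, m = n + 1 := ⟨m - 1, by omega⟩
    exact key [2, 1, 0] m (by decide)
  · refine key _ m ?_
    rw [patternState_append_singleton, patternState_replicate_two]
    decide

end LonelyEdge
namespace LonelyEdge

/-! ### Graphs given by lists of neighbours -/

/-- If a lonely edge `ab` belongs to a matching of `G - N[v]`, then in the expansion it lies in a
lift and in a `lift3`. It is lost, and the other lonely edges cannot become more. -/
theorem Klee.numLonely_expand_lt {V : Type} {G : SimpleGraph V} (hG : Klee G) {v a b : V}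
    (hab : IsLonely G s(a, b)) {μ : V → V} (hμ : IsMatchOff G (closedNbhd G v) μ)
    (ha : a ∉ closedNbhd G v) (e : μ a = b) :
    numLonely (LonelyEdge.expand G v) < numLonely G := by
  have := hG.finite
  have hc := hG.isCubic
  refine lt_of_le_of_lt (b := ({e | IsLonely G e} \ {s(a, b)}).ncard) ?_
    (Set.ncard_sdiff_singleton_lt_of_mem hab)
  refine ncard_le_of_rel (EdgeRel G v) (fun e' he' => ?_) fun _ _ _ => EdgeRel.eq hc
  obtain ⟨f, hf, hr⟩ := hG.exists_edgeRel he'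
  refine ⟨f, ⟨hf, ?_⟩, hr⟩
  rintro rfl
  simp only [closedNbhd, Set.mem_ofPred_eq, not_or] at ha
  rcases hr with ⟨a', b', h1, rfl⟩ | ⟨x, y, z, -, -, -, h1, -⟩
  · obtain ⟨σ, ⟨hσ, hσe⟩, -⟩ := isLonely_iff.1 hf
    have key : σ a'.1 = b'.1 ∧ μ a'.1 = b'.1 ∧ ¬ G.Adj v a'.1 := by
      obtain ⟨h2, h3, h4⟩ := hμ a (by simpa [closedNbhd] using ha)
      simp only [closedNbhd, Set.mem_ofPred_eq, not_or, e] at h2 h4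
      rw [hσ.hasEdge_iff] at hσe
      rcases Sym2.eq_iff.1 h1 with ⟨rfl, rfl⟩ | ⟨rfl, rfl⟩
      · exact ⟨hσe, e, ha.2⟩
      · exact ⟨hσ.eq_comm.1 hσe, h4, h2.2⟩
    exact not_isLonely_of_ne (hσ.lift hc) hμ.lift3 ((lift_inl_eq_inl hσ).2 key.1)
      ((lift3_inl_eq_inl hμ).2 ⟨key.2.2, key.2.1⟩) (lift_ne_lift3 hc) he'
  · obtain ⟨h2, -, -⟩ := hμ a (by simpa [closedNbhd] using ha)
    simp only [closedNbhd, Set.mem_ofPred_eq, not_or, e] at h2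
    rcases Sym2.eq_iff.1 h1 with ⟨h, -⟩ | ⟨-, h⟩
    · exact ha.1 h
    · exact h2.1 h

section
variable {n : ℕ}

/-- Extend partial matchings, given as lists of pairs, by an edge at `v`. -/
def extendAt (l : Fin n → List (Fin n)) (L : List (List (Fin n × Fin n))) (v : Fin n) :
    List (List (Fin n × Fin n)) :=
  L.flatMap fun M => if M.any (fun p => p.1 == v) then [M] else
    (l v).flatMap fun w => if M.any (fun p => p.1 == w && p.2 != v) then [] else
      [(v, w) :: (w, v) :: M]

/-- The invariant of the search: some listed partial matching is always contained in `σ`. -/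
theorem exists_mem_extendAt {l : Fin n → List (Fin n)} {G : SimpleGraph (Fin n)}
    (hl : ∀ a b, G.Adj a b ↔ b ∈ l a) {σ : Fin n → Fin n} (hσ : IsPM G σ)
    {L : List (List (Fin n × Fin n))} (hL : ∃ M ∈ L, ∀ p ∈ M, σ p.1 = p.2) (v : Fin n) :
    ∃ M ∈ extendAt l L v, ∀ p ∈ M, σ p.1 = p.2 := by
  obtain ⟨M, hM, hMσ⟩ := hL
  by_cases hv : M.any (fun p => p.1 == v)
  · exact ⟨M, List.mem_flatMap.2 ⟨M, hM, by simp [hv]⟩, hMσ⟩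
  · refine ⟨(v, σ v) :: (σ v, v) :: M, List.mem_flatMap.2 ⟨M, hM, ?_⟩, ?_⟩
    · rw [if_neg hv, List.mem_flatMap]
      refine ⟨σ v, (hl _ _).1 (hσ.adj v), ?_⟩
      rw [if_neg]
      · exact List.mem_singleton.2 rfl
      · simp only [List.any_eq_true, Bool.and_eq_true, beq_iff_eq, bne_iff_ne, not_exists, not_and,
          not_not]
        rintro p hp e
        rw [← hMσ p hp, e, hσ.invol]
    · simp only [List.mem_cons]
      rintro p (rfl | rfl | hp)
      · rfl
      · exact hσ.invol v
      · exact hMσ p hp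

theorem exists_mem_foldl_extendAt {l : Fin n → List (Fin n)} {G : SimpleGraph (Fin n)}
    (hl : ∀ a b, G.Adj a b ↔ b ∈ l a) {σ : Fin n → Fin n} (hσ : IsPM G σ) (vs : List (Fin n)) :
    ∀ {L : List (List (Fin n × Fin n))}, (∃ M ∈ L, ∀ p ∈ M, σ p.1 = p.2) →
    ∃ M ∈ vs.foldl (extendAt l) L, ∀ p ∈ M, σ p.1 = p.2 := by
  induction vs with
  | nil => exact fun h => h
  | cons v vs ih => exact fun h => ih (exists_mem_extendAt hl hσ h v)

/-- An exhaustive search shows that an edge is lonely. -/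
theorem isLonely_of_extendAt {l : Fin n → List (Fin n)} {G : SimpleGraph (Fin n)}
    (hl : ∀ a b, G.Adj a b ↔ b ∈ l a) {a : Fin n} (s : Fin n → Fin n)
    (hs : ∀ c, s c ∈ l c ∧ s (s c) = c)
    (h : ∀ M ∈ (List.finRange n).foldl (extendAt l) [[(a, s a)]], ∀ c, (c, s c) ∈ M) :
    IsLonely G s(a, s a) := by
  have hPM : IsPM G s := fun c => ⟨(hl _ _).2 (hs c).1, (hs c).2⟩
  refine hPM.isLonely_iff.2 fun τ hτ e => ?_
  obtain ⟨M, hM, hτM⟩ := exists_mem_foldl_extendAt hl hτ (List.finRange n)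
    (L := [[(a, s a)]]) ⟨_, List.mem_singleton.2 rfl, by simpa using e⟩
  funext c
  exact hτM _ (h M hM c)

/-- `c` places the old vertices and `d x` is the place of the triangle vertex attached to `x`. Their
values at `v` and off the neighbours of `v`, respectively, are irrelevant. All conditions are
decidable. -/
theorem nonempty_expand_iso_of_nbrs {m : ℕ} {l : Fin n → List (Fin n)} {G : SimpleGraph (Fin n)}
    (hl : ∀ a b, G.Adj a b ↔ b ∈ l a) {l' : Fin m → List (Fin m)} {H : SimpleGraph (Fin m)}
    (hl' : ∀ a b, H.Adj a b ↔ b ∈ l' a) (hG : Klee G) (hH : IsCubic H) (hm : m = n + 2)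
    (v : Fin n) (c d : Fin n → Fin m)
    (hinj1 : ∀ a, a ≠ v → ∀ b, b ≠ v → c a = c b → a = b) (hinj2 : ∀ a, a ≠ v → ∀ x ∈ l v, c a ≠ d x)
    (hinj3 : ∀ x ∈ l v, ∀ y ∈ l v, d x = d y → x = y)
    (hadj1 : ∀ a, a ≠ v → ∀ b ∈ l a, b ≠ v → c b ∈ l' (c a))
    (hadj2 : ∀ x ∈ l v, c x ∈ l' (d x) ∧ d x ∈ l' (c x))
    (hadj3 : ∀ x ∈ l v, ∀ y ∈ l v, x ≠ y → d y ∈ l' (d x)) :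
    Nonempty (expand G v ≃g H) := by
  have hmem : ∀ x : G.neighborSet v, x.1 ∈ l v := fun x => (hl _ _).1 x.2
  have hfin := (hG.expand v).finite
  obtain ⟨φ, -⟩ := (hG.isCubic.expand v).nonempty_iso hH
    (Sum.elim (fun a => c a.1) fun x => d x.1) (by
      refine (Nat.bijective_iff_injective_and_card _).2 ⟨?_, by
        rw [card_expand hG, Nat.card_eq_fintype_card, Nat.card_eq_fintype_card, Fintype.card_fin,
          Fintype.card_fin, hm]⟩
      rintro (a | x) (b | y) e
      · exact congrArg _ (Subtype.ext (hinj1 _ a.2 _ b.2 e))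
      · exact absurd e (hinj2 _ a.2 _ (hmem y))
      · exact absurd e.symm (hinj2 _ b.2 _ (hmem x))
      · exact congrArg _ (Subtype.ext (hinj3 _ (hmem x) _ (hmem y) e)))
    (by
      rintro (a | x) (b | y) h
      · exact (hl' _ _).2 (hadj1 _ a.2 _ ((hl _ _).1 h) b.2)
      · have h : a.1 = y.1 := h
        simp only [Sum.elim_inl, Sum.elim_inr, h]
        exact (hl' _ _).2 (hadj2 _ (hmem y)).2
      · have h : b.1 = x.1 := h
        simp only [Sum.elim_inl, Sum.elim_inr, h]
        exact (hl' _ _).2 (hadj2 _ (hmem x)).1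
      · exact (hl' _ _).2 (hadj3 _ (hmem x) _ (hmem y) fun e => h (Subtype.ext e)))
  exact ⟨φ⟩

/-- A table of matchings, one for each vertex outside `good`, shows that only expansions at the
vertices in `good` preserve the number of lonely edges. -/
theorem Klee.numLonely_expand_lt_of_table {l : Fin n → List (Fin n)} {G : SimpleGraph (Fin n)}
    (hl : ∀ a b, G.Adj a b ↔ b ∈ l a) (hG : Klee G) (E : List (Fin n × Fin n))
    (hE : ∀ p ∈ E, IsLonely G s(p.1, p.2)) (good : List (Fin n)) (T : Fin n → Fin n → Fin n)
    (hT1 : ∀ v, v ∉ good → ∃ p ∈ E, p.1 ≠ v ∧ p.1 ∉ l v ∧ T v p.1 = p.2)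
    (hT2 : ∀ v, v ∉ good → ∀ a, (a = v ∨ a ∈ l v) ∨
      (T v a ≠ v ∧ T v a ∉ l v) ∧ T v a ∈ l a ∧ T v (T v a) = a) (v : Fin n) (hv : v ∉ good) :
    numLonely (LonelyEdge.expand G v) < numLonely G := by
  obtain ⟨p, hp, h1, h2, h3⟩ := hT1 v hv
  refine hG.numLonely_expand_lt (hE p hp) (μ := T v) (fun a ha => ?_) ?_ h3
  · simp only [closedNbhd, Set.mem_ofPred_eq, not_or, hl] at ha ⊢
    have := hT2 v hv a
    tauto
  · simp [closedNbhd, hl, h1, h2]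

end

/-! ### The tricorn and its descendants -/

/-- The neighbours of the vertices of `tricorn`. -/
def tricornNbrs : Fin 10 → List (Fin 10) :=
  ![[1, 2, 3], [0, 4, 5], [0, 6, 7], [0, 8, 9], [1, 5, 9], [1, 4, 6], [2, 5, 7], [2, 6, 8], [3,
  7, 9], [3, 8, 4]]

theorem tricorn_adj_iff (a b : Fin 10) : tricorn.Adj a b ↔ b ∈ tricornNbrs a := tricorn_adj a b

/-- The neighbours of the vertices of `tricorn12`. -/
def tricornNbrs12 : Fin 12 → List (Fin 12) :=
  ![[1, 2, 3], [0, 10, 11], [0, 6, 7], [0, 8, 9], [10, 5, 9], [11, 4, 6], [2, 5, 7], [2, 6, 8],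
  [3, 7, 9], [3, 8, 4], [4, 11, 1], [5, 1, 10]]

/-- The tricorn with one vertex replaced by a triangle. -/
def tricorn12 : SimpleGraph (Fin 12) where
  Adj a b := b ∈ tricornNbrs12 a
  symm := ⟨by decide⟩
  loopless := ⟨by decide⟩

theorem tricorn12_adj (a b : Fin 12) : tricorn12.Adj a b ↔ b ∈ tricornNbrs12 a := Iff.rfl

/-- The neighbours of the vertices of `tricorn14`. -/
def tricornNbrs14 : Fin 14 → List (Fin 14) :=
  ![[1, 2, 3], [0, 10, 11], [0, 12, 13], [0, 8, 9], [10, 5, 9], [11, 4, 6], [12, 5, 7], [13, 6,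
  8], [3, 7, 9], [3, 8, 4], [4, 11, 1], [5, 1, 10], [6, 13, 2], [7, 2, 12]]

/-- The tricorn with two vertices replaced by a triangle. -/
def tricorn14 : SimpleGraph (Fin 14) where
  Adj a b := b ∈ tricornNbrs14 a
  symm := ⟨by decide⟩
  loopless := ⟨by decide⟩

theorem tricorn14_adj (a b : Fin 14) : tricorn14.Adj a b ↔ b ∈ tricornNbrs14 a := Iff.rfl

/-- The neighbours of the vertices of `tricorn16`. -/
def tricornNbrs16 : Fin 16 → List (Fin 16) :=
  ![[1, 2, 3], [0, 10, 11], [0, 12, 13], [0, 14, 15], [10, 5, 9], [11, 4, 6], [12, 5, 7], [13, 6,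
  8], [14, 7, 9], [15, 8, 4], [4, 11, 1], [5, 1, 10], [6, 13, 2], [7, 2, 12], [8, 15, 3], [9, 3,
  14]]

/-- The tricorn with three vertices replaced by a triangle. -/
def tricorn16 : SimpleGraph (Fin 16) where
  Adj a b := b ∈ tricornNbrs16 a
  symm := ⟨by decide⟩
  loopless := ⟨by decide⟩

theorem tricorn16_adj (a b : Fin 16) : tricorn16.Adj a b ↔ b ∈ tricornNbrs16 a := Iff.rfl

theorem klee_tricorn : Klee tricorn := by
  obtain ⟨φ⟩ := nonempty_tricorn_iso
  exact (((klee_top.expand 3).expand _).expand _).congr φ.symm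

theorem isLonely_tricorn : ∀ p ∈ [((4 : Fin 10), (5 : Fin 10)), (6, 7), (8, 9)],
    IsLonely tricorn s(p.1, p.2) := by
  simp only [List.mem_cons, List.not_mem_nil, or_false, forall_eq_or_imp, forall_eq]
  refine ⟨?_, ?_, ?_⟩
  · exact isLonely_of_extendAt tricorn_adj_iff (a := 4)
      ![1, 0, 6, 9, 5, 4, 2, 8, 7, 3] (by decide) (by decide)
  · exact isLonely_of_extendAt tricorn_adj_iff (a := 6)
      ![2, 5, 0, 8, 9, 1, 7, 6, 3, 4] (by decide) (by decide)
  · exact isLonely_of_extendAt tricorn_adj_iff (a := 8)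
      ![3, 4, 7, 0, 1, 6, 5, 2, 9, 8] (by decide) (by decide)

/-- For each vertex at which an expansion destroys a lonely edge, a matching that shows this. -/
def tricornTable : Fin 10 → Fin 10 → Fin 10 :=
  -- Row `v` is a perfect matching of the tricorn without the closed neighbourhood of `v`; entries
  -- inside that neighbourhood, and the rows of 1, 2, 3, are placeholders.
  ![![0, 0, 0, 0, 5, 4, 7, 6, 9, 8], ![0, 0, 0, 0, 0, 0, 0, 0, 0, 0], ![0, 0, 0, 0, 0, 0, 0, 0,
    0, 0], ![0, 0, 0, 0, 0, 0, 0, 0, 0, 0], ![2, 0, 0, 8, 0, 0, 7, 6, 3, 0], ![3, 0, 7, 0, 0, 0,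
    0, 2, 9, 8], ![3, 4, 0, 0, 1, 0, 0, 0, 9, 8], ![1, 0, 0, 9, 5, 4, 0, 0, 0, 3], ![1, 0, 6, 0,
    5, 4, 2, 0, 0, 0], ![2, 5, 0, 0, 0, 1, 7, 6, 0, 0]]

theorem numLonely_expand_tricorn_lt (v : Fin 10) (hv : v ∉ ([1, 2, 3] : List (Fin 10))) :
    numLonely (expand tricorn v) < numLonely tricorn :=
  klee_tricorn.numLonely_expand_lt_of_table tricorn_adj_iff _ isLonely_tricorn [1, 2, 3] tricornTable
    (by decide) (by decide) v hv

theorem isCubic_tricorn12 : IsCubic tricorn12 := isCubic_of_adj_mem _ tricorn12_adj (by decide)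

theorem nonempty_expand_tricorn_iso (v : Fin 10) (hv : v ∈ ([1, 2, 3] : List (Fin 10))) :
    Nonempty (expand tricorn v ≃g tricorn12) := by
  simp only [List.mem_cons, List.not_mem_nil, or_false] at hv
  rcases hv with rfl | rfl | rfl
  · exact nonempty_expand_iso_of_nbrs tricorn_adj_iff tricorn12_adj klee_tricorn isCubic_tricorn12 rfl 1
      ![0, 0, 2, 3, 4, 5, 6, 7, 8, 9]
      ![1, 0, 0, 0, 10, 11, 0, 0, 0, 0] (by decide) (by decide) (by decide) (by decide)
      (by decide) (by decide)
  · exact nonempty_expand_iso_of_nbrs tricorn_adj_iff tricorn12_adj klee_tricorn isCubic_tricorn12 rfl 2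
      ![0, 2, 0, 3, 7, 6, 5, 4, 9, 8]
      ![1, 0, 0, 0, 0, 0, 11, 10, 0, 0] (by decide) (by decide) (by decide) (by decide)
      (by decide) (by decide)
  · exact nonempty_expand_iso_of_nbrs tricorn_adj_iff tricorn12_adj klee_tricorn isCubic_tricorn12 rfl 3
      ![0, 2, 3, 0, 6, 7, 8, 9, 4, 5]
      ![1, 0, 0, 0, 0, 0, 0, 0, 10, 11] (by decide) (by decide) (by decide) (by decide)
      (by decide) (by decide)

theorem klee_tricorn12 : Klee tricorn12 := by
  obtain ⟨φ⟩ := nonempty_expand_tricorn_iso 1 (by decide)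
  exact (klee_tricorn.expand _).congr φ

theorem isLonely_tricorn12 : ∀ p ∈ [((4 : Fin 12), (5 : Fin 12)), (6, 7), (8, 9)],
    IsLonely tricorn12 s(p.1, p.2) := by
  simp only [List.mem_cons, List.not_mem_nil, or_false, forall_eq_or_imp, forall_eq]
  refine ⟨?_, ?_, ?_⟩
  · exact isLonely_of_extendAt tricorn12_adj (a := 4)
      ![1, 0, 6, 9, 5, 4, 2, 8, 7, 3, 11, 10] (by decide) (by decide)
  · exact isLonely_of_extendAt tricorn12_adj (a := 6)
      ![2, 10, 0, 8, 9, 11, 7, 6, 3, 4, 1, 5] (by decide) (by decide)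
  · exact isLonely_of_extendAt tricorn12_adj (a := 8)
      ![3, 11, 7, 0, 10, 6, 5, 2, 9, 8, 4, 1] (by decide) (by decide)

/-- For each vertex at which an expansion destroys a lonely edge, a matching that shows this. -/
def tricorn12Table : Fin 12 → Fin 12 → Fin 12 :=
  ![![0, 0, 0, 0, 5, 4, 7, 6, 9, 8, 11, 10], ![0, 0, 6, 9, 5, 4, 2, 8, 7, 3, 0, 0], ![0, 0, 0,
    0, 0, 0, 0, 0, 0, 0, 0, 0], ![0, 0, 0, 0, 0, 0, 0, 0, 0, 0, 0, 0], ![2, 11, 0, 8, 0, 0, 7, 6,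
    3, 0, 0, 1], ![3, 10, 7, 0, 0, 0, 0, 2, 9, 8, 1, 0], ![3, 11, 0, 0, 10, 0, 0, 0, 9, 8, 4, 1],
    ![1, 0, 0, 9, 5, 4, 0, 0, 0, 3, 11, 10], ![1, 0, 6, 0, 5, 4, 2, 0, 0, 0, 11, 10], ![2, 10, 0,
    0, 0, 11, 7, 6, 0, 0, 1, 5], ![3, 0, 7, 0, 0, 6, 5, 2, 9, 8, 0, 0], ![2, 0, 0, 8, 9, 0, 7, 6,
    3, 4, 0, 0]]

theorem numLonely_expand_tricorn12_lt (v : Fin 12) (hv : v ∉ ([2, 3] : List (Fin 12))) :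
    numLonely (expand tricorn12 v) < numLonely tricorn12 :=
  klee_tricorn12.numLonely_expand_lt_of_table tricorn12_adj _ isLonely_tricorn12 [2, 3] tricorn12Table
    (by decide) (by decide) v hv

theorem isCubic_tricorn14 : IsCubic tricorn14 := isCubic_of_adj_mem _ tricorn14_adj (by decide)

theorem nonempty_expand_tricorn12_iso (v : Fin 12) (hv : v ∈ ([2, 3] : List (Fin 12))) :
    Nonempty (expand tricorn12 v ≃g tricorn14) := by
  simp only [List.mem_cons, List.not_mem_nil, or_false] at hv
  rcases hv with rfl | rfl
  · exact nonempty_expand_iso_of_nbrs tricorn12_adj tricorn14_adj klee_tricorn12 isCubic_tricorn14 rfl 2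
      ![0, 1, 0, 3, 4, 5, 6, 7, 8, 9, 10, 11]
      ![2, 0, 0, 0, 0, 0, 12, 13, 0, 0, 0, 0] (by decide) (by decide) (by decide) (by decide)
      (by decide) (by decide)
  · exact nonempty_expand_iso_of_nbrs tricorn12_adj tricorn14_adj klee_tricorn12 isCubic_tricorn14 rfl 3
      ![0, 1, 3, 0, 5, 4, 9, 8, 7, 6, 11, 10]
      ![2, 0, 0, 0, 0, 0, 0, 0, 13, 12, 0, 0] (by decide) (by decide) (by decide) (by decide)
      (by decide) (by decide)

theorem klee_tricorn14 : Klee tricorn14 := by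
  obtain ⟨φ⟩ := nonempty_expand_tricorn12_iso 2 (by decide)
  exact (klee_tricorn12.expand _).congr φ

theorem isLonely_tricorn14 : ∀ p ∈ [((4 : Fin 14), (5 : Fin 14)), (6, 7), (8, 9)],
    IsLonely tricorn14 s(p.1, p.2) := by
  simp only [List.mem_cons, List.not_mem_nil, or_false, forall_eq_or_imp, forall_eq]
  refine ⟨?_, ?_, ?_⟩
  · exact isLonely_of_extendAt tricorn14_adj (a := 4)
      ![1, 0, 13, 9, 5, 4, 12, 8, 7, 3, 11, 10, 6, 2] (by decide) (by decide)
  · exact isLonely_of_extendAt tricorn14_adj (a := 6)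
      ![2, 10, 0, 8, 9, 11, 7, 6, 3, 4, 1, 5, 13, 12] (by decide) (by decide)
  · exact isLonely_of_extendAt tricorn14_adj (a := 8)
      ![3, 11, 12, 0, 10, 6, 5, 13, 9, 8, 4, 1, 2, 7] (by decide) (by decide)

/-- For each vertex at which an expansion destroys a lonely edge, a matching that shows this. -/
def tricorn14Table : Fin 14 → Fin 14 → Fin 14 :=
  ![![0, 0, 0, 0, 5, 4, 12, 13, 9, 8, 11, 10, 6, 7], ![0, 0, 13, 9, 5, 4, 12, 8, 7, 3, 0, 0, 6,
    2], ![0, 10, 0, 8, 9, 11, 7, 6, 3, 4, 1, 5, 0, 0], ![0, 0, 0, 0, 0, 0, 0, 0, 0, 0, 0, 0, 0,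
    0], ![2, 11, 0, 8, 0, 0, 7, 6, 3, 0, 0, 1, 13, 12], ![3, 10, 12, 0, 0, 0, 0, 13, 9, 8, 1, 0,
    2, 7], ![3, 11, 13, 0, 10, 0, 0, 0, 9, 8, 4, 1, 0, 2], ![1, 0, 12, 9, 5, 4, 0, 0, 0, 3, 11,
    10, 2, 0], ![1, 0, 13, 0, 5, 4, 12, 0, 0, 0, 11, 10, 6, 2], ![2, 10, 0, 0, 0, 11, 7, 6, 0, 0,
    1, 5, 13, 12], ![3, 0, 12, 0, 0, 6, 5, 13, 9, 8, 0, 0, 2, 7], ![2, 0, 0, 8, 9, 0, 7, 6, 3, 4,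
    0, 0, 13, 12], ![1, 0, 0, 9, 5, 4, 0, 8, 7, 3, 11, 10, 0, 0], ![3, 11, 0, 0, 10, 6, 5, 0, 9,
    8, 4, 1, 0, 0]]

theorem numLonely_expand_tricorn14_lt (v : Fin 14) (hv : v ∉ ([3] : List (Fin 14))) :
    numLonely (expand tricorn14 v) < numLonely tricorn14 :=
  klee_tricorn14.numLonely_expand_lt_of_table tricorn14_adj _ isLonely_tricorn14 [3] tricorn14Table
    (by decide) (by decide) v hv

theorem isCubic_tricorn16 : IsCubic tricorn16 := isCubic_of_adj_mem _ tricorn16_adj (by decide)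

theorem nonempty_expand_tricorn14_iso (v : Fin 14) (hv : v ∈ ([3] : List (Fin 14))) :
    Nonempty (expand tricorn14 v ≃g tricorn16) := by
  simp only [List.mem_cons, List.not_mem_nil, or_false] at hv
  subst hv
  · exact nonempty_expand_iso_of_nbrs tricorn14_adj tricorn16_adj klee_tricorn14 isCubic_tricorn16 rfl 3
      ![0, 1, 2, 0, 4, 5, 6, 7, 8, 9, 10, 11, 12, 13]
      ![3, 0, 0, 0, 0, 0, 0, 0, 14, 15, 0, 0, 0, 0] (by decide) (by decide) (by decide) (by decide)
      (by decide) (by decide)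

theorem klee_tricorn16 : Klee tricorn16 := by
  obtain ⟨φ⟩ := nonempty_expand_tricorn14_iso 3 (by decide)
  exact (klee_tricorn14.expand _).congr φ

theorem isLonely_tricorn16 : ∀ p ∈ [((4 : Fin 16), (5 : Fin 16)), (6, 7), (8, 9)],
    IsLonely tricorn16 s(p.1, p.2) := by
  simp only [List.mem_cons, List.not_mem_nil, or_false, forall_eq_or_imp, forall_eq]
  refine ⟨?_, ?_, ?_⟩
  · exact isLonely_of_extendAt tricorn16_adj (a := 4)
      ![1, 0, 13, 14, 5, 4, 12, 8, 7, 15, 11, 10, 6, 2, 3, 9] (by decide) (by decide)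
  · exact isLonely_of_extendAt tricorn16_adj (a := 6)
      ![2, 10, 0, 15, 9, 11, 7, 6, 14, 4, 1, 5, 13, 12, 8, 3] (by decide) (by decide)
  · exact isLonely_of_extendAt tricorn16_adj (a := 8)
      ![3, 11, 12, 0, 10, 6, 5, 13, 9, 8, 4, 1, 2, 7, 15, 14] (by decide) (by decide)

/-- For each vertex at which an expansion destroys a lonely edge, a matching that shows this. -/
def tricorn16Table : Fin 16 → Fin 16 → Fin 16 :=
  ![![0, 0, 0, 0, 5, 4, 12, 13, 14, 15, 11, 10, 6, 7, 8, 9], ![0, 0, 13, 14, 5, 4, 12, 8, 7,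
    15, 0, 0, 6, 2, 3, 9], ![0, 10, 0, 15, 9, 11, 7, 6, 14, 4, 1, 5, 0, 0, 8, 3], ![0, 11, 12, 0,
    10, 6, 5, 13, 9, 8, 4, 1, 2, 7, 0, 0], ![2, 11, 0, 15, 0, 0, 7, 6, 14, 0, 0, 1, 13, 12, 8,
    3], ![3, 10, 12, 0, 0, 0, 0, 13, 9, 8, 1, 0, 2, 7, 15, 14], ![3, 11, 13, 0, 10, 0, 0, 0, 9,
    8, 4, 1, 0, 2, 15, 14], ![1, 0, 12, 14, 5, 4, 0, 0, 0, 15, 11, 10, 2, 0, 3, 9], ![1, 0, 13,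
    15, 5, 4, 12, 0, 0, 0, 11, 10, 6, 2, 0, 3], ![2, 10, 0, 14, 0, 11, 7, 6, 0, 0, 1, 5, 13, 12,
    3, 0], ![3, 0, 12, 0, 0, 6, 5, 13, 9, 8, 0, 0, 2, 7, 15, 14], ![2, 0, 0, 15, 9, 0, 7, 6, 14,
    4, 0, 0, 13, 12, 8, 3], ![1, 0, 0, 14, 5, 4, 0, 8, 7, 15, 11, 10, 0, 0, 3, 9], ![3, 11, 0, 0,
    10, 6, 5, 0, 9, 8, 4, 1, 0, 0, 15, 14], ![2, 10, 0, 0, 9, 11, 7, 6, 0, 4, 1, 5, 13, 12, 0,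
    0], ![1, 0, 13, 0, 5, 4, 12, 8, 7, 0, 11, 10, 6, 2, 0, 0]]

theorem numLonely_expand_tricorn16_lt (v : Fin 16) (hv : v ∉ ([] : List (Fin 16))) :
    numLonely (expand tricorn16 v) < numLonely tricorn16 :=
  klee_tricorn16.numLonely_expand_lt_of_table tricorn16_adj _ isLonely_tricorn16 [] tricorn16Table
    (by decide) (by decide) v hv

end LonelyEdge
-- The number of lonely edges in the tricorn family
namespace LonelyEdge

/-- The perfect matchings of the tricorn. -/
def tricornMatching : Fin 6 → Fin 10 → Fin 10 :=
  ![![1, 0, 6, 9, 5, 4, 2, 8, 7, 3],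
    ![1, 0, 7, 8, 9, 6, 5, 2, 3, 4],
    ![2, 4, 0, 9, 1, 6, 5, 8, 7, 3],
    ![2, 5, 0, 8, 9, 1, 7, 6, 3, 4],
    ![3, 4, 7, 0, 1, 6, 5, 2, 9, 8],
    ![3, 5, 6, 0, 9, 1, 2, 8, 7, 4]]

theorem isPM_tricornMatching (i : Fin 6) : IsPM tricorn (tricornMatching i) := by
  intro a
  rw [tricorn_adj_iff]
  revert i a
  decide

/-- Every other edge lies in two of the six listed matchings. -/
theorem mem_of_isLonely_tricorn {e : Sym2 (Fin 10)} (he : IsLonely tricorn e) :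
    e ∈ ({s(4, 5), s(6, 7), s(8, 9)} : Finset (Sym2 (Fin 10))) := by
  induction e using Sym2.ind with
  | _ a b =>
    have key : ∀ a, ∀ b ∈ tricornNbrs a,
        s(a, b) ∈ ({s(4, 5), s(6, 7), s(8, 9)} : Finset (Sym2 (Fin 10))) ∨
        ∃ i j, tricornMatching i a = b ∧ tricornMatching j a = b ∧
          ∃ c, tricornMatching i c ≠ tricornMatching j c := by
      decide
    rcases key a b ((tricorn_adj_iff a b).1 he.1) with h | ⟨i, j, h1, h2, c, h3⟩
    · exact h
    · exact absurd he (not_isLonely_of_ne (isPM_tricornMatching i) (isPM_tricornMatching j) h1 h2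
        fun e => h3 (congrFun e c))

theorem numLonely_tricorn_le : numLonely tricorn ≤ 3 := by
  have h : {e | IsLonely tricorn e} ⊆
      (({s(4, 5), s(6, 7), s(8, 9)} : Finset (Sym2 (Fin 10))) : Set (Sym2 (Fin 10))) :=
    fun e he => mem_of_isLonely_tricorn he
  refine (Set.ncard_le_ncard h (Finset.finite_toSet _)).trans ?_
  rw [Set.ncard_coe_finset]
  decide

theorem three_le_numLonely_tricorn16 : 3 ≤ numLonely tricorn16 := by
  have h : (({s(4, 5), s(6, 7), s(8, 9)} : Finset (Sym2 (Fin 16))) : Set (Sym2 (Fin 16))) ⊆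
      {e | IsLonely tricorn16 e} := by
    have := isLonely_tricorn16
    simp only [List.mem_cons, List.not_mem_nil, or_false, forall_eq_or_imp, forall_eq] at this
    simp only [Finset.coe_insert, Finset.coe_singleton]
    rintro e (rfl | rfl | rfl)
    exacts [this.1, this.2.1, this.2.2]
  refine le_trans ?_ (Set.ncard_le_ncard h (Set.toFinite _))
  rw [Set.ncard_coe_finset]
  decide

theorem numLonely_tricorn12_le : numLonely tricorn12 ≤ numLonely tricorn := by
  obtain ⟨φ⟩ := nonempty_expand_tricorn_iso 1 (by decide)
  rw [← numLonely_congr φ]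
  exact klee_tricorn.numLonely_expand_le 1

theorem numLonely_tricorn14_le : numLonely tricorn14 ≤ numLonely tricorn12 := by
  obtain ⟨φ⟩ := nonempty_expand_tricorn12_iso 2 (by decide)
  rw [← numLonely_congr φ]
  exact klee_tricorn12.numLonely_expand_le 2

theorem numLonely_tricorn16_le : numLonely tricorn16 ≤ numLonely tricorn14 := by
  obtain ⟨φ⟩ := nonempty_expand_tricorn14_iso 3 (by decide)
  rw [← numLonely_congr φ]
  exact klee_tricorn14.numLonely_expand_le 3

/-- Expansions do not increase the number, which is at most 3 at the start of the chain and at least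
3 at its end. -/
theorem numLonely_tricorn_family : numLonely tricorn = 3 ∧ numLonely tricorn12 = 3 ∧
    numLonely tricorn14 = 3 ∧ numLonely tricorn16 = 3 := by
  have := numLonely_tricorn_le
  have := numLonely_tricorn12_le
  have := numLonely_tricorn14_le
  have := numLonely_tricorn16_le
  have := three_le_numLonely_tricorn16
  omega

/-- A lost lonely edge is never compensated, so to keep three of them every expansion must be at a
neighbour of the centre not yet expanded, and symmetry makes the choice immaterial. -/
theorem IsDescendant.klee_and {W : Type} {H : SimpleGraph W} (h : IsDescendant tricorn H) :
    Klee H ∧ (numLonely H < 3 ∨ Nonempty (H ≃g tricorn12) ∨ Nonempty (H ≃g tricorn14) ∨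
      Nonempty (H ≃g tricorn16)) := by
  obtain ⟨h10, h12, h14, h16⟩ := numLonely_tricorn_family
  induction h with
  | child v =>
    refine ⟨klee_tricorn.expand v, ?_⟩
    by_cases hv : v ∈ ([1, 2, 3] : List (Fin 10))
    · exact Or.inr (Or.inl (nonempty_expand_tricorn_iso v hv))
    · exact Or.inl (h10 ▸ numLonely_expand_tricorn_lt v hv)
  | @step W H w _ ih =>
    obtain ⟨hK, ih⟩ := ih
    refine ⟨hK.expand w, ?_⟩
    rcases ih with ih | ⟨⟨φ⟩⟩ | ⟨⟨φ⟩⟩ | ⟨⟨φ⟩⟩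
    · exact Or.inl ((hK.numLonely_expand_le w).trans_lt ih)
    · by_cases hv : φ w ∈ ([2, 3] : List (Fin 12))
      · obtain ⟨ψ⟩ := nonempty_expand_tricorn12_iso _ hv
        exact Or.inr (Or.inr (Or.inl ⟨(expandIso φ w).trans ψ⟩))
      · rw [numLonely_congr (expandIso φ w)]
        exact Or.inl (h12 ▸ numLonely_expand_tricorn12_lt _ hv)
    · by_cases hv : φ w ∈ ([3] : List (Fin 14))
      · obtain ⟨ψ⟩ := nonempty_expand_tricorn14_iso _ hv
        exact Or.inr (Or.inr (Or.inr ⟨(expandIso φ w).trans ψ⟩))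
      · rw [numLonely_congr (expandIso φ w)]
        exact Or.inl (h14 ▸ numLonely_expand_tricorn14_lt _ hv)
    · rw [numLonely_congr (expandIso φ w)]
      exact Or.inl (h16 ▸ numLonely_expand_tricorn16_lt _ (by simp))

theorem exists_isDescendant_tricorn12 :
    ∃ (W : Type) (H : SimpleGraph W), IsDescendant tricorn H ∧ Nonempty (tricorn12 ≃g H) := by
  obtain ⟨φ⟩ := nonempty_expand_tricorn_iso 1 (by decide)
  exact ⟨_, _, .child 1, ⟨φ.symm⟩⟩

theorem exists_isDescendant_tricorn14 :
    ∃ (W : Type) (H : SimpleGraph W), IsDescendant tricorn H ∧ Nonempty (tricorn14 ≃g H) := by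
  obtain ⟨φ⟩ := nonempty_expand_tricorn12_iso 2 (by decide)
  obtain ⟨W, H, h, ⟨ψ⟩⟩ := exists_isDescendant_tricorn12
  exact ⟨_, _, .step _ h, ⟨φ.symm.trans (expandIso ψ 2)⟩⟩

theorem exists_isDescendant_tricorn16 :
    ∃ (W : Type) (H : SimpleGraph W), IsDescendant tricorn H ∧ Nonempty (tricorn16 ≃g H) := by
  obtain ⟨φ⟩ := nonempty_expand_tricorn14_iso 3 (by decide)
  obtain ⟨W, H, h, ⟨ψ⟩⟩ := exists_isDescendant_tricorn14
  exact ⟨_, _, .step _ h, ⟨φ.symm.trans (expandIso ψ 3)⟩⟩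

theorem isTricornDescendantInU3_of {n : ℕ} {D : SimpleGraph (Fin n)} (hD : Klee D)
    (hl : numLonely D = 3)
    (hd : ∃ (W : Type) (H : SimpleGraph W), IsDescendant tricorn H ∧ Nonempty (D ≃g H))
    {V : Type*} [Finite V] {G : SimpleGraph V} (φ : G ≃g D) : IsTricornDescendantInU3 G := by
  obtain ⟨W, H, h, ⟨ψ⟩⟩ := hd
  exact ⟨(inU3_congr φ).2 (hD.inU3_iff.2 hl), W, H, h, ⟨φ.trans ψ⟩⟩

theorem isTricornDescendantInU3_iff {V : Type*} [Finite V] {G : SimpleGraph V} :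
    IsTricornDescendantInU3 G ↔ Nonempty (G ≃g tricorn12) ∨ Nonempty (G ≃g tricorn14) ∨
      Nonempty (G ≃g tricorn16) := by
  obtain ⟨h10, h12, h14, h16⟩ := numLonely_tricorn_family
  constructor
  · rintro ⟨⟨-, -, hl⟩, W, H, h, ⟨φ⟩⟩
    rw [numLonely_congr φ] at hl
    rcases h.klee_and.2 with h | ⟨⟨ψ⟩⟩ | ⟨⟨ψ⟩⟩ | ⟨⟨ψ⟩⟩
    · omega
    · exact Or.inl ⟨φ.trans ψ⟩
    · exact Or.inr (Or.inl ⟨φ.trans ψ⟩)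
    · exact Or.inr (Or.inr ⟨φ.trans ψ⟩)
  · rintro (⟨⟨φ⟩⟩ | ⟨⟨φ⟩⟩ | ⟨⟨φ⟩⟩)
    · exact isTricornDescendantInU3_of klee_tricorn12 h12 exists_isDescendant_tricorn12 φ
    · exact isTricornDescendantInU3_of klee_tricorn14 h14 exists_isDescendant_tricorn14 φ
    · exact isTricornDescendantInU3_of klee_tricorn16 h16 exists_isDescendant_tricorn16 φ

/-! ### The classification -/

theorem four_le_numLonely_top : 4 ≤ numLonely (⊤ : SimpleGraph (Fin 4)) := by
  have key : ∀ a b : Fin 4, a ≠ b → IsLonely (⊤ : SimpleGraph (Fin 4)) s(a, b) := by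
    intro a b hab
    obtain ⟨σ, ⟨hσ, rfl⟩, hu⟩ := existsUnique_isPM_top hab
    exact hσ.isLonely_iff.2 fun τ hτ e => hu τ ⟨hτ, e⟩
  have h : (({s(0, 1), s(0, 2), s(0, 3), s(1, 2)} : Finset (Sym2 (Fin 4))) : Set (Sym2 (Fin 4))) ⊆
      {e | IsLonely (⊤ : SimpleGraph (Fin 4)) e} := by
    simp only [Finset.coe_insert, Finset.coe_singleton]
    rintro e (rfl | rfl | rfl | rfl) <;> exact key _ _ (by decide)
  refine le_trans ?_ (Set.ncard_le_ncard h (Set.toFinite _))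
  rw [Set.ncard_coe_finset]
  decide

theorem IsExtension.congr {W U : Type*} {H : SimpleGraph W} {K : SimpleGraph U} (φ : K ≃g H)
    (p : List (Fin 3)) : ∀ {V : Type} {G : SimpleGraph V} {x : Fin 3 → V},
      IsExtension G x p H → IsExtension G x p K := by
  induction p with
  | nil => exact fun ⟨ψ⟩ => ⟨φ.trans ψ⟩
  | cons s p ih => exact fun ⟨x', h1, h2⟩ => ⟨x', h1, ih h2⟩

theorem IsExtendedPrism.congr {W U : Type*} {H : SimpleGraph W} {K : SimpleGraph U} (φ : K ≃g H)
    {p : List (Fin 3)} (h : IsExtendedPrism H p) : IsExtendedPrism K p := by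
  obtain ⟨x, h1, h2⟩ := h
  exact ⟨x, h1, h2.congr φ p⟩

theorem InU3.exists_isExtendedPrism_or {V : Type*} [Finite V] {G : SimpleGraph V} (h : InU3 G) :
    (∃ p, IsExtendedPrism G p) ∨ Nonempty (G ≃g tricorn) ∨ IsTricornDescendantInU3 G := by
  -- Klee graphs live in `Type`, so `G` is first copied to `Fin n`.
  obtain ⟨n, ⟨f⟩⟩ := Finite.exists_equiv_fin V
  have e : G ≃g G.map f.toEmbedding := SimpleGraph.Iso.map f G
  have h' := h.congr e
  generalize G.map f.toEmbedding = G' at e h'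
  cases klee_of_inU3 h' with
  | base φ =>
    have h1 := four_le_numLonely_top
    have h2 := h'.2.2
    rw [numLonely_congr φ] at h2
    omega
  | @step _ W _ K z hK ψ =>
    -- Having excluded `K₄`, which has too many lonely edges, the graph is `K^z` for a Klee graph
    -- `K`, and the dichotomy between towers and the tricorn family applies.
    rcases hK.isTower_or _ rfl z with hT | hT | ⟨U, H, hd, ⟨φ⟩⟩
    · obtain ⟨p, hp⟩ := hT.isExtendedPrism
      exact Or.inl ⟨p, hp.congr (e.trans ψ)⟩
    · obtain ⟨φ⟩ := hT
      exact Or.inr (Or.inl ⟨(e.trans ψ).trans φ⟩)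
    · exact Or.inr (Or.inr ⟨h, U, H, hd, ⟨(e.trans ψ).trans φ⟩⟩)

theorem inU3_iff_inW3_or {V : Type*} [Finite V] {G : SimpleGraph V} : InU3 G ↔ InW3 G ∨
    ∃ k h : ℕ, 3 ≤ k ∧ 1 ≤ h ∧ h ≤ k ∧ IsExtendedPrism G
      (List.replicate (h - 1) i3 ++ [i2] ++ List.replicate (k - h) i1) := by
  constructor
  · intro hU
    rcases hU.exists_isExtendedPrism_or with ⟨p, hp⟩ | h | h
    · obtain ⟨π, hπ, rfl | ⟨k, h, h1, h2, h3, rfl⟩⟩ :=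
        exists_relabelling_of_patternCount_eq_three (hp.inU3_iff.1 hU)
      · exact Or.inl (Or.inr (Or.inr (hp.relabel hπ)))
      · exact Or.inr ⟨k, h, h1, h2, h3, hp.relabel hπ⟩
    · exact Or.inl (Or.inl h)
    · exact Or.inl (Or.inr (Or.inl h))
  · rintro ((⟨⟨φ⟩⟩ | h | h) | ⟨k, h, h1, h2, h3, hp⟩)
    · exact (inU3_congr φ).2 (klee_tricorn.inU3_iff.2 numLonely_tricorn_family.1)
    · exact h.1
    · exact h.inU3_iff.2 (by decide)
    · exact hp.inU3_iff.2 (patternCount_family h1 h2 h3)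

/-- The vertex sets of the descendants of the tricorn in `𝒰₃`. -/
def TricornDescendantVert (i : Fin 3) : Type := Fin (12 + 2 * i)

/-- The descendants of the tricorn in `𝒰₃`. -/
def tricornDescendant : ∀ i, SimpleGraph (TricornDescendantVert i)
  | 0 => tricorn12
  | 1 => tricorn14
  | 2 => tricorn16

theorem isEmpty_tricornDescendant_iso {i j : Fin 3} (h : i ≠ j) :
    IsEmpty (tricornDescendant i ≃g tricornDescendant j) := by
  refine ⟨fun φ => h ?_⟩
  have : Nat.card (Fin (12 + 2 * i)) = Nat.card (Fin (12 + 2 * j)) := Nat.card_congr φ.toEquiv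
  simp only [Nat.card_eq_fintype_card, Fintype.card_fin] at this
  omega

end LonelyEdge
/-- The tricorn has, up to isomorphism, exactly three descendants in `𝒰₃`; and a finite graph lies in
`𝒰₃` if and only if it lies in `𝒲₃` or is an extended prism with pattern
`(3, …, 3, 2, 1, …, 1)`, with `h - 1` threes and `k - h` ones, for some `k ≥ 3` and `1 ≤ h ≤ k`. -/
theorem mainTheorem2 :
    (∃ (W : Fin 3 → Type) (D : ∀ i, SimpleGraph (W i)),
      (∀ i j, i ≠ j → IsEmpty (D i ≃g D j)) ∧
      ∀ (V : Type*) [Finite V] (G : SimpleGraph V),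
        LonelyEdge.IsTricornDescendantInU3 G ↔ ∃ i, Nonempty (G ≃g D i)) ∧
    ∀ (V : Type*) [Finite V] (G : SimpleGraph V),
      LonelyEdge.InU3 G ↔
        LonelyEdge.InW3 G ∨
        ∃ k h : ℕ, 3 ≤ k ∧ 1 ≤ h ∧ h ≤ k ∧
          LonelyEdge.IsExtendedPrism G
            (List.replicate (h - 1) LonelyEdge.i3 ++ [LonelyEdge.i2] ++
              List.replicate (k - h) LonelyEdge.i1) := by
  refine ⟨⟨LonelyEdge.TricornDescendantVert, LonelyEdge.tricornDescendant,
    fun i j => LonelyEdge.isEmpty_tricornDescendant_iso, fun V _ G => ?_⟩,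
    fun V _ G => LonelyEdge.inU3_iff_inW3_or⟩
  rw [LonelyEdge.isTricornDescendantInU3_iff]
  constructor
  · rintro (h | h | h)
    exacts [⟨0, h⟩, ⟨1, h⟩, ⟨2, h⟩]
  · rintro ⟨i, h⟩
    fin_cases i
    exacts [Or.inl h, Or.inr (Or.inl h), Or.inr (Or.inr h)]
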